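/- \textbf{Setting.} Let $M$ be a (connected) Riemann surface, $n\in\mathbb N$, $r=2s$ with $s\in\mathbb N$. For a subgroup $G\subseteq \mathrm U(n)$, $\Omega G$ is the group of smooth loops $\gamma:S^1\to G$ with $\gamma(1)=I$. $\Omega_r\mathrm U(n)$ is the set of $\gamma\in\Omega \mathrm U(n)$ of the form $\gamma=\sum_{k=0}^r\lambda^kT_k$, and $\Omega_r\mathrm U(n)^{\mathbb R}$ is the set of those with $\overline{\gamma}=\lambda^{-r}\gamma$. A smooth $\Phi:M\to\Omega G$ is an \emph{extended solution} if in each local holomorphic coordinate $z$ one has $\Phi^{-1}\Phi_z=(1-\lambda^{-1})A$ with $A$ a map into $\mathfrak g^{\mathbb C}$ not depending on $\lambda$. For $\varphi:M\to \mathrm U(n)$ put $A^\varphi_z=\frac12\varphi^{-1}\varphi_z$, $A^\varphi_{\bar z}=\frac12\varphi^{-1}\varphi_{\bar z}$. A \emph{uniton} for an extended solution $\Phi:M\to\Omega\mathrm U(n)$ is a smooth subbundle $\alpha$ of $M\times\mathbb C^n$ such that, with $\varphi=\Phi_{-1}$, sections of $\alpha$ are mapped to sections of $\alpha$ by $\partial_{\bar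 z}+A^\varphi_{\bar z}$ and by $A^\varphi_z$. A \emph{uniton factorization} is $\Phi=\eta_1\cdots\eta_r$, $\eta_i=\pi_{\alpha_i}+\lambda\pi_{\alpha_i}^\perp$, where each $\Phi_{i-1}=\eta_1\cdots\eta_{i-1}$ is an extended solution and $\alpha_i$ is a uniton for it. Let $\mathcal H=L^2(S^1,\mathbb C^n)$, $P_m:\mathcal H\to\mathbb C^n$ the $m$-th Fourier coefficient, $\mathcal H_+=\{f: P_mf=0\ \forall m<0\}$, $W=\Phi\mathcal H_+$, $W_i=\Phi_i\mathcal H_+$, and let $S^{i}_t$ be the adjoint of the coefficient of $\lambda^t$ in $\Phi_i$. ``Generically'' means: at all points of $M$ outside a closed discrete set (on which bundles are extended continuously). The filtration $(W_i)$ is \emph{alternating} if, for $i=r,r-1,\dots,1$, one has generically, in turn, $W_{i-1}=\lambda^{-1}W_i\cap\mathcal H_+$ (Uhlenbeck step) and $W_{i-1}=W_i+\lambda^{i-1}\mathcal H_+$ (Segal step), starting with either kind. The number of Uhlenbeck steps from $W_r$ to $W_i$ is $u_i=\lfloor (r-i+1)/2\rfloor$ if one starts with an Uhlenbeck step and $u_i=\lfloor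 (r-i)/2\rfloor$ if one starts with a Segal step. A holomorphic subbundle $X$ of $M\times\mathbb C^{rn}\cong M\times(\mathcal H_+/\lambda^r\mathcal H_+)$ \emph{generates} $W$ if generically $W=X+\lambda X_{(1)}+\dots+\lambda^{r-1}X_{(r-1)}+\lambda^r\mathcal H_+$, where $X_{(k)}$ is spanned by the derivatives of order $\le k$ of local holomorphic sections of $X$. A \emph{meromorphic spanning set} $L^1,\dots,L^m$ of $X$ consists of meromorphic sections spanning $X$ generically. Write $L^j=\sum_t\lambda^tL^j_t$ with $L^j_t=0$ unless $0\le t<r$; for $L^j\not\equiv0$ let $o(j)$ be the least $t$ with $L^j_t\not\equiv0$, and let $\widehat L^j_t=L^j_{t+o(j)}$. Superscripts $(k)$ denote $k$-th derivatives in a local holomorphic coordinate. Zero sections $L^j$ are omitted. Call $(L^j)$ \emph{adapted at level $u$} if generically $W\cap\lambda^u\mathcal H_+$ is spanned modulo $\lambda^r\mathcal H_+$ by the sections $\lambda^l(L^j)^{(k)}$ with $0\le k\le l$ and $o(j)+l\ge u$. \textbf{Theorem.} Let $\Phi:M\to\Omega_r\mathrm U(n)$. (A) $\Phi$ is an extended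 solution with values in $\Omega_r\mathrm U(n)^{\mathbb R}$ if and only if $\lambda^{-s}\Phi$ is an extended solution $M\to\Omega\mathrm O(n)$. (B) Suppose this is the case. Then there is a uniton factorization $\Phi=\eta_1\cdots\eta_r$ whose filtration $(W_i)$ is the alternating one starting with an Uhlenbeck step, and also one for which it is the alternating one starting with a Segal step. For each of them: (i) each $\eta_{2\ell-1}\eta_{2\ell}$ has values in $\Omega_2\mathrm U(n)^{\mathbb R}$ $(\ell=1,\dots,s)$; (ii) each $\eta_1\cdots\eta_{2j}$ has values in $\Omega_{2j}\mathrm U(n)^{\mathbb R}$ $(j=1,\dots,s)$; (iii) for $i=1,\dots,r$ and $u=u_i$, generically $$\alpha_i=\Bigl(\sum_{t=0}^{i-1}S^{i-1}_tP_t\Bigr)\bigl((\lambda^{-u}W\cap\mathcal H_+)+\lambda^i\mathcal H_+\bigr);$$ (iv) for every holomorphic $X$ generating $W$, every finite meromorphic spanning set $(L^j)$ of $X$, and $i=1,\dots,r$, $u=u_i$: if $u=0$ or $(L^j)$ is adapted at level $u$, then generically (and for every local coordinate) $$\alpha_i=\operatorname{span}\Bigl\{\sum_{t=0}^{i-1}S_t^{i-1}(L^j_{t-k+u})^{(k)}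 : 0\le o(j)+k-u\le i-1\Bigr\}+\operatorname{span}\Bigl\{\sum_{t=0}^{i-1}S_t^{i-1}(\widehat L^j_t)^{(k)} : o(j)+k-u<0\Bigr\},$$ and for arbitrary $(L^j)$ the right-hand side is generically contained in $\alpha_i$. Moreover, there are a holomorphic $X$ generating $W$ and a finite meromorphic spanning set of $X$ adapted at all levels $0\le u\le r$. -/

import Mathlib

open MeasureTheory Filter Topology
open scoped Manifold ContDiff Matrix Polynomial

noncomputable section

namespace UnitonFact

/-- `ℂⁿ` with its standard Hermitian inner product. -/
abbrev E (n : ℕ) := EuclideanSpace ℂ (Fin n)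

/-- Complex `n × n` matrices. -/
abbrev Mat (n : ℕ) := Matrix (Fin n) (Fin n) ℂ

/-! ### Loop groups -/

/-- The unitary group `U(n)`. -/
def unitaryMats (n : ℕ) : Set (Mat n) := {A | A ∈ Matrix.unitaryGroup (Fin n) ℂ}

/-- The orthogonal group `O(n)` as a set of complex matrices. -/
def orthogonalMats (n : ℕ) : Set (Mat n) :=
  {A | ∃ B ∈ Matrix.orthogonalGroup (Fin n) ℝ, A = B.map (fun x : ℝ => (x : ℂ))}

/-- The complexified Lie algebra `so(n, ℂ)` of `O(n)`. -/
def skewMats (n : ℕ) : Set (Mat n) := {A | Aᵀ = -A}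

/-- The based loop group `Ω G`: smooth loops `γ : S¹ → G` with `γ(1) = e`. -/
def OmegaG {n : ℕ} (G : Set (Mat n)) : Set (Circle → Mat n) :=
  {γ | (∀ z, γ z ∈ G) ∧ γ 1 = 1 ∧
    ∀ a b, ContMDiff (𝓡 1) 𝓘(ℝ, ℂ) ∞ (fun z => γ z a b)}

/-- `Ω_r U(n)`: based loops in `U(n)` which are polynomials of degree at most `r` in `λ`. -/
def OmegaPoly (r n : ℕ) : Set (Circle → Mat n) :=
  {γ | γ ∈ OmegaG (unitaryMats n) ∧
    ∃ T : ℕ → Mat n, ∀ z : Circle, γ z = ∑ k ∈ Finset.range (r + 1), (z : ℂ) ^ k • T k}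

/-- `Ω_r U(n)^ℝ`: those `γ ∈ Ω_r U(n)` with `conj γ = λ^{-r} γ`. -/
def OmegaReal (r n : ℕ) : Set (Circle → Mat n) :=
  {γ | γ ∈ OmegaPoly r n ∧
    ∀ z : Circle, (γ z).map (starRingEnd ℂ) = ((z : ℂ) ^ (-(r : ℤ))) • γ z}

/-! ### The Grassmannian model -/

/-- The Hilbert space `H = L²(S¹, ℂⁿ)`; the circle is parametrised by `t ↦ λ = e^{2πit}`
and carries its invariant probability measure. -/
abbrev H (n : ℕ) := Lp (E n) 2 (AddCircle.haarAddCircle (T := (1 : ℝ)))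

theorem integrable_fourier_smul {n : ℕ} (m : ℤ) (f : H n) :
    Integrable (fun t : AddCircle (1 : ℝ) => fourier (-m) t • f t)
      (AddCircle.haarAddCircle (T := (1 : ℝ))) := by
  have h1 : Integrable (fun t : AddCircle (1 : ℝ) => f t)
      (AddCircle.haarAddCircle (T := (1 : ℝ))) :=
    (Lp.memLp f).integrable (by norm_num)
  have h2 : Continuous (fun t : AddCircle (1 : ℝ) => (fourier (-m) t : ℂ)) :=
    map_continuous (fourier (-m))
  refine h1.mono (h2.aestronglyMeasurable.smul h1.aestronglyMeasurable) ?_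
  refine Eventually.of_forall fun t => ?_
  rw [norm_smul, fourier_apply, Circle.norm_coe, one_mul]

/-- The projection `P_m : H → ℂⁿ`, `∑ λ^i L_i ↦ L_m`. -/
def P {n : ℕ} (m : ℤ) : H n →ₗ[ℂ] E n where
  toFun f := fourierCoeff (fun t : AddCircle (1 : ℝ) => f t) m
  map_add' f g := by
    unfold fourierCoeff
    rw [← integral_add (integrable_fourier_smul m f) (integrable_fourier_smul m g)]
    refine integral_congr_ae ?_
    filter_upwards [Lp.coeFn_add f g] with t ht
    rw [ht, Pi.add_apply, smul_add]
  map_smul' c f := by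
    unfold fourierCoeff
    rw [RingHom.id_apply, ← integral_smul c]
    refine integral_congr_ae ?_
    filter_upwards [Lp.coeFn_smul c f] with t ht
    rw [ht, Pi.smul_apply, smul_smul, smul_smul, mul_comm]

/-- `H₊`: the functions all of whose Fourier coefficients of negative index vanish. -/
def Hplus (n : ℕ) : Submodule ℂ (H n) := ⨅ m : {m : ℤ // m < 0}, LinearMap.ker (P m.1)

/-- `γ V`: the image of the subspace `V ⊆ H` under pointwise multiplication by the loop `γ`. -/
def loopImage {n : ℕ} (γ : Circle → Mat n) (V : Submodule ℂ (H n)) : Submodule ℂ (H n) where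
  carrier := {f | ∃ g ∈ V, ∀ᵐ t ∂(AddCircle.haarAddCircle (T := (1 : ℝ))),
    f t = Matrix.toEuclideanLin (γ t.toCircle) (g t)}
  add_mem' := by
    rintro f f' ⟨g, hg, h⟩ ⟨g', hg', h'⟩
    refine ⟨g + g', V.add_mem hg hg', ?_⟩
    filter_upwards [h, h', Lp.coeFn_add f f', Lp.coeFn_add g g'] with t h1 h2 h3 h4
    rw [h3, h4, Pi.add_apply, Pi.add_apply, h1, h2, map_add]
  zero_mem' := by
    refine ⟨0, V.zero_mem, ?_⟩
    filter_upwards [Lp.coeFn_zero (E n) 2 (AddCircle.haarAddCircle (T := (1 : ℝ)))] with t h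
    rw [h, Pi.zero_apply, map_zero]
  smul_mem' := by
    rintro c f ⟨g, hg, h⟩
    refine ⟨c • g, V.smul_mem c hg, ?_⟩
    filter_upwards [h, Lp.coeFn_smul c f, Lp.coeFn_smul c g] with t h1 h2 h3
    rw [h2, h3, Pi.smul_apply, Pi.smul_apply, h1, map_smul]

/-- The scalar loop `λ^k`. -/
def lamPow (n : ℕ) (k : ℤ) : Circle → Mat n := fun z => ((z : ℂ) ^ k) • 1

/-- `λ^k V`. -/
def shift {n : ℕ} (k : ℤ) (V : Submodule ℂ (H n)) : Submodule ℂ (H n) :=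
  loopImage (lamPow n k) V

/-- The Grassmannian model `W = γ H₊` of `γ`. -/
def grass {n : ℕ} (γ : Circle → Mat n) : Submodule ℂ (H n) := loopImage γ (Hplus n)

/-- The `s`-th Fourier coefficient of a matrix valued loop; for `γ = ∑ λ^k T_k` it is `T_s`. -/
def loopCoeff {n : ℕ} (γ : Circle → Mat n) (s : ℤ) : Mat n :=
  Matrix.of fun a b => fourierCoeff (fun t : AddCircle (1 : ℝ) => γ t.toCircle a b) s

/-- `ℂ^{rn} ≅ H₊ / λ^r H₊`: the element `(v_0, …, v_{r-1})` stands for `∑ λ^i v_i`. -/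
abbrev Coef (r n : ℕ) := Fin r → E n

/-- The `m`-th coefficient of an element of `ℂ^{rn}`; it is zero unless `0 ≤ m < r`. -/
def coeff {r n : ℕ} (v : Coef r n) (m : ℤ) : E n :=
  if h : 0 ≤ m ∧ m.toNat < r then v ⟨m.toNat, h.2⟩ else 0

/-- The element `λ^k ∑ λ^i v_i` of `H`. -/
def laurent {r n : ℕ} (k : ℕ) (v : Coef r n) : H n :=
  ContinuousMap.toLp 2 (AddCircle.haarAddCircle (T := (1 : ℝ))) ℂ
    ⟨fun t => ∑ i : Fin r, ((t.toCircle : Circle) : ℂ) ^ (k + (i : ℕ)) • v i, by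
      have : Continuous (fun t : AddCircle (1 : ℝ) => ((t.toCircle : Circle) : ℂ)) :=
        continuous_subtype_val.comp AddCircle.continuous_toCircle
      fun_prop⟩

section Surface

variable {M : Type*} [TopologicalSpace M] [ChartedSpace ℂ M]

/-! ### Extended solutions and unitons -/

/-- `∂f/∂z` at `p` with respect to the complex coordinate `z = e`. -/
def dz {V : Type*} [NormedAddCommGroup V] [NormedSpace ℝ V] [NormedSpace ℂ V]
    (e : OpenPartialHomeomorph M ℂ) (f : M → V) (p : M) : V :=
  (1 / 2 : ℂ) • (fderiv ℝ (f ∘ e.symm) (e p) 1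
    - Complex.I • fderiv ℝ (f ∘ e.symm) (e p) Complex.I)

/-- `∂f/∂z̄` at `p` with respect to the complex coordinate `z = e`. -/
def dzbar {V : Type*} [NormedAddCommGroup V] [NormedSpace ℝ V] [NormedSpace ℂ V]
    (e : OpenPartialHomeomorph M ℂ) (f : M → V) (p : M) : V :=
  (1 / 2 : ℂ) • (fderiv ℝ (f ∘ e.symm) (e p) 1
    + Complex.I • fderiv ℝ (f ∘ e.symm) (e p) Complex.I)

/-- Entrywise `∂/∂z` of a matrix valued map. -/
def dzMat {n : ℕ} (e : OpenPartialHomeomorph M ℂ) (f : M → Mat n) (p : M) : Mat n :=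
  Matrix.of fun a b => dz e (fun q => f q a b) p

/-- Entrywise `∂/∂z̄` of a matrix valued map. -/
def dzbarMat {n : ℕ} (e : OpenPartialHomeomorph M ℂ) (f : M → Mat n) (p : M) : Mat n :=
  Matrix.of fun a b => dzbar e (fun q => f q a b) p

/-- `Φ : M → Ω G` is an extended solution: it is smooth (as a map on `M × S¹`), and in every local
holomorphic coordinate `z` one has `Φ⁻¹ Φ_z = (1 - λ⁻¹) A` for a map `A` into `gC`, the
complexified Lie algebra of `G`. -/
def IsExtendedSolution {n : ℕ} (G gC : Set (Mat n)) (Φ : M → Circle → Mat n) : Prop :=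
  (∀ p, Φ p ∈ OmegaG G) ∧
  (∀ a b, ContMDiff (𝓘(ℝ, ℂ).prod (𝓡 1)) 𝓘(ℝ, ℂ) ∞
    (fun x : M × Circle => Φ x.1 x.2 a b)) ∧
  ∀ e ∈ IsManifold.maximalAtlas 𝓘(ℂ) ω M, ∃ A : M → Mat n, ∀ p ∈ e.source,
    A p ∈ gC ∧ ∀ z : Circle,
      (Φ p z)⁻¹ * dzMat e (fun q => Φ q z) p = (1 - ((z : ℂ))⁻¹) • A p

/-- Extended solutions into `Ω U(n)`; here `gC = gl(n, ℂ)`. -/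
def IsExtendedSolutionU {n : ℕ} (Φ : M → Circle → Mat n) : Prop :=
  IsExtendedSolution (unitaryMats n) Set.univ Φ

/-- Extended solutions into `Ω O(n)`; here `gC = so(n, ℂ)`. -/
def IsExtendedSolutionO {n : ℕ} (Φ : M → Circle → Mat n) : Prop :=
  IsExtendedSolution (orthogonalMats n) (skewMats n) Φ

/-- `A^φ_z = ½ φ⁻¹ φ_z`. -/
def Az {n : ℕ} (e : OpenPartialHomeomorph M ℂ) (φ : M → Mat n) (p : M) : Mat n :=
  (1 / 2 : ℂ) • ((φ p)⁻¹ * dzMat e φ p)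

/-- `A^φ_z̄ = ½ φ⁻¹ φ_z̄`. -/
def Azbar {n : ℕ} (e : OpenPartialHomeomorph M ℂ) (φ : M → Mat n) (p : M) : Mat n :=
  (1 / 2 : ℂ) • ((φ p)⁻¹ * dzbarMat e φ p)

/-- A smooth subbundle of the trivial bundle `M × ℂⁿ`: locally it has a smooth frame. -/
def IsSmoothSubbundle {n : ℕ} (α : M → Submodule ℂ (E n)) : Prop :=
  ∀ p : M, ∃ U : Set M, IsOpen U ∧ p ∈ U ∧ ∃ (k : ℕ) (f : Fin k → M → E n),
    (∀ i, ContMDiffOn 𝓘(ℝ, ℂ) 𝓘(ℝ, E n) ∞ (f i) U) ∧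
    ∀ q ∈ U, LinearIndependent ℂ (fun i => f i q) ∧
      α q = Submodule.span ℂ (Set.range fun i => f i q)

/-- `α` is a uniton for `φ : M → U(n)`: a smooth subbundle of the trivial bundle, holomorphic for
the structure with `∂̄`-operator `D_z̄ = ∂_z̄ + A^φ_z̄`, and closed under `A^φ_z`. -/
def IsUniton {n : ℕ} (φ : M → Mat n) (α : M → Submodule ℂ (E n)) : Prop :=
  IsSmoothSubbundle α ∧
  ∀ e ∈ IsManifold.maximalAtlas 𝓘(ℂ) ω M, ∀ U : Set M, IsOpen U → U ⊆ e.source →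
    ∀ σ : M → E n, ContMDiffOn 𝓘(ℝ, ℂ) 𝓘(ℝ, E n) ∞ σ U → (∀ q ∈ U, σ q ∈ α q) →
      ∀ p ∈ U,
        dzbar e σ p + Matrix.toEuclideanLin (Azbar e φ p) (σ p) ∈ α p ∧
        Matrix.toEuclideanLin (Az e φ p) (σ p) ∈ α p

/-- The matrix of the orthogonal projection onto a subspace of `ℂⁿ`. -/
def projMat {n : ℕ} (V : Submodule ℂ (E n)) : Mat n :=
  Matrix.toEuclideanLin.symm (V.starProjection : E n →ₗ[ℂ] E n)

/-- The loop `π_V + λ π_V^⊥`. -/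
def eta {n : ℕ} (V : Submodule ℂ (E n)) : Circle → Mat n :=
  fun z => projMat V + (z : ℂ) • projMat Vᗮ

/-- The partial product `Φ_i = (π_{α_1} + λ π_{α_1}^⊥) ⋯ (π_{α_i} + λ π_{α_i}^⊥)`. -/
def partialProd {n : ℕ} (α : ℕ → M → Submodule ℂ (E n)) : ℕ → M → Circle → Mat n
  | 0 => fun _ _ => 1
  | i + 1 => fun p z => partialProd α i p z * eta (α (i + 1) p) z

/-- `Φ = η_1 ⋯ η_r` is a uniton factorization: each partial product `Φ_{i-1}` is an extended
solution and `α_i` is a uniton for it, i.e. for the harmonic map obtained at `λ = -1`. -/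
def IsUnitonFactorization {n : ℕ} (r : ℕ) (Φ : M → Circle → Mat n)
    (α : ℕ → M → Submodule ℂ (E n)) : Prop :=
  Φ = partialProd α r ∧
  ∀ i, 1 ≤ i → i ≤ r → IsExtendedSolutionU (partialProd α (i - 1)) ∧
    IsUniton (fun p => partialProd α (i - 1) p (-1)) (α i)

/-! ### The alternating filtration -/

/-- The number `u` of Uhlenbeck steps among the first `r - i` steps of the alternating filtration,
which starts with an Uhlenbeck step if `startU` is true and with a Segal step otherwise. -/
def altCount (startU : Bool) (r i : ℕ) : ℕ := if startU then (r - i + 1) / 2 else (r - i) / 2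

/-- `Φ_0, …, Φ_r` corresponds to the alternating filtration `W_i = Φ_i H₊` of `W = Φ_r H₊`: going
down from `W_r`, the passages from `W_i` to `W_{i-1}` are alternately the Uhlenbeck step
`(λ⁻¹ W_i) ∩ H₊` and the Segal step `W_i + λ^{i-1} H₊`. As usual for bundles, the equalities hold
away from a closed discrete set, across which the right-hand sides are extended as bundles. -/
def IsAlternatingFiltration {n : ℕ} (startU : Bool) (r : ℕ) (Φ : ℕ → M → Circle → Mat n) : Prop :=
  ∀ i, 1 ≤ i → i ≤ r → ∀ᶠ p in codiscrete M,
    ((startU = true ↔ Even (r - i)) →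
      grass (Φ (i - 1) p) = shift (-1) (grass (Φ i p)) ⊓ Hplus n) ∧
    (¬ (startU = true ↔ Even (r - i)) →
      grass (Φ (i - 1) p) = grass (Φ i p) ⊔ shift ((i : ℤ) - 1) (Hplus n))

/-- `λ^{-u} W ∩ H₊ + λ^i H₊`. -/
def stepSpace {n : ℕ} (W : Submodule ℂ (H n)) (u i : ℕ) : Submodule ℂ (H n) :=
  (shift (-(u : ℤ)) W ⊓ Hplus n) ⊔ shift (i : ℤ) (Hplus n)

/-! ### Meromorphic data -/

/-- A meromorphic map from the Riemann surface to a complex vector space. -/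
def IsMeromorphic {V : Type*} [NormedAddCommGroup V] [NormedSpace ℂ V] (f : M → V) : Prop :=
  ∀ p : M, MeromorphicAt (f ∘ (chartAt ℂ p).symm) (chartAt ℂ p p)

/-- A holomorphic subbundle of the trivial bundle `M × ℂ^{rn}`: locally it has a holomorphic
frame. -/
def IsHolomorphicSubbundle {r n : ℕ} (X : M → Submodule ℂ (Coef r n)) : Prop :=
  ∀ p : M, ∃ U : Set M, IsOpen U ∧ p ∈ U ∧ ∃ (k : ℕ) (f : Fin k → M → Coef r n),
    (∀ i, MDifferentiableOn 𝓘(ℂ) 𝓘(ℂ, Coef r n) (f i) U) ∧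
    ∀ q ∈ U, LinearIndependent ℂ (fun i => f i q) ∧
      X q = Submodule.span ℂ (Set.range fun i => f i q)

/-- The `k`-th derivative of `f` at `p` with respect to the complex coordinate `e`. -/
def cderiv {V : Type*} [NormedAddCommGroup V] [NormedSpace ℂ V]
    (e : OpenPartialHomeomorph M ℂ) (k : ℕ) (f : M → V) (p : M) : V :=
  iteratedDeriv k (f ∘ e.symm) (e p)

/-- The span at `p` of the derivatives of order at most `k` of local holomorphic sections of `X`;
away from a discrete set this is the fibre of the osculating bundle `X_(k)`. -/
def osculating {r n : ℕ} (X : M → Submodule ℂ (Coef r n)) (k : ℕ) (p : M) :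
    Submodule ℂ (Coef r n) :=
  Submodule.span ℂ {v | ∃ e ∈ IsManifold.maximalAtlas 𝓘(ℂ) ω M, p ∈ e.source ∧
    ∃ U : Set M, IsOpen U ∧ p ∈ U ∧ ∃ σ : M → Coef r n,
      MDifferentiableOn 𝓘(ℂ) 𝓘(ℂ, Coef r n) σ U ∧ (∀ q ∈ U, σ q ∈ X q) ∧
      ∃ l ≤ k, v = cderiv e l σ p}

/-- `X` generates `W`: `W = X + λ X_(1) + ⋯ + λ^{r-1} X_(r-1) + λ^r H₊`. -/
def Generates {r n : ℕ} (X : M → Submodule ℂ (Coef r n)) (W : M → Submodule ℂ (H n)) : Prop :=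
  ∀ᶠ p in codiscrete M, W p =
    Submodule.span ℂ {f | ∃ k < r, ∃ v ∈ osculating X k p, f = laurent k v}
      ⊔ shift (r : ℤ) (Hplus n)

/-- `L^1, …, L^m` is a meromorphic spanning set for `X`. -/
def IsMeromorphicSpanningSet {r n m : ℕ} (X : M → Submodule ℂ (Coef r n))
    (L : Fin m → M → Coef r n) : Prop :=
  (∀ j, IsMeromorphic (L j)) ∧
  ∀ᶠ p in codiscrete M, X p = Submodule.span ℂ (Set.range fun j => L j p)

/-- The order of `L` is `o`: the least `i` such that `P_i L` is not identically zero. (The zero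
section has no order.) -/
def HasOrder {r n : ℕ} (L : M → Coef r n) (o : ℕ) : Prop :=
  (∀ i < o, ∀ᶠ p in codiscrete M, coeff (L p) i = 0) ∧
  ¬ ∀ᶠ p in codiscrete M, coeff (L p) o = 0

/-- The spanning set `L` is adapted to the order filtration of `W` at level `u`: away from a
discrete set, `W ∩ λ^u H₊` is spanned, modulo `λ^r H₊`, by those of the sections
`λ^l (L^j)^{(k)}` (`0 ≤ k ≤ l`) of `W` for which `o(j) + l ≥ u`. -/
def IsAdapted {r n m : ℕ} (W : M → Submodule ℂ (H n)) (L : Fin m → M → Coef r n) (u : ℕ) : Prop :=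
  ∀ᶠ p in codiscrete M, ∀ e ∈ IsManifold.maximalAtlas 𝓘(ℂ) ω M, p ∈ e.source →
    W p ⊓ shift (u : ℤ) (Hplus n) =
      Submodule.span ℂ {f | ∃ (j : Fin m) (k l o : ℕ), HasOrder (L j) o ∧ k ≤ l ∧ u ≤ o + l ∧
        f = laurent l (cderiv e k (L j) p)} ⊔ shift (r : ℤ) (Hplus n)

/-- The span at `p` of
`∑_{s<i} S_s (L^j_{s-k+u})^{(k)}` for `0 ≤ o(j) + k - u ≤ i - 1`, and
`∑_{s<i} S_s (L̂^j_s)^{(k)}` for `o(j) + k - u < 0`, where `L^j = λ^{o(j)} L̂^j` and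
`S_s` is the adjoint of the coefficient `T_s` of `λ^s` in the loop `γ`. -/
def explicitSpan {r n m : ℕ} (γ : Circle → Mat n) (e : OpenPartialHomeomorph M ℂ)
    (L : Fin m → M → Coef r n) (u i : ℕ) (p : M) : Submodule ℂ (E n) :=
  Submodule.span ℂ {v | ∃ (j : Fin m) (k o : ℕ), HasOrder (L j) o ∧
      0 ≤ (o : ℤ) + k - u ∧ (o : ℤ) + k - u ≤ (i : ℤ) - 1 ∧
      v = ∑ s ∈ Finset.range i, Matrix.toEuclideanLin (loopCoeff γ s)ᴴ
        (cderiv e k (fun q => coeff (L j q) ((s : ℤ) - k + u)) p)} ⊔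
  Submodule.span ℂ {v | ∃ (j : Fin m) (k o : ℕ), HasOrder (L j) o ∧
      (o : ℤ) + k - u < 0 ∧
      v = ∑ s ∈ Finset.range i, Matrix.toEuclideanLin (loopCoeff γ s)ᴴ
        (cderiv e k (fun q => coeff (L j q) ((s : ℤ) + o)) p)}

end Surface

end UnitonFact

end

open MeasureTheory Filter Topology
open scoped Manifold ContDiff Matrix Polynomial

noncomputable section

namespace UnitonFact

/-! Everything is read off from W = ΦH₊, which satisfies λ^r H₊ ⊆ W ⊆ H₊ and determines Φ: if γ and
γ' have the same W, then γ*γ' and its inverse both preserve H₊, so γ*γ' is constant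
(`OmegaPoly.eq_of_grass_eq`).

Pointwise, splitting a last factor off a loop γ = ∑ λ^k T_k of degree r + 1 means forming γ(R +
λ⁻¹(1 - R)) for an orthogonal projection R; the result is polynomial of degree r as soon as T_0(1 -
R) = 0 and T_{r+1}R = 0. Unitarity gives T_{r+1}T_0* = 0, so both extreme choices are allowed.
Projecting onto (ker T_0)^⊥ replaces W by λ⁻¹W ∩ H₊ (Uhlenbeck), projecting onto ker T_{r+1}
replaces it by W + λ^r H₊ (Segal); see `IsStep.grass_eq`.

Over the surface the rank of T_r may drop at isolated points, so the projections must be extended.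
The equation Φ_z = Φ(1 - λ⁻¹)A makes T_r* holomorphic for ∂_z̄ - A*. A local frame g with ∂_z̄ g =
A*g is manufactured from a holomorphic frame of W (`PolySolution.exists_gauge`), so no differential
equation has to be solved; then g⁻¹T_r* is a holomorphic matrix, and zeros can be divided out of its
columns (`exists_analytic_frame`). The identities which keep the quotient an extended solution hold
generically and persist by continuity (`PolySolution.exists_segal_step`). Conjugation turns Segal
steps into Uhlenbeck steps, so one kind suffices.

Reality: γ ↦ λ^r conj γ interchanges the two kinds of step, and by the modular law steps of opposite
kinds commute on W. A real γ followed by two opposite steps therefore has the same W as its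
conjugate, and is real (`OmegaReal.two_steps`).

Formulae: after the first r - i steps, W_i = (λ^{-u}W ∩ H₊) + λ^i H₊
(`IsFactorization.grass_eq_stepSpace`). Since Φ_{i-1}⁻¹W_i = η_i H₊, its constant terms fill α_i,
and P_0 Φ_{i-1}⁻¹ = ∑ S_t P_t. Inserting the generators λ^l (L^j)^{(k)} of W ∩ λ^u H₊, only those
with l = k or l = u - o(j) survive (`map_le_explicitSpan`).

Adapted data are obtained by concatenating meromorphic frames of W ∩ λ^u H₊ for all u. Such frames
exist globally on a connected surface, because normalising a frame against a fixed matrix makes it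
unique and lets local solutions glue (`exists_meromorphic_spanning`). -/

/-! ### Multiplication operators on `H` -/

/-- The matrix `A` acting on `ℂⁿ`. -/
abbrev act {n : ℕ} (A : Mat n) : E n →ₗ[ℂ] E n := Matrix.toEuclideanLin A

theorem act_mul {n : ℕ} (A B : Mat n) (v : E n) : act (A * B) v = act A (act B v) := by
  simp [act, Matrix.toLpLin_apply, Matrix.mulVec_mulVec]

theorem act_one {n : ℕ} (v : E n) : act (1 : Mat n) v = v := by
  simp [act]

theorem act_smul_mat {n : ℕ} (c : ℂ) (A : Mat n) (v : E n) : act (c • A) v = c • act A v := by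
  simp [act]

theorem act_injective {n : ℕ} {A B : Mat n} (h : ∀ v, act A v = act B v) : A = B :=
  Matrix.toEuclideanLin.injective (LinearMap.ext h)

/-- `L` is the operator of pointwise multiplication by the loop `γ`. -/
def IsMul {n : ℕ} (γ : Circle → Mat n) (L : H n →ₗ[ℂ] H n) : Prop :=
  ∀ f, ∀ᵐ t ∂(AddCircle.haarAddCircle (T := (1 : ℝ))), L f t = act (γ t.toCircle) (f t)

namespace IsMul

variable {n : ℕ} {γ γ' : Circle → Mat n} {L L' : H n →ₗ[ℂ] H n}

theorem comp (h : IsMul γ L) (h' : IsMul γ' L') : IsMul (fun z => γ z * γ' z) (L ∘ₗ L') := by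
  intro f
  filter_upwards [h (L' f), h' f] with t h1 h2
  rw [LinearMap.comp_apply, h1, h2, act_mul]

theorem unique (h : IsMul γ L) (h' : IsMul γ L') : L = L' := by
  ext1 f
  apply Lp.ext
  filter_upwards [h f, h' f] with t h1 h2
  rw [h1, h2]

theorem id : IsMul (fun _ => (1 : Mat n)) LinearMap.id := by
  intro f
  filter_upwards with t
  rw [LinearMap.id_apply, act_one]

theorem sum {ι : Type*} (s : Finset ι) (γ : ι → Circle → Mat n) (L : ι → H n →ₗ[ℂ] H n)
    (h : ∀ i ∈ s, IsMul (γ i) (L i)) : IsMul (fun z => ∑ i ∈ s, γ i z) (∑ i ∈ s, L i) := by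
  classical
  intro f
  induction s using Finset.induction_on with
  | empty =>
    filter_upwards [Lp.coeFn_zero (E n) 2 (AddCircle.haarAddCircle (T := (1 : ℝ)))] with t h
    simp [act]
  | insert i s hi ih =>
    filter_upwards [ih fun j hj => h j (Finset.mem_insert_of_mem hj),
      h i (Finset.mem_insert_self _ _) f, Lp.coeFn_add (L i f) ((∑ i ∈ s, L i) f)] with t h1 h2 h3
    rw [Finset.sum_insert hi, LinearMap.add_apply, h3, Pi.add_apply, h1, h2, Finset.sum_insert hi]
    simp [act]

theorem loopImage_eq (h : IsMul γ L) (V : Submodule ℂ (H n)) : loopImage γ V = V.map L := by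
  ext f
  constructor
  · rintro ⟨g, hg, h'⟩
    refine ⟨g, hg, ?_⟩
    apply Lp.ext
    filter_upwards [h g, h'] with t h1 h2
    rw [h1, h2]
  · rintro ⟨g, hg, rfl⟩
    exact ⟨g, hg, h g⟩

theorem left_inv (h : IsMul γ L) (h' : IsMul γ' L') (hi : ∀ z, γ z * γ' z = 1) (f : H n) :
    L (L' f) = f := by
  have := unique (h.comp h') (by simpa only [hi] using IsMul.id)
  exact LinearMap.congr_fun this f

/-- Applying the inverse loop turns membership in γV into membership in V; all later questions about
`grass` become questions about Fourier coefficients in this way. -/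
theorem mem_loopImage (h : IsMul γ L) (h' : IsMul γ' L') (hi : ∀ z, γ z * γ' z = 1)
    {V : Submodule ℂ (H n)} {f : H n} : f ∈ loopImage γ V ↔ L' f ∈ V := by
  have hi' : ∀ z, γ' z * γ z = 1 := fun z => mul_eq_one_comm.1 (hi z)
  rw [h.loopImage_eq]
  constructor
  · rintro ⟨g, hg, rfl⟩
    rwa [left_inv h' h hi']
  · intro hf
    exact ⟨L' f, hf, left_inv h h' hi f⟩

end IsMul

theorem memLp_zpow_smul {n : ℕ} (k : ℤ) (f : H n) :
    MemLp (fun t : AddCircle (1 : ℝ) => ((t.toCircle : Circle) : ℂ) ^ k • f t) 2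
      (AddCircle.haarAddCircle (T := (1 : ℝ))) := by
  have hc : Continuous (fun t : AddCircle (1 : ℝ) => ((t.toCircle : Circle) : ℂ) ^ k) :=
    (continuous_subtype_val.comp AddCircle.continuous_toCircle).zpow₀ k
      fun t => Or.inl (Circle.coe_ne_zero _)
  refine (Lp.memLp f).congr_norm
    (hc.aestronglyMeasurable.smul (Lp.memLp f).aestronglyMeasurable) ?_
  refine Eventually.of_forall fun t => ?_
  rw [norm_smul, norm_zpow, Circle.norm_coe, one_zpow, one_mul]

/-- Multiplication by `λ^k` on `H`. -/
def shiftL {n : ℕ} (k : ℤ) : H n →ₗ[ℂ] H n where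
  toFun f := (memLp_zpow_smul k f).toLp _
  map_add' f g := by
    apply Lp.ext
    filter_upwards [(memLp_zpow_smul k (f + g)).coeFn_toLp, (memLp_zpow_smul k f).coeFn_toLp,
      (memLp_zpow_smul k g).coeFn_toLp, Lp.coeFn_add f g,
      Lp.coeFn_add ((memLp_zpow_smul k f).toLp _) ((memLp_zpow_smul k g).toLp _)]
      with t h1 h2 h3 h4 h5
    rw [h1, h5, Pi.add_apply, h2, h3, h4, Pi.add_apply, smul_add]
  map_smul' c f := by
    apply Lp.ext
    filter_upwards [(memLp_zpow_smul k (c • f)).coeFn_toLp, (memLp_zpow_smul k f).coeFn_toLp,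
      Lp.coeFn_smul c f, Lp.coeFn_smul c ((memLp_zpow_smul k f).toLp _)] with t h1 h2 h3 h4
    rw [h1, RingHom.id_apply, h4, Pi.smul_apply, h2, h3, Pi.smul_apply, smul_comm]

theorem coeFn_shiftL {n : ℕ} (k : ℤ) (f : H n) :
    ∀ᵐ t ∂(AddCircle.haarAddCircle (T := (1 : ℝ))),
      shiftL k f t = ((t.toCircle : Circle) : ℂ) ^ k • f t :=
  (memLp_zpow_smul k f).coeFn_toLp

theorem isMul_shiftL {n : ℕ} (k : ℤ) : IsMul (lamPow n k) (shiftL k) := by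
  intro f
  filter_upwards [coeFn_shiftL k f] with t h
  rw [h, lamPow, act_smul_mat, act_one]

/-- Multiplication by a constant matrix on `H`. -/
def constL {n : ℕ} (A : Mat n) : H n →ₗ[ℂ] H n :=
  (ContinuousLinearMap.compLpL 2 (AddCircle.haarAddCircle (T := (1 : ℝ)))
    (LinearMap.toContinuousLinearMap (act A))).toLinearMap

theorem isMul_constL {n : ℕ} (A : Mat n) : IsMul (fun _ => A) (constL A) := by
  intro f
  filter_upwards [ContinuousLinearMap.coeFn_compLpL (p := 2)
    (LinearMap.toContinuousLinearMap (act A)) f] with t h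
  exact h

theorem isMul_zpow_smul {n : ℕ} (k : ℤ) (A : Mat n) :
    IsMul (fun z => (z : ℂ) ^ k • A) (shiftL k ∘ₗ constL A) := by
  simpa [lamPow] using (isMul_shiftL k).comp (isMul_constL A)

theorem P_apply {n : ℕ} (m : ℤ) (f : H n) :
    P m f = ∫ t : AddCircle (1 : ℝ), ((t.toCircle : Circle) : ℂ) ^ (-m) • f t
      ∂(AddCircle.haarAddCircle (T := (1 : ℝ))) := by
  change fourierCoeff (fun t : AddCircle (1 : ℝ) => f t) m = _
  unfold fourierCoeff
  congr 1
  ext1 t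
  rw [fourier_apply, AddCircle.toCircle_zsmul, Circle.coe_zpow]

theorem P_shiftL {n : ℕ} (m k : ℤ) (f : H n) : P m (shiftL k f) = P (m - k) f := by
  rw [P_apply, P_apply]
  refine integral_congr_ae ?_
  filter_upwards [coeFn_shiftL k f] with t h
  rw [h, smul_smul, ← zpow_add₀ (Circle.coe_ne_zero _)]
  congr 2
  ring

theorem P_constL {n : ℕ} (m : ℤ) (A : Mat n) (f : H n) : P m (constL A f) = act A (P m f) := by
  rw [P_apply, P_apply]
  have hi : Integrable (fun t : AddCircle (1 : ℝ) => ((t.toCircle : Circle) : ℂ) ^ (-m) • f t)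
      (AddCircle.haarAddCircle (T := (1 : ℝ))) := by
    refine (integrable_fourier_smul m f).congr (Eventually.of_forall fun t => ?_)
    simp only [fourier_apply, AddCircle.toCircle_zsmul, Circle.coe_zpow]
  have := ContinuousLinearMap.integral_comp_comm (LinearMap.toContinuousLinearMap (act A)) hi
  simp only [LinearMap.coe_toContinuousLinearMap'] at this
  rw [← this]
  refine integral_congr_ae ?_
  filter_upwards [isMul_constL A f] with t h
  rw [h, map_smul]

theorem integral_zpow (k : ℤ) :
    ∫ t : AddCircle (1 : ℝ), ((t.toCircle : Circle) : ℂ) ^ k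
      ∂(AddCircle.haarAddCircle (T := (1 : ℝ))) = if k = 0 then 1 else 0 := by
  have h := congrFun (fourierCoeff_fourier (T := (1 : ℝ)) 0) (-k)
  unfold fourierCoeff at h
  simp only [fourier_zero, smul_eq_mul, mul_one, neg_neg, Pi.single_apply, neg_eq_zero] at h
  rw [← h]
  congr 1
  ext1 t
  rw [fourier_apply, AddCircle.toCircle_zsmul, Circle.coe_zpow]

theorem P_laurent {r n : ℕ} (m : ℤ) (k : ℕ) (v : Coef r n) :
    P m (laurent k v) = coeff v (m - k) := by
  have hcoe := ContinuousMap.coeFn_toLp (p := 2) (𝕜 := ℂ)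
    (AddCircle.haarAddCircle (T := (1 : ℝ))) (⟨fun t => ∑ i : Fin r,
      ((t.toCircle : Circle) : ℂ) ^ (k + (i : ℕ)) • v i, by
    have : Continuous (fun t : AddCircle (1 : ℝ) => ((t.toCircle : Circle) : ℂ)) :=
      continuous_subtype_val.comp AddCircle.continuous_toCircle
    fun_prop⟩ : C(AddCircle (1 : ℝ), E n))
  rw [P_apply]
  have h1 : ∫ t : AddCircle (1 : ℝ), ((t.toCircle : Circle) : ℂ) ^ (-m) • laurent k v t
      ∂(AddCircle.haarAddCircle (T := (1 : ℝ))) =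
      ∫ t : AddCircle (1 : ℝ), ∑ i : Fin r, ((t.toCircle : Circle) : ℂ) ^ (k + (i : ℤ) - m) • v i
      ∂(AddCircle.haarAddCircle (T := (1 : ℝ))) := by
    refine integral_congr_ae ?_
    filter_upwards [hcoe] with t ht
    rw [laurent, ht, ContinuousMap.coe_mk, Finset.smul_sum]
    refine Finset.sum_congr rfl fun i _ => ?_
    rw [smul_smul, ← zpow_natCast, ← zpow_add₀ (Circle.coe_ne_zero _)]
    congr 2
    push_cast
    ring
  have hc : ∀ j : ℤ, Continuous (fun t : AddCircle (1 : ℝ) => ((t.toCircle : Circle) : ℂ) ^ j) :=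
    fun j => (continuous_subtype_val.comp AddCircle.continuous_toCircle).zpow₀ j
      fun t => Or.inl (Circle.coe_ne_zero _)
  have hi : ∀ j : ℤ, ∀ w : E n, Integrable (fun t : AddCircle (1 : ℝ) =>
      ((t.toCircle : Circle) : ℂ) ^ j • w) (AddCircle.haarAddCircle (T := (1 : ℝ))) := by
    intro j w
    exact ((hc j).smul continuous_const).integrable_of_hasCompactSupport
      (HasCompactSupport.of_compactSpace _)
  rw [h1, integral_finsetSum _ fun i _ => hi _ _]
  simp_rw [integral_smul_const, integral_zpow]
  unfold coeff
  split_ifs with h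
  · rw [Finset.sum_eq_single ⟨(m - k).toNat, h.2⟩]
    · rw [if_pos, one_smul]
      simp only
      omega
    · intro i _ hne
      rw [if_neg, zero_smul]
      intro h0
      apply hne
      ext
      simp only
      omega
    · simp
  · refine Finset.sum_eq_zero fun i _ => ?_
    rw [if_neg, zero_smul]
    intro h0
    apply h
    have := i.2
    omega

theorem mem_Hplus {n : ℕ} {f : H n} : f ∈ Hplus n ↔ ∀ m : ℤ, m < 0 → P m f = 0 := by
  simp [Hplus, Submodule.mem_iInf]

theorem mem_shift {n : ℕ} {k : ℤ} {V : Submodule ℂ (H n)} {f : H n} :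
    f ∈ shift k V ↔ shiftL (-k) f ∈ V := by
  refine (isMul_shiftL k).mem_loopImage (isMul_shiftL (-k)) fun z => ?_
  simp [lamPow, smul_smul, inv_mul_cancel₀ (zpow_ne_zero k (Circle.coe_ne_zero z))]

theorem mem_shift_Hplus {n : ℕ} {k : ℤ} {f : H n} :
    f ∈ shift k (Hplus n) ↔ ∀ m : ℤ, m < k → P m f = 0 := by
  rw [mem_shift, mem_Hplus]
  simp_rw [P_shiftL]
  constructor
  · intro h m hm
    simpa using h (m - k) (by omega)
  · intro h m hm
    exact h _ (by omega)

theorem shiftL_shiftL {n : ℕ} (j k : ℤ) (f : H n) : shiftL j (shiftL k f) = shiftL (j + k) f := by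
  have h := (isMul_shiftL j).comp (isMul_shiftL (n := n) k)
  have h2 : (fun z => lamPow n j z * lamPow n k z) = lamPow n (j + k) := by
    ext1 z
    simp [lamPow, smul_smul, ← zpow_add₀ (Circle.coe_ne_zero z), add_comm]
  rw [h2] at h
  exact LinearMap.congr_fun (h.unique (isMul_shiftL _)) f

theorem shiftL_zero {n : ℕ} (f : H n) : shiftL 0 f = f := by
  have h := isMul_shiftL (n := n) 0
  have h2 : lamPow n 0 = fun _ => 1 := by
    ext1 z
    simp [lamPow]
  rw [h2] at h
  exact LinearMap.congr_fun (h.unique IsMul.id) f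

/-- The element `λ^k v` of `H`. -/
def mono {n : ℕ} (k : ℕ) (v : E n) : H n := laurent k (fun _ : Fin 1 => v)

theorem P_mono {n : ℕ} (m : ℤ) (k : ℕ) (v : E n) :
    P m (mono k v) = if m = k then v else 0 := by
  rw [mono, P_laurent, coeff]
  by_cases h : m = k
  · subst h; simp
  · rw [if_neg h, dif_neg]
    intro h'
    omega

/-! ### Fourier coefficients of loops -/

section LoopCoeff

variable {n : ℕ} {γ γ' : Circle → Mat n}

theorem loopCoeff_apply (γ : Circle → Mat n) (m : ℤ) (a b : Fin n) :
    loopCoeff γ m a b = ∫ t : AddCircle (1 : ℝ), ((t.toCircle : Circle) : ℂ) ^ (-m) *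
      γ t.toCircle a b ∂(AddCircle.haarAddCircle (T := (1 : ℝ))) := by
  rw [loopCoeff, Matrix.of_apply, fourierCoeff]
  congr 1
  ext1 t
  rw [fourier_apply, AddCircle.toCircle_zsmul, Circle.coe_zpow, smul_eq_mul]

theorem continuous_coe_zpow (k : ℤ) : Continuous (fun z : Circle => (z : ℂ) ^ k) :=
  continuous_subtype_val.zpow₀ k fun z => Or.inl (Circle.coe_ne_zero z)

theorem integrable_entry (hγ : Continuous γ) (m : ℤ) (a b : Fin n) :
    Integrable (fun t : AddCircle (1 : ℝ) => ((t.toCircle : Circle) : ℂ) ^ (-m) *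
      γ t.toCircle a b) (AddCircle.haarAddCircle (T := (1 : ℝ))) := by
  have h : Continuous (fun z : Circle => (z : ℂ) ^ (-m) * γ z a b) :=
    (continuous_coe_zpow _).mul (hγ.matrix_elem a b)
  exact (h.comp AddCircle.continuous_toCircle).integrable_of_hasCompactSupport
    (HasCompactSupport.of_compactSpace _)

theorem loopCoeff_sum {ι : Type*} (s : Finset ι) (γ : ι → Circle → Mat n)
    (hγ : ∀ i ∈ s, Continuous (γ i)) (m : ℤ) :
    loopCoeff (fun z => ∑ i ∈ s, γ i z) m = ∑ i ∈ s, loopCoeff (γ i) m := by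
  ext a b
  simp_rw [Matrix.sum_apply, loopCoeff_apply, Matrix.sum_apply, Finset.mul_sum]
  exact integral_finsetSum _ fun i hi => integrable_entry (hγ i hi) m a b

theorem loopCoeff_add (hγ : Continuous γ) (hγ' : Continuous γ') (m : ℤ) :
    loopCoeff (fun z => γ z + γ' z) m = loopCoeff γ m + loopCoeff γ' m := by
  ext a b
  simp_rw [Matrix.add_apply, loopCoeff_apply, Matrix.add_apply, mul_add]
  exact integral_add (integrable_entry hγ m a b) (integrable_entry hγ' m a b)

theorem loopCoeff_mul_const (hγ : Continuous γ) (B : Mat n) (m : ℤ) :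
    loopCoeff (fun z => γ z * B) m = loopCoeff γ m * B := by
  ext a b
  simp_rw [Matrix.mul_apply, loopCoeff_apply, Matrix.mul_apply, Finset.mul_sum, ← mul_assoc]
  rw [integral_finsetSum _ fun i _ => (integrable_entry hγ m a i).mul_const _]
  simp_rw [integral_mul_const]

theorem loopCoeff_zpow_smul (γ : Circle → Mat n) (j m : ℤ) :
    loopCoeff (fun z => (z : ℂ) ^ j • γ z) m = loopCoeff γ (m - j) := by
  ext a b
  simp_rw [loopCoeff_apply, Matrix.smul_apply, smul_eq_mul, ← mul_assoc,
    ← zpow_add₀ (Circle.coe_ne_zero _)]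
  congr 1
  ext1 t
  congr 2
  ring

theorem loopCoeff_const (B : Mat n) (m : ℤ) :
    loopCoeff (fun _ => B) m = if m = 0 then B else 0 := by
  ext a b
  rw [loopCoeff_apply]
  rw [integral_mul_const, integral_zpow]
  by_cases h : m = 0 <;> simp [h]

theorem loopCoeff_map_conj (γ : Circle → Mat n) (m : ℤ) :
    loopCoeff (fun z => (γ z).map (starRingEnd ℂ)) m =
      (loopCoeff γ (-m)).map (starRingEnd ℂ) := by
  ext a b
  rw [Matrix.map_apply, loopCoeff_apply, loopCoeff_apply, ← integral_conj]
  congr 1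
  ext1 t
  rw [Matrix.map_apply, map_mul, map_zpow₀, ← Circle.coe_inv_eq_conj, Circle.coe_inv, inv_zpow',
    neg_neg]

theorem loopCoeff_conjTranspose (γ : Circle → Mat n) (m : ℤ) :
    loopCoeff (fun z => (γ z)ᴴ) m = (loopCoeff γ (-m))ᴴ := by
  ext a b
  have := congrFun (congrFun (loopCoeff_map_conj γ m) b) a
  rw [Matrix.map_apply] at this
  rw [Matrix.conjTranspose_apply, ← starRingEnd_apply, ← this, loopCoeff_apply, loopCoeff_apply]
  rfl

/-- A matrix valued Laurent polynomial in `λ`. -/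
def IsLaurent (γ : Circle → Mat n) : Prop :=
  ∃ (s : Finset ℤ) (C : ℤ → Mat n), ∀ z : Circle, γ z = ∑ k ∈ s, (z : ℂ) ^ k • C k

theorem continuous_sum_zpow (s : Finset ℤ) (C : ℤ → Mat n) :
    Continuous (fun z : Circle => ∑ k ∈ s, (z : ℂ) ^ k • C k) :=
  continuous_finsetSum _ fun k _ => (continuous_coe_zpow k).smul continuous_const

theorem IsLaurent.continuous (h : IsLaurent γ) : Continuous γ := by
  obtain ⟨s, C, h⟩ := h
  rw [show γ = _ from funext h]
  exact continuous_sum_zpow s C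

theorem loopCoeff_sum_zpow (s : Finset ℤ) (C : ℤ → Mat n) (m : ℤ) :
    loopCoeff (fun z => ∑ k ∈ s, (z : ℂ) ^ k • C k) m = if m ∈ s then C m else 0 := by
  rw [loopCoeff_sum s (fun k z => (z : ℂ) ^ k • C k)
    fun k _ => (continuous_coe_zpow k).smul continuous_const]
  simp_rw [loopCoeff_zpow_smul, loopCoeff_const, sub_eq_zero]
  rw [Finset.sum_ite_eq]

/-- The finite set `s` is free apart from containing the support, so that loops with different
supports can be compared and reindexed over a common set. -/
theorem IsLaurent.eq_sum (h : IsLaurent γ) {s : Finset ℤ}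
    (hs : ∀ k, loopCoeff γ k ≠ 0 → k ∈ s) (z : Circle) :
    γ z = ∑ k ∈ s, (z : ℂ) ^ k • loopCoeff γ k := by
  obtain ⟨s', C, h⟩ := h
  have hc : ∀ m, loopCoeff γ m = if m ∈ s' then C m else 0 := by
    intro m
    rw [show γ = _ from funext h, loopCoeff_sum_zpow]
  have h1 : ∑ k ∈ s, (z : ℂ) ^ k • loopCoeff γ k =
      ∑ k ∈ s ∪ s', (z : ℂ) ^ k • loopCoeff γ k := by
    refine Finset.sum_subset Finset.subset_union_left fun k _ hk => ?_
    rw [not_not.1 (mt (hs k) hk), smul_zero]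
  have h2 : ∑ k ∈ s', (z : ℂ) ^ k • loopCoeff γ k =
      ∑ k ∈ s ∪ s', (z : ℂ) ^ k • loopCoeff γ k := by
    refine Finset.sum_subset Finset.subset_union_right fun k _ hk => ?_
    rw [hc, if_neg hk, smul_zero]
  rw [h1, ← h2, h]
  refine Finset.sum_congr rfl fun k hk => ?_
  rw [hc, if_pos hk]

/-- Convolution formula. Only the second factor needs finite support; it is expanded and the first
is integrated against each power of λ. -/
theorem IsLaurent.loopCoeff_mul (hγ : Continuous γ) (h : IsLaurent γ') {s : Finset ℤ}
    (hs : ∀ k, loopCoeff γ' k ≠ 0 → k ∈ s) (m : ℤ) :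
    loopCoeff (fun z => γ z * γ' z) m = ∑ k ∈ s, loopCoeff γ (m - k) * loopCoeff γ' k := by
  have : (fun z : Circle => γ z * γ' z) =
      fun z : Circle => ∑ k ∈ s, (z : ℂ) ^ k • (γ z * loopCoeff γ' k) := by
    ext1 z
    rw [h.eq_sum hs z, Finset.mul_sum]
    simp_rw [Matrix.mul_smul]
  rw [this, loopCoeff_sum s (fun k z => (z : ℂ) ^ k • (γ z * loopCoeff γ' k))
    fun k _ => (continuous_coe_zpow k).smul (hγ.matrix_mul continuous_const)]
  simp_rw [loopCoeff_zpow_smul, loopCoeff_mul_const hγ]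

theorem IsLaurent.ext (h : IsLaurent γ) (h' : IsLaurent γ')
    (hc : ∀ k, loopCoeff γ k = loopCoeff γ' k) : γ = γ' := by
  obtain ⟨s, C, hC⟩ := id h
  have hs : ∀ k, loopCoeff γ k ≠ 0 → k ∈ s := by
    intro k hk
    by_contra hks
    rw [show γ = _ from funext hC, loopCoeff_sum_zpow, if_neg hks] at hk
    exact hk rfl
  ext1 z
  rw [h.eq_sum hs, h'.eq_sum (s := s) fun k hk => hs k (by rwa [hc])]
  simp_rw [hc]

theorem IsLaurent.of_sum_range {r : ℕ} {T : ℕ → Mat n}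
    (h : ∀ z : Circle, γ z = ∑ k ∈ Finset.range (r + 1), (z : ℂ) ^ k • T k) :
    IsLaurent γ ∧ ∀ k : ℤ, loopCoeff γ k ≠ 0 → 0 ≤ k ∧ k ≤ r := by
  have h1 : ∀ z : Circle, γ z = ∑ k ∈ (Finset.range (r + 1)).map Nat.castEmbedding,
      (z : ℂ) ^ k • (fun k : ℤ => T k.toNat) k := by
    intro z
    rw [h, Finset.sum_map]
    simp
  refine ⟨⟨_, _, h1⟩, fun k hk => ?_⟩
  rw [show γ = _ from funext h1, loopCoeff_sum_zpow] at hk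
  split_ifs at hk with hks
  · simp only [Finset.mem_map, Finset.mem_range, Nat.castEmbedding_apply] at hks
    omega
  · exact absurd rfl hk

theorem IsLaurent.eq_sum_range (h : IsLaurent γ) {r : ℕ}
    (hs : ∀ k, loopCoeff γ k ≠ 0 → 0 ≤ k ∧ k ≤ r) (z : Circle) :
    γ z = ∑ k ∈ Finset.range (r + 1), (z : ℂ) ^ k • loopCoeff γ k := by
  rw [h.eq_sum (s := (Finset.range (r + 1)).map Nat.castEmbedding), Finset.sum_map]
  · simp
  · intro k hk
    have := hs k hk
    simp only [Finset.mem_map, Finset.mem_range, Nat.castEmbedding_apply]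
    exact ⟨k.toNat, by omega, by omega⟩

theorem IsLaurent.conjTranspose (h : IsLaurent γ) : IsLaurent (fun z => (γ z)ᴴ) := by
  obtain ⟨s, C, h⟩ := h
  refine ⟨s.map (Equiv.neg ℤ).toEmbedding, fun k => (C (-k))ᴴ, fun z => ?_⟩
  beta_reduce
  rw [h, Finset.sum_map, Matrix.conjTranspose_sum]
  refine Finset.sum_congr rfl fun k _ => ?_
  simp only [Equiv.coe_toEmbedding, Equiv.neg_apply, neg_neg]
  rw [Matrix.conjTranspose_smul, ← starRingEnd_apply, map_zpow₀, ← Circle.coe_inv_eq_conj,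
    Circle.coe_inv, inv_zpow']

theorem IsLaurent.zpow_smul (h : IsLaurent γ) (j : ℤ) :
    IsLaurent (fun z => (z : ℂ) ^ j • γ z) := by
  obtain ⟨s, C, h⟩ := h
  refine ⟨s.map (Equiv.addRight j).toEmbedding, fun k => C (k - j), fun z => ?_⟩
  beta_reduce
  rw [h, Finset.sum_map, Finset.smul_sum]
  refine Finset.sum_congr rfl fun k _ => ?_
  simp only [Equiv.coe_toEmbedding, Equiv.coe_addRight, add_sub_cancel_right]
  rw [smul_smul, ← zpow_add₀ (Circle.coe_ne_zero z), add_comm]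

theorem IsLaurent.mul_const (h : IsLaurent γ) (B : Mat n) : IsLaurent (fun z => γ z * B) := by
  obtain ⟨s, C, h⟩ := h
  refine ⟨s, fun k => C k * B, fun z => ?_⟩
  beta_reduce
  rw [h, Finset.sum_mul]
  simp_rw [Matrix.smul_mul]

theorem IsLaurent.add (h : IsLaurent γ) (h' : IsLaurent γ') :
    IsLaurent (fun z => γ z + γ' z) := by
  classical
  obtain ⟨s, C, h⟩ := h
  obtain ⟨s', C', h'⟩ := h'
  refine ⟨s ∪ s', fun k => (if k ∈ s then C k else 0) + (if k ∈ s' then C' k else 0),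
    fun z => ?_⟩
  simp only [h, h', smul_add, Finset.sum_add_distrib, smul_ite, smul_zero, Finset.sum_ite_mem,
    Finset.union_inter_cancel_left, Finset.union_inter_cancel_right]

theorem IsLaurent.sum {ι : Type*} (s : Finset ι) {γ : ι → Circle → Mat n}
    (h : ∀ i ∈ s, IsLaurent (γ i)) : IsLaurent (fun z => ∑ i ∈ s, γ i z) := by
  classical
  induction s using Finset.induction_on with
  | empty => exact ⟨∅, 0, by simp⟩
  | insert i s hi ih =>
    simp_rw [Finset.sum_insert hi]
    exact (h i (Finset.mem_insert_self _ _)).add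
      (ih fun j hj => h j (Finset.mem_insert_of_mem hj))

theorem IsLaurent.mul (h : IsLaurent γ) (h' : IsLaurent γ') :
    IsLaurent (fun z => γ z * γ' z) := by
  obtain ⟨s', C', h'⟩ := h'
  have : (fun z : Circle => γ z * γ' z) = fun z : Circle => ∑ k ∈ s', (z : ℂ) ^ k • (γ z * C' k) := by
    ext1 z
    rw [h', Finset.mul_sum]
    simp_rw [Matrix.mul_smul]
  rw [this]
  exact IsLaurent.sum s' fun k _ => (h.mul_const _).zpow_smul k

theorem IsLaurent.const (B : Mat n) : IsLaurent (fun _ => B) :=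
  ⟨{0}, fun _ => B, by simp⟩

theorem IsLaurent.map_conj (h : IsLaurent γ) :
    IsLaurent (fun z => (γ z).map (starRingEnd ℂ)) := by
  obtain ⟨s, C, h⟩ := h
  refine ⟨s.map (Equiv.neg ℤ).toEmbedding, fun k => (C (-k)).map (starRingEnd ℂ), fun z => ?_⟩
  beta_reduce
  rw [h, Finset.sum_map]
  ext a b
  simp only [Matrix.map_apply, Matrix.sum_apply, Matrix.smul_apply, map_sum, smul_eq_mul, map_mul,
    Equiv.coe_toEmbedding, Equiv.neg_apply, neg_neg]
  refine Finset.sum_congr rfl fun k _ => ?_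
  rw [map_zpow₀, ← Circle.coe_inv_eq_conj, Circle.coe_inv, inv_zpow']

/-- The operator of multiplication by a Laurent polynomial. -/
theorem IsLaurent.exists_isMul (h : IsLaurent γ) {s : Finset ℤ}
    (hs : ∀ k, loopCoeff γ k ≠ 0 → k ∈ s) :
    ∃ L : H n →ₗ[ℂ] H n, IsMul γ L ∧
      ∀ f m, P m (L f) = ∑ k ∈ s, act (loopCoeff γ k) (P (m - k) f) := by
  refine ⟨∑ k ∈ s, shiftL k ∘ₗ constL (loopCoeff γ k), ?_, fun f m => ?_⟩
  · have := IsMul.sum s _ _ fun k _ => isMul_zpow_smul k (loopCoeff γ k)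
    rwa [← show γ = _ from funext (h.eq_sum hs)] at this
  · rw [LinearMap.sum_apply, map_sum]
    refine Finset.sum_congr rfl fun k _ => ?_
    rw [LinearMap.comp_apply, P_shiftL, P_constL]

end LoopCoeff

/-! ### Polynomial loops and the steps of a filtration at a point -/

section Pointwise

variable {n : ℕ} {γ γ' : Circle → Mat n} {r : ℕ} {R : Mat n}

theorem contMDiff_coe_circle : ContMDiff (𝓡 1) 𝓘(ℝ, ℂ) ∞ (fun z : Circle => (z : ℂ)) :=
  haveI : Fact (Module.finrank ℝ ℂ = 1 + 1) := finrank_real_complex_fact'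
  contMDiff_coe_sphere

theorem OmegaPoly.isLaurent (h : γ ∈ OmegaPoly r n) : IsLaurent γ := by
  obtain ⟨-, T, hT⟩ := h
  exact (IsLaurent.of_sum_range hT).1

theorem OmegaPoly.support (h : γ ∈ OmegaPoly r n) {k : ℤ} (hk : loopCoeff γ k ≠ 0) :
    0 ≤ k ∧ k ≤ r := by
  obtain ⟨-, T, hT⟩ := h
  exact (IsLaurent.of_sum_range hT).2 k hk

theorem OmegaPoly.coeff_eq_zero (h : γ ∈ OmegaPoly r n) {k : ℤ} (hk : k < 0 ∨ r < k) :
    loopCoeff γ k = 0 := by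
  by_contra h0
  have := OmegaPoly.support h h0
  omega

theorem OmegaPoly.mul_conjTranspose (h : γ ∈ OmegaPoly r n) (z : Circle) : γ z * (γ z)ᴴ = 1 :=
  Matrix.mem_unitaryGroup_iff.1 (h.1.1 z)

theorem OmegaPoly.conjTranspose_mul (h : γ ∈ OmegaPoly r n) (z : Circle) : (γ z)ᴴ * γ z = 1 :=
  Matrix.mem_unitaryGroup_iff'.1 (h.1.1 z)

/-- Smoothness along the circle is automatic: the entries are restrictions of polynomials on ℂ. -/
theorem OmegaPoly.mk (hl : IsLaurent γ) (hs : ∀ k, loopCoeff γ k ≠ 0 → 0 ≤ k ∧ k ≤ r)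
    (hu : ∀ z, (γ z)ᴴ * γ z = 1) (h1 : γ 1 = 1) : γ ∈ OmegaPoly r n := by
  have h := hl.eq_sum_range hs
  refine ⟨⟨fun z => Matrix.mem_unitaryGroup_iff'.2 (hu z), h1, fun a b => ?_⟩, _, h⟩
  have : (fun z => γ z a b) = fun z : Circle =>
      ∑ k ∈ Finset.range (r + 1), (z : ℂ) ^ k * loopCoeff γ k a b := by
    ext1 z
    rw [h, Matrix.sum_apply]
    simp
  rw [this]
  have hs : ContDiff ℝ ∞ (fun w : ℂ =>
      ∑ k ∈ Finset.range (r + 1), w ^ k * loopCoeff γ k a b) := by fun_prop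
  exact hs.contMDiff.comp contMDiff_coe_circle

/-- An orthogonal projection matrix. -/
structure IsOrthProj {n : ℕ} (R : Mat n) : Prop where
  mul_self : R * R = R
  conjTranspose : Rᴴ = R

namespace IsOrthProj

theorem one_sub (h : IsOrthProj R) : IsOrthProj (1 - R) where
  mul_self := by simp [sub_mul, mul_sub, h.mul_self]
  conjTranspose := by simp [h.conjTranspose]

theorem mul_compl (h : IsOrthProj R) : R * (1 - R) = 0 := by simp [mul_sub, h.mul_self]

theorem compl_mul (h : IsOrthProj R) : (1 - R) * R = 0 := by simp [sub_mul, h.mul_self]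

theorem map_conj (h : IsOrthProj R) : IsOrthProj (R.map (starRingEnd ℂ)) where
  mul_self := by rw [← Matrix.map_mul, h.mul_self]
  conjTranspose := by
    ext a b
    have := congrFun (congrFun h.conjTranspose a) b
    simp only [Matrix.conjTranspose_apply, Matrix.map_apply] at this ⊢
    rw [← this]
    simp

end IsOrthProj

/-- The loop `γ (π + λ⁻¹ π^⊥)`, where `π` is the projection with matrix `R`. -/
def stepDown {n : ℕ} (γ : Circle → Mat n) (R : Mat n) : Circle → Mat n :=
  fun z => γ z * (R + (z : ℂ)⁻¹ • (1 - R))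

theorem stepFactor_mul (h : IsOrthProj R) (z : Circle) :
    (R + (z : ℂ)⁻¹ • (1 - R)) * (R + (z : ℂ) • (1 - R)) = 1 := by
  simp [add_mul, mul_add, smul_smul, h.mul_self, h.mul_compl, h.compl_mul, h.one_sub.mul_self]

theorem stepFactor_conjTranspose (h : IsOrthProj R) (z : Circle) :
    (R + (z : ℂ)⁻¹ • (1 - R))ᴴ = R + (z : ℂ) • (1 - R) := by
  rw [Matrix.conjTranspose_add, Matrix.conjTranspose_smul, h.conjTranspose,
    h.one_sub.conjTranspose, ← starRingEnd_apply, ← Circle.coe_inv, ← Circle.coe_inv_eq_conj,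
    inv_inv]

theorem stepDown_mul (h : IsOrthProj R) (γ : Circle → Mat n) (z : Circle) :
    stepDown γ R z * (R + (z : ℂ) • (1 - R)) = γ z := by
  rw [stepDown, mul_assoc, stepFactor_mul h, mul_one]

theorem stepDown_eq (γ : Circle → Mat n) (R : Mat n) :
    stepDown γ R = fun z : Circle => γ z * R + (z : ℂ) ^ (-1 : ℤ) • (γ z * (1 - R)) := by
  ext1 z
  rw [stepDown, mul_add, Matrix.mul_smul, zpow_neg_one]

theorem IsLaurent.stepDown (h : IsLaurent γ) (R : Mat n) : IsLaurent (stepDown γ R) := by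
  rw [stepDown_eq]
  exact (h.mul_const R).add ((h.mul_const (1 - R)).zpow_smul (-1))

theorem loopCoeff_stepDown (h : IsLaurent γ) (R : Mat n) (k : ℤ) :
    loopCoeff (stepDown γ R) k = loopCoeff γ k * R + loopCoeff γ (k + 1) * (1 - R) := by
  rw [stepDown_eq, loopCoeff_add (h.mul_const R).continuous
    ((h.mul_const (1 - R)).zpow_smul (-1)).continuous, loopCoeff_mul_const h.continuous,
    loopCoeff_zpow_smul, loopCoeff_mul_const h.continuous, sub_neg_eq_add]

/-- The new coefficients are T_k R + T_{k+1}(1 - R), so only the degrees -1 and r + 1 could spoil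
the range; the two hypotheses kill exactly these. -/
theorem stepDown_mem (hγ : γ ∈ OmegaPoly (r + 1) n) (hR : IsOrthProj R)
    (h0 : loopCoeff γ 0 * (1 - R) = 0) (h1 : loopCoeff γ ((r + 1 : ℕ) : ℤ) * R = 0) :
    stepDown γ R ∈ OmegaPoly r n := by
  have hl := OmegaPoly.isLaurent hγ
  refine OmegaPoly.mk (hl.stepDown R) (fun k hk => ?_) (fun z => ?_) ?_
  · rw [loopCoeff_stepDown hl] at hk
    by_contra hcon
    apply hk
    rcases lt_trichotomy k (-1) with h | h | h
    · rw [OmegaPoly.coeff_eq_zero hγ (by omega), OmegaPoly.coeff_eq_zero hγ (by omega)]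
      simp
    · rw [OmegaPoly.coeff_eq_zero hγ (by omega), h]
      simpa using h0
    · by_cases h' : k = r + 1
      · rw [OmegaPoly.coeff_eq_zero hγ (k := k + 1) (by push_cast; omega), h']
        push_cast at h1
        simpa using h1
      · rw [OmegaPoly.coeff_eq_zero hγ (by push_cast; omega),
          OmegaPoly.coeff_eq_zero hγ (by push_cast; omega)]
        simp
  · rw [stepDown, Matrix.conjTranspose_mul, stepFactor_conjTranspose hR, mul_assoc,
      ← mul_assoc (γ z)ᴴ, OmegaPoly.conjTranspose_mul hγ, one_mul]
    exact mul_eq_one_comm.1 (stepFactor_mul hR z)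
  · simp [stepDown, hγ.1.2.1]

/-- The relations between the coefficients of a unitary loop. -/
theorem OmegaPoly.sum_mul_conjTranspose (hγ : γ ∈ OmegaPoly r n) (a b : ℤ) (J : Finset ℤ)
    (hJ : ∀ j, loopCoeff γ (b + j) ≠ 0 → j ∈ J) :
    ∑ j ∈ J, loopCoeff γ (a + j) * (loopCoeff γ (b + j))ᴴ = if a = b then 1 else 0 := by
  have hl := OmegaPoly.isLaurent hγ
  -- This is the coefficient of λ^(a-b) in γγ* = 1. The index k = -b - j is chosen because γ* has
  -- (T_{-k})* = (T_{b+j})* in degree k.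
  have h1 := hl.conjTranspose.loopCoeff_mul hl.continuous
    (s := J.map (Equiv.subLeft (-b)).toEmbedding) (fun k hk => ?_) (a - b)
  · simp_rw [OmegaPoly.mul_conjTranspose hγ, loopCoeff_const, sub_eq_zero,
      loopCoeff_conjTranspose, Finset.sum_map] at h1
    rw [h1]
    refine Finset.sum_congr rfl fun j _ => ?_
    simp only [Equiv.coe_toEmbedding, Equiv.subLeft_apply]
    congr 2
    · ring
    · congr 1; ring
  · rw [loopCoeff_conjTranspose, ne_eq, Matrix.conjTranspose_eq_zero] at hk
    simp only [Finset.mem_map, Equiv.coe_toEmbedding, Equiv.subLeft_apply]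
    exact ⟨-b - k, hJ _ (by rwa [show b + (-b - k) = -k by ring]), by ring⟩

theorem OmegaPoly.sum_conjTranspose_mul (hγ : γ ∈ OmegaPoly r n) (a b : ℤ) (J : Finset ℤ)
    (hJ : ∀ j, loopCoeff γ (b + j) ≠ 0 → j ∈ J) :
    ∑ j ∈ J, (loopCoeff γ (a + j))ᴴ * loopCoeff γ (b + j) = if a = b then 1 else 0 := by
  have hl := OmegaPoly.isLaurent hγ
  have h1 := hl.loopCoeff_mul hl.conjTranspose.continuous
    (s := J.map (Equiv.addLeft b).toEmbedding) (fun k hk => ?_) (b - a)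
  · simp_rw [OmegaPoly.conjTranspose_mul hγ, loopCoeff_const, sub_eq_zero, eq_comm (a := b),
      loopCoeff_conjTranspose, Finset.sum_map] at h1
    rw [h1]
    refine Finset.sum_congr rfl fun j _ => ?_
    simp only [Equiv.coe_toEmbedding, Equiv.coe_addLeft]
    congr 3
    ring
  · simp only [Finset.mem_map, Equiv.coe_toEmbedding, Equiv.coe_addLeft]
    exact ⟨k - b, hJ _ (by simpa using hk), by ring⟩

/-- Coefficient of λ^(r+1) in γγ* = 1: only the two extreme degrees differ by that much. This
orthogonality is what makes both kinds of step legitimate. -/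
theorem OmegaPoly.top_mul_bot (hγ : γ ∈ OmegaPoly (r + 1) n) :
    loopCoeff γ ((r + 1 : ℕ) : ℤ) * (loopCoeff γ 0)ᴴ = 0 := by
  have := OmegaPoly.sum_mul_conjTranspose hγ ((r + 1 : ℕ) : ℤ) 0
    (insert 0 (Finset.Icc 1 ((r + 1 : ℕ) : ℤ))) fun j hj => by
      have := OmegaPoly.support hγ hj
      simp only [Finset.mem_insert, Finset.mem_Icc]
      omega
  rw [Finset.sum_insert (by simp), if_neg (by push_cast; omega), Finset.sum_eq_zero] at this
  · simpa using this
  · intro j hj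
    rw [OmegaPoly.coeff_eq_zero hγ, zero_mul]
    simp only [Finset.mem_Icc] at hj
    omega

/-- `R` is the projection defining an Uhlenbeck step (`b = true`) or a Segal step (`b = false`)
for the polynomial loop `γ` of degree `r`. -/
def IsStep {n : ℕ} (b : Bool) (r : ℕ) (γ : Circle → Mat n) (R : Mat n) : Prop :=
  if b then ∀ v, act (loopCoeff γ 0) v = 0 ↔ act R v = 0
  else ∀ v, act (loopCoeff γ r) v = 0 ↔ act (1 - R) v = 0

theorem mul_eq_zero_of_act {A B : Mat n} (h : ∀ v, act A (act B v) = 0) : A * B = 0 :=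
  act_injective fun v => by rw [act_mul, h]; simp [act]

theorem act_act_eq_zero {A B : Mat n} (h : A * B = 0) (v : E n) : act A (act B v) = 0 := by
  rw [← act_mul, h]; simp [act]

/-- For an Uhlenbeck step, 1 - R maps into ker R = ker T_0. For a Segal step, T_0* maps into ker
T_{r+1} = ker (1 - R), and the claim is the adjoint of that. -/
theorem IsStep.bot {b : Bool} (h : IsStep b (r + 1) γ R) (hR : IsOrthProj R)
    (hγ : γ ∈ OmegaPoly (r + 1) n) : loopCoeff γ 0 * (1 - R) = 0 := by
  cases b with
  | true => exact mul_eq_zero_of_act fun v => (h _).2 (act_act_eq_zero hR.mul_compl v)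
  | false =>
    have h1 : (1 - R) * (loopCoeff γ 0)ᴴ = 0 :=
      mul_eq_zero_of_act fun v => (h _).1 (act_act_eq_zero (OmegaPoly.top_mul_bot hγ) v)
    rw [← Matrix.conjTranspose_eq_zero, Matrix.conjTranspose_mul, hR.one_sub.conjTranspose, h1]

theorem IsStep.top {b : Bool} (h : IsStep b (r + 1) γ R) (hR : IsOrthProj R)
    (hγ : γ ∈ OmegaPoly (r + 1) n) : loopCoeff γ ((r + 1 : ℕ) : ℤ) * R = 0 := by
  cases b with
  | false => exact mul_eq_zero_of_act fun v => (h _).2 (act_act_eq_zero hR.compl_mul v)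
  | true =>
    have h0 : loopCoeff γ 0 * (loopCoeff γ ((r + 1 : ℕ) : ℤ))ᴴ = 0 := by
      rw [← Matrix.conjTranspose_eq_zero, Matrix.conjTranspose_mul,
        Matrix.conjTranspose_conjTranspose, OmegaPoly.top_mul_bot hγ]
    have h1 : R * (loopCoeff γ ((r + 1 : ℕ) : ℤ))ᴴ = 0 :=
      mul_eq_zero_of_act fun v => (h _).1 (act_act_eq_zero h0 v)
    rw [← Matrix.conjTranspose_eq_zero, Matrix.conjTranspose_mul, hR.conjTranspose, h1]

theorem IsStep.stepDown_mem {b : Bool} (h : IsStep b (r + 1) γ R) (hR : IsOrthProj R)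
    (hγ : γ ∈ OmegaPoly (r + 1) n) : stepDown γ R ∈ OmegaPoly r n :=
  UnitonFact.stepDown_mem hγ hR (h.bot hR hγ) (h.top hR hγ)

/-- Multiplication by `γ` and `γ⁻¹`, in terms of Fourier coefficients. -/
theorem OmegaPoly.exists_isMul (hγ : γ ∈ OmegaPoly r n) :
    ∃ L L' : H n →ₗ[ℂ] H n, IsMul γ L ∧ IsMul (fun z => (γ z)ᴴ) L' ∧
      (∀ f m, P m (L f) = ∑ k ∈ Finset.range (r + 1), act (loopCoeff γ k) (P (m - k) f)) ∧
      (∀ f m, P m (L' f) = ∑ k ∈ Finset.range (r + 1), act (loopCoeff γ k)ᴴ (P (m + k) f)) ∧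
      (∀ f, L (L' f) = f) ∧ (∀ f, L' (L f) = f) := by
  have hl := OmegaPoly.isLaurent hγ
  obtain ⟨L, hL, hL1⟩ := hl.exists_isMul (s := (Finset.range (r + 1)).map Nat.castEmbedding)
    fun k hk => by
      have := OmegaPoly.support hγ hk
      simp only [Finset.mem_map, Finset.mem_range, Nat.castEmbedding_apply]
      exact ⟨k.toNat, by omega, by omega⟩
  obtain ⟨L', hL', hL1'⟩ := hl.conjTranspose.exists_isMul
    (s := (Finset.range (r + 1)).map (Nat.castEmbedding.trans (Equiv.neg ℤ).toEmbedding))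
    fun k hk => by
      rw [loopCoeff_conjTranspose, ne_eq, Matrix.conjTranspose_eq_zero] at hk
      have := OmegaPoly.support hγ hk
      simp only [Finset.mem_map, Finset.mem_range, Function.Embedding.trans_apply,
        Nat.castEmbedding_apply, Equiv.coe_toEmbedding, Equiv.neg_apply]
      exact ⟨(-k).toNat, by omega, by omega⟩
  refine ⟨L, L', hL, hL', fun f m => ?_, fun f m => ?_, fun f => ?_, fun f => ?_⟩
  · rw [hL1, Finset.sum_map]; rfl
  · rw [hL1', Finset.sum_map]
    refine Finset.sum_congr rfl fun k _ => ?_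
    simp [loopCoeff_conjTranspose]
  · exact IsMul.left_inv hL hL' (OmegaPoly.mul_conjTranspose hγ) f
  · exact IsMul.left_inv hL' hL (OmegaPoly.conjTranspose_mul hγ) f

theorem OmegaPoly.mem_grass (hγ : γ ∈ OmegaPoly r n) {L' : H n →ₗ[ℂ] H n}
    (h' : IsMul (fun z => (γ z)ᴴ) L') {f : H n} : f ∈ grass γ ↔ L' f ∈ Hplus n := by
  obtain ⟨L, -, hL, -⟩ := OmegaPoly.exists_isMul hγ
  exact hL.mem_loopImage h' (OmegaPoly.mul_conjTranspose hγ)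

theorem OmegaPoly.grass_le (hγ : γ ∈ OmegaPoly r n) : grass γ ≤ Hplus n := by
  obtain ⟨L, L', hL, hL', hP, -, hLL', -⟩ := OmegaPoly.exists_isMul hγ
  intro f hf
  rw [OmegaPoly.mem_grass hγ hL', mem_Hplus] at hf
  rw [mem_Hplus]
  intro m hm
  rw [← hLL' f, hP]
  refine Finset.sum_eq_zero fun k _ => ?_
  rw [hf _ (by omega), map_zero]

theorem OmegaPoly.le_grass (hγ : γ ∈ OmegaPoly r n) : shift (r : ℤ) (Hplus n) ≤ grass γ := by
  obtain ⟨L, L', hL, hL', -, hP, hLL', -⟩ := OmegaPoly.exists_isMul hγ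
  intro f hf
  rw [mem_shift_Hplus] at hf
  rw [OmegaPoly.mem_grass hγ hL', mem_Hplus]
  intro m hm
  rw [hP]
  refine Finset.sum_eq_zero fun k hk => ?_
  rw [Finset.mem_range] at hk
  rw [hf _ (by omega), map_zero]

/-- Equality of the two spaces says that γ*γ' maps H₊ into itself, hence has no negative
coefficients. By symmetry its adjoint has none either, so it is constant, and the constant is 1
because both loops are based. -/
theorem OmegaPoly.eq_of_grass_eq {r' : ℕ} (hγ : γ ∈ OmegaPoly r n) (hγ' : γ' ∈ OmegaPoly r' n)
    (h : grass γ = grass γ') : γ = γ' := by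
  obtain ⟨L, L', hL, hL', -, -, hLL', hL'L⟩ := OmegaPoly.exists_isMul hγ
  obtain ⟨K, K', hK, hK', -, -, hKK', hK'K⟩ := OmegaPoly.exists_isMul hγ'
  have hl := OmegaPoly.isLaurent hγ
  have hl' := OmegaPoly.isLaurent hγ'
  -- Stated for an arbitrary pair, since it is used once in each direction. Testing on constant
  -- functions v isolates the coefficient of degree m.
  have key : ∀ {δ δ' : Circle → Mat n} {K L' : H n →ₗ[ℂ] H n} {i i' : ℕ} (_ : δ ∈ OmegaPoly i n)
      (_ : δ' ∈ OmegaPoly i' n) (_ : IsMul δ' K) (_ : IsMul (fun z => (δ z)ᴴ) L')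
      (_ : grass δ = grass δ') (m : ℤ), m < 0 → loopCoeff (fun z => (δ z)ᴴ * δ' z) m = 0 := by
    intro δ δ' K L' i i' hδ hδ' hK hL' h m hm
    have hla := (OmegaPoly.isLaurent hδ).conjTranspose.mul (OmegaPoly.isLaurent hδ')
    obtain ⟨s, C, hC⟩ := id hla
    obtain ⟨L1, hL1, hP1⟩ := hla.exists_isMul (s := s) fun k hk => by
      by_contra hks
      rw [show (fun z => (δ z)ᴴ * δ' z) = _ from funext hC, loopCoeff_sum_zpow, if_neg hks] at hk
      exact hk rfl
    refine act_injective fun v => ?_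
    have h1 : P m (L1 (mono 0 v)) = 0 := by
      rw [hL1.unique (hL'.comp hK)]
      have h2 : K (mono 0 v) ∈ grass δ' := by
        rw [grass, hK.loopImage_eq]
        refine Submodule.mem_map_of_mem ?_
        rw [mem_Hplus]
        intro m hm
        rw [P_mono, if_neg (by push_cast; omega)]
      rw [← h, OmegaPoly.mem_grass hδ hL', mem_Hplus] at h2
      exact h2 m hm
    rw [hP1] at h1
    simp_rw [P_mono] at h1
    by_cases hms : m ∈ s
    · rw [Finset.sum_eq_single m] at h1
      · simpa [act] using h1
      · intro k _ hk
        rw [if_neg (by push_cast; omega), map_zero]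
      · exact fun hms' => absurd hms hms'
    · rw [show (fun z => (δ z)ᴴ * δ' z) = _ from funext hC, loopCoeff_sum_zpow, if_neg hms]
  have hneg := key hγ hγ' hK hL' h
  have hpos := key hγ' hγ hL hK' h.symm
  have hconst : (fun z => (γ z)ᴴ * γ' z) = fun _ => 1 := by
    have h1 : (fun z => (γ z)ᴴ * γ' z) = fun _ => loopCoeff (fun z => (γ z)ᴴ * γ' z) 0 := by
      refine (hl.conjTranspose.mul hl').ext (IsLaurent.const _) fun k => ?_
      rw [loopCoeff_const]
      split_ifs with hk
      · rw [hk]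
      · rcases lt_or_gt_of_ne hk with hk | hk
        · exact hneg k hk
        · have := hpos (-k) (by omega)
          have h2 : (fun z => (γ' z)ᴴ * γ z) = fun z => ((γ z)ᴴ * γ' z)ᴴ := by
            ext1 z
            rw [Matrix.conjTranspose_mul, Matrix.conjTranspose_conjTranspose]
          rwa [h2, loopCoeff_conjTranspose, neg_neg, Matrix.conjTranspose_eq_zero] at this
    have h2 := congrFun h1 1
    simp only [hγ.1.2.1, hγ'.1.2.1, Matrix.conjTranspose_one, one_mul] at h2
    rw [h1, ← h2]
  ext1 z
  have h3 := congrArg (γ z * ·) (congrFun hconst z)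
  simp only [← mul_assoc, OmegaPoly.mul_conjTranspose hγ, one_mul, mul_one] at h3
  exact h3.symm

/-- The effect of a step on the Grassmannian model of a loop of degree `i + 1`. -/
def stepGrass {n : ℕ} (b : Bool) (i : ℕ) (W : Submodule ℂ (H n)) : Submodule ℂ (H n) :=
  if b then shift (-1) W ⊓ Hplus n else W ⊔ shift (i : ℤ) (Hplus n)

theorem IsStep.isMul_inv {L' : H n →ₗ[ℂ] H n} (hR : IsOrthProj R)
    (hL' : IsMul (fun z => (γ z)ᴴ) L') :
    ∃ K' : H n →ₗ[ℂ] H n, IsMul (fun z => (stepDown γ R z)ᴴ) K' ∧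
      ∀ f m, P m (K' f) = act R (P m (L' f)) + act (1 - R) (P (m - 1) (L' f)) := by
  -- The inverse of `stepDown γ R` is (R + λ(1 - R))γ*; its first factor is written as a sum over
  -- `Bool` so that `IsMul.sum` applies.
  have h1 := (IsMul.sum (Finset.univ : Finset Bool)
    (fun b (z : Circle) => (z : ℂ) ^ (if b then (1 : ℤ) else 0) • (if b then 1 - R else R)) _
    fun b _ => isMul_zpow_smul (if b then (1 : ℤ) else 0) (if b then 1 - R else R)).comp hL'
  refine ⟨(∑ b : Bool, shiftL (if b then 1 else 0) ∘ₗ constL (if b then 1 - R else R)) ∘ₗ L',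
    ?_, fun f m => ?_⟩
  · convert h1 using 2 with z
    rw [stepDown, Matrix.conjTranspose_mul, stepFactor_conjTranspose hR]
    simp [add_comm]
  · simp [P_shiftL, P_constL, add_comm]

theorem IsOrthProj.act_add_eq_zero (hR : IsOrthProj R) {v w : E n}
    (h : act R v + act (1 - R) w = 0) : act R v = 0 ∧ act (1 - R) w = 0 := by
  have h1 := congrArg (act R) h
  have h2 := congrArg (act (1 - R)) h
  simp only [map_add, ← act_mul, hR.mul_self, hR.mul_compl, hR.compl_mul, hR.one_sub.mul_self]
    at h1 h2
  simpa [act] using And.intro h1 h2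

/-- Put g = γ*f. The coefficient of degree m of (R + λ(1 - R))g is R g_m + (1 - R)g_{m-1}, whose two
summands are orthogonal and so vanish separately. Requiring this for all m < 0 kills g_m for m < -1
and leaves R g_{-1} = 0. -/
theorem mem_grass_stepDown (hR : IsOrthProj R)
    (hm : stepDown γ R ∈ OmegaPoly r n) {L' : H n →ₗ[ℂ] H n}
    (hL' : IsMul (fun z => (γ z)ᴴ) L') {f : H n} :
    f ∈ grass (stepDown γ R) ↔ (∀ m : ℤ, m < -1 → P m (L' f) = 0) ∧ act R (P (-1) (L' f)) = 0 := by
  obtain ⟨K', hK', hP⟩ := IsStep.isMul_inv hR hL'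
  rw [OmegaPoly.mem_grass hm hK', mem_Hplus]
  simp_rw [hP]
  constructor
  · intro h
    refine ⟨fun m hm => ?_, (hR.act_add_eq_zero (h (-1) (by omega))).1⟩
    have h1 := (hR.act_add_eq_zero (h m (by omega))).1
    have h2 := (hR.act_add_eq_zero (h (m + 1) (by omega))).2
    rw [add_sub_cancel_right] at h2
    have h3 : act (R + (1 - R)) (P m (L' f)) = 0 := by
      rw [act, map_add, LinearMap.add_apply, h1, h2, add_zero]
    rwa [add_sub_cancel, act_one] at h3
  · rintro ⟨h1, h2⟩ m hm
    rw [h1 (m - 1) (by omega), map_zero, add_zero]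
    rcases eq_or_ne m (-1) with rfl | h
    · exact h2
    · rw [h1 m (by omega), map_zero]

/-- Again with g = γ*f. Uhlenbeck: f ∈ λ⁻¹W means g_m = 0 for m < -1; then f_{-1} = T_0 g_{-1} is
the only coefficient that can obstruct f ∈ H₊, and T_0 has the kernel of R. Segal: R g_{-1} = 0 puts
g_{-1} in (ker T_{r+1})^⊥ = range T_{r+1}*, and subtracting a suitable λ^r v from f removes g_{-1}.
-/
theorem IsStep.grass_eq {b : Bool} (h : IsStep b (r + 1) γ R) (hR : IsOrthProj R)
    (hγ : γ ∈ OmegaPoly (r + 1) n) : grass (stepDown γ R) = stepGrass b r (grass γ) := by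
  obtain ⟨L, L', hL, hL', hP, hP', hLL', hL'L⟩ := OmegaPoly.exists_isMul hγ
  have hm := h.stepDown_mem hR hγ
  ext f
  rw [mem_grass_stepDown hR hm hL']
  cases b with
  | true =>
    have h1 : f ∈ shift (-1) (grass γ) ↔ ∀ m : ℤ, m < -1 → P m (L' f) = 0 := by
      rw [mem_shift, OmegaPoly.mem_grass hγ hL', mem_Hplus]
      have : ∀ m : ℤ, P m (L' (shiftL (- -1) f)) = P (m - 1) (L' f) := by
        intro m
        simp_rw [hP', P_shiftL]
        refine Finset.sum_congr rfl fun k _ => ?_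
        rw [show m + (k : ℤ) - - -1 = m - 1 + k by ring]
      simp_rw [this]
      exact ⟨fun h m hm => by simpa using h (m + 1) (by omega), fun h m hm => h _ (by omega)⟩
    simp only [stepGrass, if_true, Submodule.mem_inf, h1]
    refine and_congr_right fun h2 => ?_
    have h3 : ∀ m : ℤ, m ≤ -1 → P m f = act (loopCoeff γ 0) (P m (L' f)) := by
      intro m hm
      rw [← hLL' f, hP, Finset.sum_eq_single 0]
      · simp [hLL' f]
      · intro k _ hk
        rw [h2 _ (by omega), map_zero]
      · simp
    rw [← h (P (-1) (L' f)), ← h3 _ le_rfl, mem_Hplus]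
    constructor
    · intro h4 m hm
      rcases eq_or_ne m (-1) with rfl | h5
      · exact h4
      · rw [h3 m (by omega), h2 m (by omega), map_zero]
    · exact fun h4 => h4 _ (by omega)
  | false =>
    rw [stepGrass, if_neg (by simp)]
    constructor
    · rintro ⟨h1, h2⟩
      have h3 : P (-1) (L' f) ∈ (LinearMap.ker (act (loopCoeff γ ((r + 1 : ℕ) : ℤ))))ᗮ := by
        have h4 : P (-1) (L' f) = act (1 - R) (P (-1) (L' f)) := by
          rw [act, map_sub, LinearMap.sub_apply, h2, sub_zero, ← act, act_one]
        intro w hw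
        have hw' := (h w).1 hw
        rw [h4]
        have : act (1 - R) = (act (1 - R)).adjoint := by
          rw [act, ← Matrix.toEuclideanLin_conjTranspose_eq_adjoint, hR.one_sub.conjTranspose]
        rw [this, LinearMap.adjoint_inner_right, hw', inner_zero_left]
      rw [LinearMap.orthogonal_ker, ← Matrix.toEuclideanLin_conjTranspose_eq_adjoint] at h3
      obtain ⟨v, hv⟩ := h3
      -- The only term of γ*(λ^r v) of negative degree is λ⁻¹ T_{r+1}* v.
      have h5 : ∀ m : ℤ, m < 0 → P m (L' (mono r v)) = if m = -1 then P (-1) (L' f) else 0 := by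
        intro m hm
        rw [hP', Finset.sum_range_succ, Finset.sum_eq_zero, zero_add, P_mono]
        · split_ifs with h6 h7 h7
          · exact hv
          · omega
          · push_cast at h6; omega
          · rw [map_zero]
        · intro k hk
          rw [Finset.mem_range] at hk
          rw [P_mono, if_neg (by omega), map_zero]
      rw [Submodule.mem_sup]
      refine ⟨f - mono r v, ?_, mono r v, ?_, sub_add_cancel _ _⟩
      · rw [OmegaPoly.mem_grass hγ hL', mem_Hplus]
        intro m hm
        rw [map_sub, map_sub, h5 m hm]
        split_ifs with h6
        · rw [h6, sub_self]
        · rw [h1 m (by omega), sub_zero]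
      · rw [mem_shift_Hplus]
        intro m hm
        rw [P_mono, if_neg hm.ne]
    · have h1 : R * (loopCoeff γ ((r + 1 : ℕ) : ℤ))ᴴ = 0 := by
        have := congrArg Matrix.conjTranspose (h.top hR hγ)
        rwa [Matrix.conjTranspose_mul, hR.conjTranspose, Matrix.conjTranspose_zero] at this
      rw [Submodule.mem_sup]
      rintro ⟨f1, hf1, f2, hf2, rfl⟩
      rw [OmegaPoly.mem_grass hγ hL', mem_Hplus] at hf1
      rw [mem_shift_Hplus] at hf2
      have h2 : ∀ m : ℤ, m < 0 → P m (L' f2) =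
          act (loopCoeff γ ((r + 1 : ℕ) : ℤ))ᴴ (P (m + (r + 1 : ℕ)) f2) := by
        intro m hm
        rw [hP', Finset.sum_range_succ, Finset.sum_eq_zero, zero_add]
        intro k hk
        rw [Finset.mem_range] at hk
        rw [hf2 _ (by omega), map_zero]
      refine ⟨fun m hm => ?_, ?_⟩
      · rw [map_add, map_add, hf1 m (by omega), h2 m (by omega), hf2 _ (by push_cast; omega),
          map_zero, add_zero]
      · rw [map_add, map_add, hf1 _ (by omega), h2 _ (by omega), zero_add, act_act_eq_zero h1]

theorem shift_sup {n : ℕ} (k : ℤ) (V W : Submodule ℂ (H n)) :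
    shift k (V ⊔ W) = shift k V ⊔ shift k W := by
  simp only [shift, (isMul_shiftL (n := n) k).loopImage_eq, Submodule.map_sup]

theorem shift_inf {n : ℕ} (k : ℤ) (V W : Submodule ℂ (H n)) :
    shift k (V ⊓ W) = shift k V ⊓ shift k W := by
  ext f
  simp only [Submodule.mem_inf, mem_shift]

theorem shift_shift {n : ℕ} (j k : ℤ) (V : Submodule ℂ (H n)) :
    shift j (shift k V) = shift (j + k) V := by
  ext f
  simp only [mem_shift, shiftL_shiftL]
  rw [show -k + -j = -(j + k) by ring]

theorem shift_zero {n : ℕ} (V : Submodule ℂ (H n)) : shift 0 V = V := by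
  ext f
  rw [mem_shift, neg_zero, shiftL_zero]

theorem shift_Hplus_mono {n : ℕ} {j k : ℤ} (h : j ≤ k) :
    shift k (Hplus n) ≤ shift j (Hplus n) := by
  intro f hf
  rw [mem_shift_Hplus] at hf ⊢
  exact fun m hm => hf m (by omega)

theorem shift_Hplus_le {n : ℕ} {k : ℤ} (h : 0 ≤ k) : shift k (Hplus n) ≤ Hplus n := by
  simpa [shift_zero] using shift_Hplus_mono (n := n) h

/-- The modular law, applicable because λ^i H₊ ⊆ H₊. The cut-off drops from i + 1 to i between the
steps, which matches the shift by λ⁻¹ in the Uhlenbeck step. -/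
theorem stepGrass_stepGrass {n : ℕ} (b : Bool) (i : ℕ) (W : Submodule ℂ (H n)) :
    stepGrass (!b) i (stepGrass b (i + 1) W) = stepGrass b i (stepGrass (!b) (i + 1) W) := by
  have key : (shift (-1) W ⊓ Hplus n) ⊔ shift (i : ℤ) (Hplus n) =
      shift (-1) (W ⊔ shift ((i + 1 : ℕ) : ℤ) (Hplus n)) ⊓ Hplus n := by
    rw [shift_sup, shift_shift, show (-1 : ℤ) + ((i + 1 : ℕ) : ℤ) = i from by push_cast; ring,
      sup_comm, sup_comm (shift (-1) W), sup_inf_assoc_of_le _ (shift_Hplus_le (by omega))]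
  cases b with
  | true => simpa [stepGrass] using key
  | false => simpa [stepGrass] using key.symm

/-- The family of spaces `stepSpace W u i` is stable under both kinds of step: an Uhlenbeck step
raises u, a Segal step only lowers the cut-off. The Uhlenbeck case is once more the modular law. -/
theorem stepGrass_stepSpace {n : ℕ} (b : Bool) (u i : ℕ) (W : Submodule ℂ (H n)) :
    stepGrass b i (stepSpace W u (i + 1)) = stepSpace W (if b then u + 1 else u) i := by
  cases b with
  | true =>
    simp only [stepGrass, stepSpace, if_true]
    have h1 : Hplus n ≤ shift (-1) (Hplus n) := by
      have := shift_Hplus_mono (n := n) (show (-1 : ℤ) ≤ 0 by omega)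
      rwa [shift_zero] at this
    rw [shift_sup, shift_inf, shift_shift, shift_shift,
      show (-1 : ℤ) + ((i + 1 : ℕ) : ℤ) = i from by push_cast; ring,
      show (-1 : ℤ) + -(u : ℤ) = -((u + 1 : ℕ) : ℤ) from by push_cast; ring, sup_comm,
      sup_inf_assoc_of_le _ (shift_Hplus_le (by omega)), sup_comm, inf_assoc,
      inf_eq_right.2 h1]
  | false =>
    simp only [stepGrass, stepSpace, Bool.false_eq_true, if_false]
    rw [sup_assoc]
    congr 1
    exact sup_eq_right.2 (shift_Hplus_mono (by push_cast; omega))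

end Pointwise

/-! ### Complex conjugation and the two kinds of step -/

section Reality

variable {n : ℕ} {γ γ' : Circle → Mat n} {r : ℕ} {R R' : Mat n}

/-- The loop `λ^r conj γ`. -/
def conjLoop {n : ℕ} (r : ℕ) (γ : Circle → Mat n) : Circle → Mat n :=
  fun z => (z : ℂ) ^ (r : ℤ) • (γ z).map (starRingEnd ℂ)

theorem mem_OmegaReal_iff : γ ∈ OmegaReal r n ↔ γ ∈ OmegaPoly r n ∧ conjLoop r γ = γ := by
  refine and_congr_right fun _ => ?_
  simp only [funext_iff, conjLoop]
  refine forall_congr' fun z => ?_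
  have hz := zpow_ne_zero (r : ℤ) (Circle.coe_ne_zero z)
  rw [zpow_neg]
  constructor
  · intro h
    rw [h, smul_smul, mul_inv_cancel₀ hz, one_smul]
  · intro h
    conv_rhs => rw [← h]
    rw [smul_smul, inv_mul_cancel₀ hz, one_smul]

theorem loopCoeff_conjLoop (γ : Circle → Mat n) (r : ℕ) (k : ℤ) :
    loopCoeff (conjLoop r γ) k = (loopCoeff γ (r - k)).map (starRingEnd ℂ) := by
  unfold conjLoop
  rw [loopCoeff_zpow_smul, loopCoeff_map_conj, neg_sub]

theorem map_conj_mul (A B : Mat n) : (A * B).map (starRingEnd ℂ) =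
    A.map (starRingEnd ℂ) * B.map (starRingEnd ℂ) := Matrix.map_mul

theorem conjTranspose_map_conj (A : Mat n) :
    (A.map (starRingEnd ℂ))ᴴ = Aᴴ.map (starRingEnd ℂ) := by
  ext a b
  simp

theorem conjLoop_mem (h : γ ∈ OmegaPoly r n) : conjLoop r γ ∈ OmegaPoly r n := by
  refine OmegaPoly.mk ((OmegaPoly.isLaurent h).map_conj.zpow_smul r) (fun k hk => ?_)
    (fun z => ?_) ?_
  · rw [loopCoeff_conjLoop] at hk
    have : loopCoeff γ (r - k) ≠ 0 := fun h0 => hk (by rw [h0]; ext; simp)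
    have := OmegaPoly.support h this
    omega
  · rw [conjLoop, Matrix.conjTranspose_smul, conjTranspose_map_conj, Matrix.smul_mul,
      Matrix.mul_smul, smul_smul, ← map_conj_mul, OmegaPoly.conjTranspose_mul h,
      ← starRingEnd_apply, map_zpow₀, ← Circle.coe_inv_eq_conj, Circle.coe_inv, inv_zpow,
      inv_mul_cancel₀ (zpow_ne_zero _ (Circle.coe_ne_zero z)), one_smul]
    ext a b
    simp [Matrix.one_apply, apply_ite]
  · ext a b
    simp [conjLoop, h.1.2.1, Matrix.one_apply, apply_ite]

theorem act_map_conj_eq_zero {A : Mat n} {v : E n} :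
    act (A.map (starRingEnd ℂ)) v = 0 ↔ act A (WithLp.toLp 2 fun i => starRingEnd ℂ (v i)) = 0 := by
  have h : ∀ i, (act (A.map (starRingEnd ℂ)) v) i =
      starRingEnd ℂ ((act A (WithLp.toLp 2 fun i => starRingEnd ℂ (v i))) i) := by
    intro i
    simp [act, Matrix.toLpLin_apply, Matrix.mulVec, dotProduct, map_sum]
  constructor
  · intro h0
    ext i
    have := h i
    rw [h0] at this
    simpa using this.symm
  · intro h0
    ext i
    rw [h i, h0]
    simp

/-- The coefficient of degree k of λ^r conj γ is conj T_{r-k}, so conjugation exchanges the two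
extreme coefficients and with them the two kinds of step; the projection becomes the complement of
its conjugate. -/
theorem IsStep.conjLoop {b : Bool} (h : IsStep b r γ R) :
    IsStep (!b) r (conjLoop r γ) (1 - R.map (starRingEnd ℂ)) := by
  have h1 : (1 : Mat n) - R.map (starRingEnd ℂ) = (1 - R).map (starRingEnd ℂ) := by
    ext a b
    simp [Matrix.one_apply, apply_ite]
  cases b with
  | true =>
    intro v
    rw [sub_sub_cancel, loopCoeff_conjLoop, sub_self, act_map_conj_eq_zero, act_map_conj_eq_zero]
    exact h _
  | false =>
    intro v
    rw [h1, loopCoeff_conjLoop, sub_zero, act_map_conj_eq_zero, act_map_conj_eq_zero]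
    exact h _

/-- On the circle, the conjugate of R + λ⁻¹(1 - R) is λ times a factor of the same shape for the
projection 1 - conj R. This extra λ compensates the drop of the degree from r + 1 to r. -/
theorem conjLoop_stepDown (γ : Circle → Mat n) (R : Mat n) (r : ℕ) :
    conjLoop r (stepDown γ R) =
      stepDown (conjLoop (r + 1) γ) (1 - R.map (starRingEnd ℂ)) := by
  ext1 z
  have hz := Circle.coe_ne_zero z
  have h1 : (R + (z : ℂ)⁻¹ • (1 - R)).map (starRingEnd ℂ) =
      R.map (starRingEnd ℂ) + (z : ℂ) • (1 - R.map (starRingEnd ℂ)) := by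
    ext a b
    simp only [Matrix.map_apply, Matrix.add_apply, Matrix.smul_apply, Matrix.sub_apply,
      smul_eq_mul, map_add, map_mul, map_sub, map_inv₀, ← Circle.coe_inv_eq_conj, Circle.coe_inv,
      inv_inv, Matrix.one_apply, apply_ite (starRingEnd ℂ), map_one, map_zero]
  have h2 : (z : ℂ) • (1 - R.map (starRingEnd ℂ) + (z : ℂ)⁻¹ • R.map (starRingEnd ℂ)) =
      R.map (starRingEnd ℂ) + (z : ℂ) • (1 - R.map (starRingEnd ℂ)) := by
    rw [smul_add, smul_smul, mul_inv_cancel₀ hz, one_smul, add_comm]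
  rw [conjLoop, stepDown, stepDown, conjLoop, map_conj_mul, h1, sub_sub_cancel, Matrix.smul_mul,
    ← h2, Matrix.mul_smul, Nat.cast_succ, zpow_add₀ hz, zpow_one, mul_smul]

/-- Conjugating the chain of two steps gives a chain which starts at the same real γ but has the
opposite order of types. Both orders have the same effect on W by `stepGrass_stepGrass`, and W
determines the loop. -/
theorem OmegaReal.two_steps {b : Bool} (hγ : γ ∈ OmegaReal (r + 1 + 1) n) (hR : IsOrthProj R)
    (hR' : IsOrthProj R') (h : IsStep b (r + 1 + 1) γ R)
    (h' : IsStep (!b) (r + 1) (stepDown γ R) R') :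
    stepDown (stepDown γ R) R' ∈ OmegaReal r n := by
  obtain ⟨hγp, hγr⟩ := mem_OmegaReal_iff.1 hγ
  have m1 := h.stepDown_mem hR hγp
  have m2 := h'.stepDown_mem hR' m1
  refine mem_OmegaReal_iff.2 ⟨m2, ?_⟩
  have c1 := h.conjLoop
  rw [hγr] at c1
  have e1 := conjLoop_stepDown γ R (r + 1)
  rw [hγr] at e1
  have c2 := h'.conjLoop
  rw [e1, Bool.not_not] at c2
  have q1 := c1.stepDown_mem hR.map_conj.one_sub hγp
  have q2 := c2.stepDown_mem hR'.map_conj.one_sub q1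
  rw [conjLoop_stepDown, e1]
  refine OmegaPoly.eq_of_grass_eq q2 m2 ?_
  rw [c2.grass_eq hR'.map_conj.one_sub q1, c1.grass_eq hR.map_conj.one_sub hγp,
    h'.grass_eq hR' m1, h.grass_eq hR hγp, stepGrass_stepGrass]

end Reality

/-! ### The range of the projection as an image of the Grassmannian model -/

section Evaluation

variable {n : ℕ} {γ : Circle → Mat n} {i : ℕ} {R : Mat n}

/-- The map `∑_{t<i} S_t P_t`, where `S_t` is the adjoint of the coefficient of `λ^t` in `γ`. -/
def evalMap {n : ℕ} (γ : Circle → Mat n) (i : ℕ) : H n →ₗ[ℂ] E n :=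
  ∑ t ∈ Finset.range i, act (loopCoeff γ t)ᴴ ∘ₗ P (t : ℤ)

theorem evalMap_apply (γ : Circle → Mat n) (i : ℕ) (f : H n) :
    evalMap γ i f = ∑ t ∈ Finset.range i, act (loopCoeff γ t)ᴴ (P (t : ℤ) f) := by
  simp [evalMap]

theorem evalMap_eq_zero_of_mem_shift {f : H n} (hf : f ∈ shift (i : ℤ) (Hplus n)) :
    evalMap γ i f = 0 := by
  rw [mem_shift_Hplus] at hf
  rw [evalMap_apply]
  refine Finset.sum_eq_zero fun t ht => ?_
  rw [hf _ (by simpa using ht), map_zero]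

/-- The left-hand side is the coefficient of degree -1 of γ*f, which vanishes because γ*f ∈ H₊. This
discards superfluous generators in `map_le_explicitSpan`. -/
theorem evalMap_shiftL (hγ : γ ∈ OmegaPoly i n) {f : H n} (hf : f ∈ grass γ) :
    evalMap γ (i + 1) (shiftL 1 f) = 0 := by
  obtain ⟨L, L', hL, hL', -, hP, -, -⟩ := OmegaPoly.exists_isMul hγ
  rw [OmegaPoly.mem_grass hγ hL', mem_Hplus] at hf
  rw [evalMap_apply, ← hf (-1) (by omega), hP]
  refine Finset.sum_congr rfl fun t _ => ?_
  rw [P_shiftL]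
  congr 2

/-- Let δ be the stepped-down loop and η = R + λ(1 - R), so γ = δη. As δ has degree i, `evalMap δ (i
+ 1)` is P_0 of multiplication by δ⁻¹; it sends γH₊ to the constant terms of ηH₊, which form the
range of R. -/
theorem map_evalMap_grass (hγ : γ ∈ OmegaPoly (i + 1) n) (hR : IsOrthProj R)
    (hm : stepDown γ R ∈ OmegaPoly i n) :
    (grass γ).map (evalMap (stepDown γ R) (i + 1)) = LinearMap.range (act R) := by
  obtain ⟨L, L', hL, hL', -, -, -, hL'L⟩ := OmegaPoly.exists_isMul hγ
  obtain ⟨-, K₀, -, hK₀, -, hK₀P, -, -⟩ := OmegaPoly.exists_isMul hm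
  obtain ⟨K', hK', hKP⟩ := IsStep.isMul_inv hR hL'
  obtain rfl := hK₀.unique hK'
  have key : ∀ f, evalMap (stepDown γ R) (i + 1) f = P 0 (K₀ f) := by
    intro f
    rw [evalMap_apply, hK₀P]
    simp
  apply le_antisymm
  · rintro _ ⟨f, hf, rfl⟩
    rw [SetLike.mem_coe, OmegaPoly.mem_grass hγ hL', mem_Hplus] at hf
    rw [key, hKP, hf (0 - 1) (by omega), map_zero, add_zero]
    exact ⟨_, rfl⟩
  · rintro _ ⟨v, rfl⟩
    have h1 : ∀ m : ℤ, P m (L' (L (mono 0 v))) = if m = 0 then v else 0 := by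
      intro m
      rw [hL'L, P_mono]
      simp
    refine ⟨L (mono 0 v), ?_, ?_⟩
    · rw [SetLike.mem_coe, OmegaPoly.mem_grass hγ hL', mem_Hplus]
      intro m hm
      rw [h1, if_neg hm.ne]
    · rw [key, hKP, h1, h1]
      simp

end Evaluation

/-! ### Generic points -/

theorem eventually_codiscrete_iff {X : Type*} [TopologicalSpace X] {p : X → Prop} :
    (∀ᶠ x in codiscrete X, p x) ↔ ∀ x, ∀ᶠ y in 𝓝[≠] x, p y := by
  change {x | p x} ∈ codiscrete X ↔ _
  rw [mem_codiscrete]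
  refine forall_congr' fun x => ?_
  rw [disjoint_principal_right, compl_compl]
  rfl

theorem eventually_codiscrete_eventually_nhds {X : Type*} [TopologicalSpace X] {p : X → Prop}
    (h : ∀ᶠ x in codiscrete X, p x) : ∀ᶠ x in codiscrete X, ∀ᶠ y in 𝓝 x, p y :=
  Filter.mem_of_superset h fun _ hx => (mem_codiscrete'.1 h).1.mem_nhds hx

theorem eventually_nhdsNE_eventually_nhds {X : Type*} [TopologicalSpace X] [T1Space X]
    {p : X → Prop} {x : X} (h : ∀ᶠ y in 𝓝[≠] x, p y) : ∀ᶠ y in 𝓝[≠] x, ∀ᶠ z in 𝓝 y, p z := by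
  rw [eventually_nhdsWithin_iff] at h ⊢
  filter_upwards [h.eventually_nhds] with y hy hne
  filter_upwards [hy, isOpen_ne.mem_nhds hne] with z hz hzx
  exact hz hzx

/-- A property which near every point holds generically or fails generically does so globally. -/
theorem eventually_codiscrete_or {X : Type*} [TopologicalSpace X] [PreconnectedSpace X]
    [T1Space X] (hne : ∀ x : X, (𝓝[≠] x).NeBot) {p : X → Prop}
    (h : ∀ x, (∀ᶠ y in 𝓝[≠] x, p y) ∨ ∀ᶠ y in 𝓝[≠] x, ¬ p y) :
    (∀ᶠ x in codiscrete X, p x) ∨ ∀ᶠ x in codiscrete X, ¬ p x := by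
  have hopen : ∀ q : X → Prop, IsOpen {x | ∀ᶠ y in 𝓝[≠] x, q y} := by
    intro q
    rw [isOpen_iff_mem_nhds]
    intro x hx
    have h1 := eventually_nhdsWithin_iff.1
      (eventually_nhdsNE_eventually_nhds (show ∀ᶠ y in 𝓝[≠] x, q y from hx))
    filter_upwards [h1] with y hy
    by_cases hyx : y = x
    · rwa [hyx]
    · exact (hy hyx).filter_mono nhdsWithin_le_nhds
  -- Generic truth and generic falsity are both open conditions on the point. They exclude each
  -- other because punctured neighbourhoods are nonempty, so each is clopen.
  have hcompl : {x | ∀ᶠ y in 𝓝[≠] x, p y}ᶜ = {x | ∀ᶠ y in 𝓝[≠] x, ¬ p y} := by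
    ext x
    simp only [Set.mem_compl_iff, Set.mem_ofPred_eq]
    refine ⟨fun h1 => (h x).resolve_left h1, fun h1 h2 => ?_⟩
    have := hne x
    obtain ⟨y, hy1, hy2⟩ := (h1.and h2).exists
    exact hy1 hy2
  have hclopen : IsClopen {x | ∀ᶠ y in 𝓝[≠] x, p y} :=
    ⟨⟨by rw [hcompl]; exact hopen _⟩, hopen p⟩
  rw [eventually_codiscrete_iff, eventually_codiscrete_iff]
  rcases isClopen_iff.1 hclopen with h1 | h1
  · right
    intro x
    have : x ∈ {x | ∀ᶠ y in 𝓝[≠] x, p y}ᶜ := by rw [h1]; simp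
    rwa [hcompl] at this
  · left
    intro x
    have : x ∈ {x | ∀ᶠ y in 𝓝[≠] x, p y} := by rw [h1]; trivial
    exact this

/-! ### Neighbourhoods and punctured neighbourhoods in charts -/

section Punctured

variable {M : Type*} [TopologicalSpace M] {e : OpenPartialHomeomorph M ℂ} {p : M}

theorem tendsto_symm_nhds (hp : p ∈ e.source) : Tendsto e.symm (𝓝 (e p)) (𝓝 p) := by
  have := e.symm.continuousAt (x := e p) (e.map_source hp)
  rwa [ContinuousAt, e.left_inv hp] at this

theorem tendsto_nhdsNE (hp : p ∈ e.source) : Tendsto e (𝓝[≠] p) (𝓝[≠] (e p)) := by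
  refine tendsto_nhdsWithin_iff.2 ⟨(e.continuousAt hp).mono_left nhdsWithin_le_nhds, ?_⟩
  filter_upwards [self_mem_nhdsWithin,
    nhdsWithin_le_nhds (e.open_source.mem_nhds hp)] with q hq hqs h
  exact hq (e.injOn hqs hp h)

theorem tendsto_symm_nhdsNE (hp : p ∈ e.source) : Tendsto e.symm (𝓝[≠] (e p)) (𝓝[≠] p) := by
  refine tendsto_nhdsWithin_iff.2 ⟨(tendsto_symm_nhds hp).mono_left nhdsWithin_le_nhds, ?_⟩
  filter_upwards [self_mem_nhdsWithin,
    nhdsWithin_le_nhds (e.open_target.mem_nhds (e.map_source hp))] with w hw hwt h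
  apply hw
  rw [Set.mem_singleton_iff] at h ⊢
  rw [← h, e.right_inv hwt]

theorem eventually_nhds_chart (hp : p ∈ e.source) {P : M → Prop} :
    (∀ᶠ z in 𝓝 (e p), P (e.symm z)) ↔ ∀ᶠ q in 𝓝 p, P q := by
  constructor
  · intro h
    filter_upwards [(e.continuousAt hp).eventually h, e.open_source.mem_nhds hp] with q hq hqs
    rwa [e.left_inv hqs] at hq
  · exact fun h => (tendsto_symm_nhds hp).eventually h

theorem eventually_nhdsNE_chart (hp : p ∈ e.source) {P : M → Prop} :
    (∀ᶠ z in 𝓝[≠] (e p), P (e.symm z)) ↔ ∀ᶠ q in 𝓝[≠] p, P q := by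
  constructor
  · intro h
    filter_upwards [(tendsto_nhdsNE hp).eventually h,
      nhdsWithin_le_nhds (e.open_source.mem_nhds hp)] with q hq hqs
    rwa [e.left_inv hqs] at hq
  · exact fun h => (tendsto_symm_nhdsNE hp).eventually h

theorem nhdsNE_neBot [ChartedSpace ℂ M] (p : M) : (𝓝[≠] p).NeBot := by
  have h : (𝓝[≠] (chartAt ℂ p p)).NeBot := inferInstance
  exact (tendsto_symm_nhdsNE (mem_chart_source ℂ p)).neBot

/-- Continuous maps which agree generically agree everywhere. -/
theorem eq_of_eventuallyEq_nhdsNE [ChartedSpace ℂ M] {V : Type*} [TopologicalSpace V] [T2Space V]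
    {f g : M → V} (hf : ContinuousAt f p) (hg : ContinuousAt g p)
    (h : ∀ᶠ q in 𝓝[≠] p, f q = g q) : f p = g p :=
  haveI := nhdsNE_neBot p
  tendsto_nhds_unique_of_eventuallyEq (hf.tendsto.mono_left nhdsWithin_le_nhds)
    (hg.tendsto.mono_left nhdsWithin_le_nhds) h

end Punctured

/-! ### The underlying real manifold -/

section RealStructure

variable {M : Type*} [TopologicalSpace M] [ChartedSpace ℂ M]

/-- Complex analytic transition maps are real smooth; hence every holomorphic coordinate is also a
chart of the underlying real manifold. -/
theorem contDiffGroupoid_complex_le : contDiffGroupoid ω 𝓘(ℂ) ≤ contDiffGroupoid ∞ 𝓘(ℝ, ℂ) := by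
  refine groupoid_of_pregroupoid_le _ _ fun f s h => ?_
  have h' : ContDiffOn ℂ ω f s := by simpa [contDiffPregroupoid] using h
  have : ContDiffOn ℝ ∞ f s := (h'.restrict_scalars ℝ).of_le le_top
  simpa [contDiffPregroupoid] using this

theorem mem_real_maximalAtlas {e : OpenPartialHomeomorph M ℂ}
    (he : e ∈ IsManifold.maximalAtlas 𝓘(ℂ) ω M) : e ∈ IsManifold.maximalAtlas 𝓘(ℝ, ℂ) ∞ M :=
  mem_maximalAtlas_iff.2 fun e' he' =>
    ⟨contDiffGroupoid_complex_le (mem_maximalAtlas_iff.1 he e' he').1,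
      contDiffGroupoid_complex_le (mem_maximalAtlas_iff.1 he e' he').2⟩

theorem mem_maximalAtlas_one {e : OpenPartialHomeomorph M ℂ}
    (he : e ∈ IsManifold.maximalAtlas 𝓘(ℂ) ω M) : e ∈ IsManifold.maximalAtlas 𝓘(ℂ) 1 M :=
  mem_maximalAtlas_iff.2 fun e' he' =>
    ⟨contDiffGroupoid_le le_top (mem_maximalAtlas_iff.1 he e' he').1,
      contDiffGroupoid_le le_top (mem_maximalAtlas_iff.1 he e' he').2⟩

theorem chartAt_mem [IsManifold 𝓘(ℂ) ω M] (p : M) :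
    chartAt ℂ p ∈ IsManifold.maximalAtlas 𝓘(ℂ) ω M :=
  IsManifold.chart_mem_maximalAtlas p

/-- Smoothness at a point of a map from a Riemann surface into a vector space. -/
abbrev SmoothAt {V : Type*} [NormedAddCommGroup V] [NormedSpace ℝ V] (f : M → V) (p : M) : Prop :=
  ContMDiffAt 𝓘(ℝ, ℂ) 𝓘(ℝ, V) ∞ f p

variable {V : Type*} [NormedAddCommGroup V] [NormedSpace ℝ V] {f g : M → V} {p : M}
  {e : OpenPartialHomeomorph M ℂ}

theorem SmoothAt.contDiffAt (hf : SmoothAt f p)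
    (he : e ∈ IsManifold.maximalAtlas 𝓘(ℂ) ω M) (hp : p ∈ e.source) :
    ContDiffAt ℝ ∞ (f ∘ e.symm) (e p) := by
  rw [← contMDiffAt_iff_contDiffAt]
  refine ContMDiffAt.comp (I' := 𝓘(ℝ, ℂ)) (e p) ?_
    (contMDiffAt_symm_of_mem_maximalAtlas (mem_real_maximalAtlas he) (e.map_source hp))
  rwa [e.left_inv hp]

theorem smoothAt_of_contDiffAt (he : e ∈ IsManifold.maximalAtlas 𝓘(ℂ) ω M) (hp : p ∈ e.source)
    (hf : ContDiffAt ℝ ∞ (f ∘ e.symm) (e p)) : SmoothAt f p := by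
  have h1 : SmoothAt ((f ∘ e.symm) ∘ e) p :=
    ContMDiffAt.comp (I' := 𝓘(ℝ, ℂ)) p (contMDiffAt_iff_contDiffAt.2 hf)
      (contMDiffAt_of_mem_maximalAtlas (mem_real_maximalAtlas he) hp)
  refine h1.congr_of_eventuallyEq ?_
  filter_upwards [e.open_source.mem_nhds hp] with q hq
  simp [e.left_inv hq]

theorem SmoothAt.comp_contDiffAt {W : Type*} [NormedAddCommGroup W] [NormedSpace ℝ W] {φ : V → W}
    (hφ : ContDiffAt ℝ ∞ φ (f p)) (hf : SmoothAt f p) : SmoothAt (fun q => φ (f q)) p :=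
  ContMDiffAt.comp (I' := 𝓘(ℝ, V)) p (contMDiffAt_iff_contDiffAt.2 hφ) hf

theorem SmoothAt.mul {f g : M → ℂ} (hf : SmoothAt f p) (hg : SmoothAt g p) :
    SmoothAt (fun q => f q * g q) p :=
  SmoothAt.comp_contDiffAt (f := fun q => (f q, g q)) (φ := fun x : ℂ × ℂ => x.1 * x.2)
    contDiff_mul.contDiffAt (hf.prodMk_space hg)

theorem SmoothAt.inv {f : M → ℂ} (hf : SmoothAt f p) (h : f p ≠ 0) :
    SmoothAt (fun q => (f q)⁻¹) p :=
  SmoothAt.comp_contDiffAt (contDiffAt_inv ℝ h) hf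

theorem SmoothAt.conj {f : M → ℂ} (hf : SmoothAt f p) :
    SmoothAt (fun q => starRingEnd ℂ (f q)) p :=
  SmoothAt.comp_contDiffAt (φ := fun z : ℂ => starRingEnd ℂ z)
    Complex.conjCLE.contDiff.contDiffAt hf

/-- The ring of complex functions which are smooth at `p`. -/
def smoothSubring (p : M) : Subring (M → ℂ) where
  carrier := {f | SmoothAt f p}
  mul_mem' := SmoothAt.mul
  one_mem' := contMDiffAt_const
  add_mem' := ContMDiffAt.add
  zero_mem' := contMDiffAt_const
  neg_mem' := ContMDiffAt.neg

end RealStructure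

/-! ### Determinants and inverses of matrices of functions -/

section MatrixFunctions

variable {X ι : Type*} [Fintype ι] [DecidableEq ι]

/-- The determinant is a polynomial in the entries. Phrased for a subring of functions so as to
serve both smooth and analytic matrices. -/
theorem det_mem_subring (S : Subring (X → ℂ)) {F : X → Matrix ι ι ℂ}
    (h : ∀ a b, (fun x => F x a b) ∈ S) : (fun x => (F x).det) ∈ S := by
  have : (fun x => (F x).det) =
      ∑ σ : Equiv.Perm ι, Equiv.Perm.sign σ • ∏ i, fun x => F x (σ i) i := by
    ext x
    simp [Matrix.det_apply, Finset.sum_apply, Finset.prod_apply]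
  rw [this]
  refine sum_mem fun σ _ => ?_
  have h1 := S.prod_mem (t := Finset.univ) (f := fun i x => F x (σ i) i) fun i _ => h _ _
  rcases Int.units_eq_one_or (Equiv.Perm.sign σ) with h2 | h2
  · rwa [h2, one_smul]
  · rw [h2, Units.neg_smul, one_smul]
    exact neg_mem h1

theorem adjugate_mem_subring (S : Subring (X → ℂ)) {F : X → Matrix ι ι ℂ}
    (h : ∀ a b, (fun x => F x a b) ∈ S) (a b : ι) : (fun x => (F x).adjugate a b) ∈ S := by
  simp_rw [Matrix.adjugate_apply]
  refine det_mem_subring S fun i j => ?_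
  by_cases hi : i = b
  · subst hi
    simp only [Matrix.updateRow_self, Pi.single_apply]
    split_ifs
    · exact S.one_mem
    · exact S.zero_mem
  · simpa only [Matrix.updateRow_ne hi] using h i j

end MatrixFunctions

/-! ### Smooth matrix-valued maps -/

section MatSmooth

variable {M : Type*} [TopologicalSpace M] [ChartedSpace ℂ M] {ι κ ν : Type*}
  {F : M → Matrix ι κ ℂ} {p : M}

/-- Entrywise smoothness of a matrix valued map. -/
def MatSmoothAt (F : M → Matrix ι κ ℂ) (p : M) : Prop :=
  ∀ a b, SmoothAt (fun q => F q a b) p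

theorem matSmoothAt_const (A : Matrix ι κ ℂ) : MatSmoothAt (fun _ : M => A) p :=
  fun _ _ => contMDiffAt_const

theorem MatSmoothAt.mul [Fintype κ] {G : M → Matrix κ ν ℂ} (hF : MatSmoothAt F p)
    (hG : MatSmoothAt G p) : MatSmoothAt (fun q => F q * G q) p := by
  intro a b
  simp_rw [Matrix.mul_apply]
  exact contMDiffAt_finsetSum fun c _ => (hF a c).mul (hG c b)

theorem MatSmoothAt.add {G : M → Matrix ι κ ℂ} (hF : MatSmoothAt F p) (hG : MatSmoothAt G p) :
    MatSmoothAt (fun q => F q + G q) p :=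
  fun a b => ContMDiffAt.add (hF a b) (hG a b)

theorem MatSmoothAt.sub {G : M → Matrix ι κ ℂ} (hF : MatSmoothAt F p) (hG : MatSmoothAt G p) :
    MatSmoothAt (fun q => F q - G q) p :=
  fun a b => ContMDiffAt.sub (hF a b) (hG a b)

theorem MatSmoothAt.conjTranspose (hF : MatSmoothAt F p) : MatSmoothAt (fun q => (F q)ᴴ) p :=
  fun a b => (hF b a).conj

theorem MatSmoothAt.const_smul (hF : MatSmoothAt F p) (c : ℂ) :
    MatSmoothAt (fun q => c • F q) p :=
  fun a b => SmoothAt.mul contMDiffAt_const (hF a b)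

theorem MatSmoothAt.sum {σ : Type*} (s : Finset σ) {F : σ → M → Matrix ι κ ℂ}
    (hF : ∀ i ∈ s, MatSmoothAt (F i) p) : MatSmoothAt (fun q => ∑ i ∈ s, F i q) p := by
  intro a b
  simp_rw [Matrix.sum_apply]
  exact contMDiffAt_finsetSum fun i hi => hF i hi a b

theorem MatSmoothAt.map_conj (hF : MatSmoothAt F p) :
    MatSmoothAt (fun q => (F q).map (starRingEnd ℂ)) p :=
  fun a b => (hF a b).conj

theorem MatSmoothAt.inv [Fintype ι] [DecidableEq ι] {F : M → Matrix ι ι ℂ} (hF : MatSmoothAt F p)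
    (h : (F p).det ≠ 0) : MatSmoothAt (fun q => (F q)⁻¹) p := by
  intro a b
  have h1 : SmoothAt (fun q => (F q).det) p := det_mem_subring (smoothSubring p) hF
  have h2 : SmoothAt (fun q => (F q).adjugate a b) p := adjugate_mem_subring (smoothSubring p) hF a b
  simp_rw [Matrix.inv_def, Matrix.smul_apply, Ring.inverse_eq_inv', smul_eq_mul]
  exact (h1.inv h).mul h2

theorem MatSmoothAt.congr {G : M → Matrix ι κ ℂ} (hF : MatSmoothAt F p)
    (h : ∀ᶠ q in 𝓝 p, G q = F q) : MatSmoothAt G p :=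
  fun a b => (hF a b).congr_of_eventuallyEq (h.mono fun q hq => by simp only [hq])

theorem MatSmoothAt.continuousAt (hF : MatSmoothAt F p) : ContinuousAt F p :=
  tendsto_pi_nhds.2 fun a => tendsto_pi_nhds.2 fun b => (hF a b).continuousAt

theorem MatSmoothAt.eventually_det_ne_zero [Fintype ι] [DecidableEq ι] {F : M → Matrix ι ι ℂ}
    (hF : MatSmoothAt F p) (h : (F p).det ≠ 0) : ∀ᶠ q in 𝓝 p, (F q).det ≠ 0 := by
  have h1 : SmoothAt (fun q => (F q).det) p := det_mem_subring (smoothSubring p) hF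
  exact h1.continuousAt.eventually_ne h

end MatSmooth

/-! ### The operators `∂_z` and `∂_z̄` -/

section Derivations

theorem comp_symm_eventuallyEq {M V : Type*} [TopologicalSpace M]
    {e : OpenPartialHomeomorph M ℂ} {p : M} {f g : M → V} (hp : p ∈ e.source) (h : ∀ᶠ q in 𝓝 p, f q = g q) :
    f ∘ e.symm =ᶠ[𝓝 (e p)] g ∘ e.symm :=
  (tendsto_symm_nhds hp).eventually h

variable {M : Type*} [TopologicalSpace M]

/-- The operator `½ (∂_x + c ∂_y)` with respect to the coordinate `x + i y = e`; it is `∂_z` for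
`c = -i` and `∂_z̄` for `c = i`. -/
def dd {V : Type*} [NormedAddCommGroup V] [NormedSpace ℝ V] [NormedSpace ℂ V] (c : ℂ)
    (e : OpenPartialHomeomorph M ℂ) (f : M → V) (p : M) : V :=
  (1 / 2 : ℂ) • (fderiv ℝ (f ∘ e.symm) (e p) 1 + c • fderiv ℝ (f ∘ e.symm) (e p) Complex.I)

/-- Differentiability at `p` in the coordinate `e`. -/
abbrev DiffAt {V : Type*} [NormedAddCommGroup V] [NormedSpace ℝ V]
    (e : OpenPartialHomeomorph M ℂ) (f : M → V) (p : M) : Prop :=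
  DifferentiableAt ℝ (f ∘ e.symm) (e p)

variable {V : Type*} [NormedAddCommGroup V] [NormedSpace ℝ V] [NormedSpace ℂ V]
  {e : OpenPartialHomeomorph M ℂ} {p : M} {c : ℂ}

theorem dz_eq_dd (f : M → V) : dz e f p = dd (-Complex.I) e f p := by
  rw [dz, dd, neg_smul, sub_eq_add_neg]

theorem dd_congr {f g : M → V} (hp : p ∈ e.source) (h : ∀ᶠ q in 𝓝 p, f q = g q) :
    dd c e f p = dd c e g p := by
  rw [dd, dd, (comp_symm_eventuallyEq hp h).fderiv_eq]

theorem dd_const (v : V) : dd c e (fun _ => v) p = 0 := by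
  have : (fun _ : M => v) ∘ e.symm = fun _ => v := rfl
  simp [dd, this]

theorem dd_add {f g : M → V} (hf : DiffAt e f p) (hg : DiffAt e g p) :
    dd c e (fun q => f q + g q) p = dd c e f p + dd c e g p := by
  have : (fun q => f q + g q) ∘ e.symm = fun z => (f ∘ e.symm) z + (g ∘ e.symm) z := rfl
  rw [dd, dd, dd, this, fderiv_fun_add hf hg]
  simp only [add_apply, smul_add]
  abel

theorem dd_sum {σ : Type*} (s : Finset σ) {f : σ → M → V} (hf : ∀ i ∈ s, DiffAt e (f i) p) :
    dd c e (fun q => ∑ i ∈ s, f i q) p = ∑ i ∈ s, dd c e (f i) p := by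
  have : (fun q => ∑ i ∈ s, f i q) ∘ e.symm = fun z => ∑ i ∈ s, (f i ∘ e.symm) z := rfl
  simp only [dd]
  rw [this, fderiv_fun_sum hf]
  simp only [sum_apply, Finset.smul_sum, ← Finset.sum_add_distrib]

theorem dd_mul {f g : M → ℂ} (hf : DiffAt e f p) (hg : DiffAt e g p) (hp : p ∈ e.source) :
    dd c e (fun q => f q * g q) p = dd c e f p * g p + f p * dd c e g p := by
  have : (fun q => f q * g q) ∘ e.symm = fun z => (f ∘ e.symm) z * (g ∘ e.symm) z := rfl
  rw [dd, dd, dd, this, fderiv_fun_mul hf hg]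
  simp only [add_apply, smul_apply, smul_eq_mul, Function.comp_apply, e.left_inv hp]
  ring

theorem dd_clm {W : Type*} [NormedAddCommGroup W] [NormedSpace ℝ W] [NormedSpace ℂ W]
    [IsScalarTower ℝ ℂ V] [IsScalarTower ℝ ℂ W]
    (L : V →L[ℂ] W) {f : M → V} (hf : DiffAt e f p) :
    dd c e (fun q => L (f q)) p = L (dd c e f p) := by
  have : (fun q => L (f q)) ∘ e.symm = (L.restrictScalars ℝ) ∘ (f ∘ e.symm) := rfl
  rw [dd, dd, this, fderiv_comp _ (L.restrictScalars ℝ).differentiableAt hf,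
    ContinuousLinearMap.fderiv]
  simp

theorem DiffAt.conj {f : M → ℂ} (hf : DiffAt e f p) :
    DiffAt e (fun q => starRingEnd ℂ (f q)) p :=
  (Complex.conjCLE.differentiableAt (x := (f ∘ e.symm) (e p))).comp (e p) hf

theorem dd_conj {f : M → ℂ} (hf : DiffAt e f p) :
    dd c e (fun q => starRingEnd ℂ (f q)) p = starRingEnd ℂ (dd (starRingEnd ℂ c) e f p) := by
  have : (fun q => starRingEnd ℂ (f q)) ∘ e.symm =
      (Complex.conjCLE : ℂ →L[ℝ] ℂ) ∘ (f ∘ e.symm) := rfl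
  rw [dd, dd, this, fderiv_comp _ (Complex.conjCLE : ℂ →L[ℝ] ℂ).differentiableAt hf,
    ContinuousLinearMap.fderiv]
  simp only [smul_eq_mul, map_mul, map_add, Complex.conj_conj, map_div₀, map_one, map_ofNat]
  rfl

theorem DiffAt.mul {f g : M → ℂ} (hf : DiffAt e f p) (hg : DiffAt e g p) :
    DiffAt e (fun q => f q * g q) p :=
  DifferentiableAt.mul hf hg

/-- The Cauchy–Riemann equation, read in the coordinate `e`. -/
theorem differentiableAt_complex_iff {f : M → ℂ} :
    DifferentiableAt ℂ (f ∘ e.symm) (e p) ↔ DiffAt e f p ∧ dd Complex.I e f p = 0 := by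
  rw [differentiableAt_complex_iff_differentiableAt_real]
  refine and_congr_right fun _ => ?_
  rw [dd, smul_eq_zero_iff_right (by norm_num)]
  constructor
  · intro h
    rw [h, smul_smul, Complex.I_mul_I, neg_one_smul, add_neg_cancel]
  · intro h
    rw [eq_neg_of_add_eq_zero_left h, smul_neg, smul_smul, Complex.I_mul_I, neg_one_smul, neg_neg]

section Matrices

variable {ι κ ν : Type*}

/-- Entrywise `½ (∂_x + c ∂_y)`. -/
def ddM (c : ℂ) (e : OpenPartialHomeomorph M ℂ) (F : M → Matrix ι κ ℂ) (p : M) : Matrix ι κ ℂ :=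
  Matrix.of fun a b => dd c e (fun q => F q a b) p

/-- Entrywise differentiability in the coordinate `e`. -/
def MatDiffAt (e : OpenPartialHomeomorph M ℂ) (F : M → Matrix ι κ ℂ) (p : M) : Prop :=
  ∀ a b, DiffAt e (fun q => F q a b) p

theorem dzMat_eq_ddM {n : ℕ} (F : M → Mat n) : dzMat e F p = ddM (-Complex.I) e F p := by
  ext a b
  exact dz_eq_dd _

theorem dzbarMat_eq_ddM {n : ℕ} (F : M → Mat n) : dzbarMat e F p = ddM Complex.I e F p := rfl

variable {F : M → Matrix ι κ ℂ}

theorem matDiffAt_const (A : Matrix ι κ ℂ) : MatDiffAt e (fun _ : M => A) p :=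
  fun _ _ => differentiableAt_const _

theorem MatDiffAt.mul [Fintype κ] {G : M → Matrix κ ν ℂ} (hF : MatDiffAt e F p)
    (hG : MatDiffAt e G p) : MatDiffAt e (fun q => F q * G q) p := by
  intro a b
  simp_rw [Matrix.mul_apply]
  exact DifferentiableAt.fun_sum fun i _ => (hF a i).mul (hG i b)

theorem MatDiffAt.add {G : M → Matrix ι κ ℂ} (hF : MatDiffAt e F p) (hG : MatDiffAt e G p) :
    MatDiffAt e (fun q => F q + G q) p :=
  fun a b => DifferentiableAt.add (hF a b) (hG a b)

theorem MatDiffAt.sub {G : M → Matrix ι κ ℂ} (hF : MatDiffAt e F p) (hG : MatDiffAt e G p) :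
    MatDiffAt e (fun q => F q - G q) p :=
  fun a b => DifferentiableAt.sub (hF a b) (hG a b)

theorem MatDiffAt.const_smul (hF : MatDiffAt e F p) (k : ℂ) :
    MatDiffAt e (fun q => k • F q) p :=
  fun a b => DifferentiableAt.const_mul (hF a b) k

theorem MatDiffAt.conjTranspose (hF : MatDiffAt e F p) : MatDiffAt e (fun q => (F q)ᴴ) p :=
  fun a b => (hF b a).conj

theorem ddM_congr {G : M → Matrix ι κ ℂ} (hp : p ∈ e.source) (h : ∀ᶠ q in 𝓝 p, F q = G q) :
    ddM c e F p = ddM c e G p := by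
  ext a b
  exact dd_congr hp (h.mono fun q hq => by rw [hq])

theorem ddM_const (A : Matrix ι κ ℂ) : ddM c e (fun _ : M => A) p = 0 := by
  ext a b
  exact dd_const _

theorem ddM_mul [Fintype κ] {G : M → Matrix κ ν ℂ} (hF : MatDiffAt e F p) (hG : MatDiffAt e G p)
    (hp : p ∈ e.source) :
    ddM c e (fun q => F q * G q) p = ddM c e F p * G p + F p * ddM c e G p := by
  ext a b
  simp only [ddM, Matrix.of_apply, Matrix.mul_apply, Matrix.add_apply]
  rw [dd_sum _ fun i _ => (hF a i).mul (hG i b), ← Finset.sum_add_distrib]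
  exact Finset.sum_congr rfl fun i _ => dd_mul (hF a i) (hG i b) hp

theorem ddM_add {G : M → Matrix ι κ ℂ} (hF : MatDiffAt e F p) (hG : MatDiffAt e G p) :
    ddM c e (fun q => F q + G q) p = ddM c e F p + ddM c e G p := by
  ext a b
  exact dd_add (hF a b) (hG a b)

theorem ddM_const_mul [Fintype ι] (A : Matrix ν ι ℂ) (hF : MatDiffAt e F p) (hp : p ∈ e.source) :
    ddM c e (fun q => A * F q) p = A * ddM c e F p := by
  rw [ddM_mul (matDiffAt_const A) hF hp, ddM_const, Matrix.zero_mul, zero_add]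

theorem ddM_mul_const [Fintype κ] (A : Matrix κ ν ℂ) (hF : MatDiffAt e F p) (hp : p ∈ e.source) :
    ddM c e (fun q => F q * A) p = ddM c e F p * A := by
  rw [ddM_mul hF (matDiffAt_const A) hp, ddM_const, Matrix.mul_zero, add_zero]

theorem ddM_const_smul (k : ℂ) (hF : MatDiffAt e F p) (hp : p ∈ e.source) :
    ddM c e (fun q => k • F q) p = k • ddM c e F p := by
  ext a b
  simp only [ddM, Matrix.of_apply, Matrix.smul_apply, smul_eq_mul]
  rw [dd_mul (differentiableAt_const _) (hF a b) hp, dd_const, zero_mul, zero_add]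

theorem ddM_const_sub (A : Matrix ι κ ℂ) (hF : MatDiffAt e F p) (hp : p ∈ e.source) :
    ddM c e (fun q => A - F q) p = - ddM c e F p := by
  have h : (fun q => A - F q) = fun q => A + (-1 : ℂ) • F q := by
    ext1 q
    rw [neg_one_smul, sub_eq_add_neg]
  rw [h, ddM_add (matDiffAt_const A) (hF.const_smul _), ddM_const, zero_add,
    ddM_const_smul _ hF hp, neg_one_smul]

theorem ddM_sum {σ : Type*} (s : Finset σ) {F : σ → M → Matrix ι κ ℂ}
    (hF : ∀ i ∈ s, MatDiffAt e (F i) p) :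
    ddM c e (fun q => ∑ i ∈ s, F i q) p = ∑ i ∈ s, ddM c e (F i) p := by
  ext a b
  simp only [ddM, Matrix.of_apply, Matrix.sum_apply]
  exact dd_sum s fun i hi => hF i hi a b

theorem ddM_conjTranspose (hF : MatDiffAt e F p) :
    ddM c e (fun q => (F q)ᴴ) p = (ddM (starRingEnd ℂ c) e F p)ᴴ := by
  ext a b
  exact dd_conj (hF b a)

end Matrices

end Derivations

/-! ### Regularity of the coordinate derivatives -/

section Smooth

variable {M : Type*} [TopologicalSpace M] [ChartedSpace ℂ M] {e : OpenPartialHomeomorph M ℂ}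
  {p : M} {c : ℂ}

theorem SmoothAt.diffAt {V : Type*} [NormedAddCommGroup V] [NormedSpace ℝ V] {f : M → V}
    (hf : SmoothAt f p) (he : e ∈ IsManifold.maximalAtlas 𝓘(ℂ) ω M) (hp : p ∈ e.source) :
    DiffAt e f p :=
  (hf.contDiffAt he hp).differentiableAt (by simp)

theorem SmoothAt.continuousAt_dd {V : Type*} [NormedAddCommGroup V] [NormedSpace ℝ V]
    [NormedSpace ℂ V] {f : M → V} (hf : SmoothAt f p)
    (he : e ∈ IsManifold.maximalAtlas 𝓘(ℂ) ω M) (hp : p ∈ e.source) :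
    ContinuousAt (dd c e f) p := by
  have h1 : ContinuousAt (fderiv ℝ (f ∘ e.symm)) (e p) :=
    ((hf.contDiffAt he hp).fderiv_right (m := 0) (by simp)).continuousAt
  have h2 : ContinuousAt (fun q => fderiv ℝ (f ∘ e.symm) (e q)) p :=
    ContinuousAt.comp (f := e) h1 (e.continuousAt hp)
  unfold dd
  exact ((h2.clm_apply continuousAt_const).add
    ((h2.clm_apply continuousAt_const).const_smul c)).const_smul _

variable {ι κ : Type*} {F : M → Matrix ι κ ℂ}

theorem MatSmoothAt.matDiffAt (hF : MatSmoothAt F p)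
    (he : e ∈ IsManifold.maximalAtlas 𝓘(ℂ) ω M) (hp : p ∈ e.source) : MatDiffAt e F p :=
  fun a b => (hF a b).diffAt he hp

theorem MatSmoothAt.continuousAt_ddM (hF : MatSmoothAt F p)
    (he : e ∈ IsManifold.maximalAtlas 𝓘(ℂ) ω M) (hp : p ∈ e.source) :
    ContinuousAt (ddM c e F) p :=
  tendsto_pi_nhds.2 fun a => tendsto_pi_nhds.2 fun b => (hF a b).continuousAt_dd he hp

end Smooth

/-! ### Saturation of families of holomorphic vectors -/

section Saturation

variable {N : Type*} [Fintype N]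

theorem exists_left_inverse_of_linearIndependent {k : ℕ} {w : Fin k → N → ℂ}
    (hw : LinearIndependent ℂ w) :
    ∃ Λ : Matrix (Fin k) N ℂ, Λ * (Matrix.of w)ᵀ = 1 := by
  classical
  have hinj : Function.Injective (Matrix.of w)ᵀ.mulVec := by
    rw [Matrix.mulVec_injective_iff]
    exact hw
  obtain ⟨g, hg⟩ := LinearMap.exists_leftInverse_of_injective (Matrix.toLin' (Matrix.of w)ᵀ)
    (LinearMap.ker_eq_bot.2 hinj)
  refine ⟨LinearMap.toMatrix' g, ?_⟩
  have h := congrArg LinearMap.toMatrix' hg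
  rwa [LinearMap.toMatrix'_comp, LinearMap.toMatrix'_toLin', LinearMap.toMatrix'_id] at h

/-- The ring of complex functions which are analytic at `z₀`. -/
def analyticSubring (z₀ : ℂ) : Subring (ℂ → ℂ) where
  carrier := {f | AnalyticAt ℂ f z₀}
  mul_mem' := AnalyticAt.mul
  one_mem' := analyticAt_const
  add_mem' := AnalyticAt.add
  zero_mem' := analyticAt_const
  neg_mem' := AnalyticAt.neg

theorem analyticAt_inv_entry {ι : Type*} [Fintype ι] [DecidableEq ι] {z₀ : ℂ}
    {G : ℂ → Matrix ι ι ℂ} (hG : ∀ a b, AnalyticAt ℂ (fun z => G z a b) z₀)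
    (h : (G z₀).det ≠ 0) (a b : ι) : AnalyticAt ℂ (fun z => (G z)⁻¹ a b) z₀ := by
  have h1 : AnalyticAt ℂ (fun z => (G z).det) z₀ := det_mem_subring (analyticSubring z₀) hG
  have h2 : AnalyticAt ℂ (fun z => (G z).adjugate a b) z₀ :=
    adjugate_mem_subring (analyticSubring z₀) hG a b
  simp_rw [Matrix.inv_def, Matrix.smul_apply, Ring.inverse_eq_inv', smul_eq_mul]
  exact (h1.inv h).mul h2

theorem sup_span_singleton_eq {V : Type*} [AddCommGroup V] [Module ℂ V] {S : Submodule ℂ V}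
    {x y : V} {u : ℂ} (hu : u ≠ 0) (h : x - u • y ∈ S) :
    Submodule.span ℂ {x} ⊔ S = Submodule.span ℂ {y} ⊔ S := by
  apply le_antisymm
  · refine sup_le ?_ le_sup_right
    rw [Submodule.span_singleton_le_iff_mem, Submodule.mem_sup]
    exact ⟨u • y, Submodule.smul_mem _ _ (Submodule.mem_span_singleton_self y), _, h, by abel⟩
  · refine sup_le ?_ le_sup_right
    rw [Submodule.span_singleton_le_iff_mem, Submodule.mem_sup]
    refine ⟨u⁻¹ • x, Submodule.smul_mem _ _ (Submodule.mem_span_singleton_self x),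
      -(u⁻¹ • (x - u • y)), S.neg_mem (S.smul_mem _ h), ?_⟩
    rw [smul_sub, smul_smul, inv_mul_cancel₀ hu, one_smul]
    abel

/-- Induction on the number of vectors. A new vector is corrected by a combination of the frame
found so far until a left inverse Λ of that frame at z₀ annihilates it. Either the remainder is
identically zero, or dividing it by the exact power of z - z₀ gives a vector nonzero at z₀; it is
still killed by Λ, hence independent of the frame at z₀. The division changes the span only at z₀.
-/
theorem exists_analytic_frame (z₀ : ℂ) : ∀ (m : ℕ) (v : Fin m → ℂ → N → ℂ),
    (∀ j, AnalyticAt ℂ (v j) z₀) → ∃ (k : ℕ) (w : Fin k → ℂ → N → ℂ),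
      (∀ i, AnalyticAt ℂ (w i) z₀) ∧ LinearIndependent ℂ (fun i => w i z₀) ∧
      ∀ᶠ z in 𝓝[≠] z₀, Submodule.span ℂ (Set.range fun j => v j z) =
        Submodule.span ℂ (Set.range fun i => w i z) := by
  intro m
  induction m with
  | zero =>
    intro v _
    exact ⟨0, fun i => i.elim0, fun i => i.elim0, linearIndependent_empty_type,
      Eventually.of_forall fun z => by simp⟩
  | succ m ih =>
    intro v hv
    obtain ⟨k, w, hw, hli, hspan⟩ := ih (fun j => v j.succ) fun j => hv _
    obtain ⟨Λ, hΛ⟩ := exists_left_inverse_of_linearIndependent hli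
    set F : ℂ → Matrix N (Fin k) ℂ := fun z => (Matrix.of fun i => w i z)ᵀ with hF
    have hFa : ∀ a b, AnalyticAt ℂ (fun z => F z a b) z₀ := fun a b =>
      (analyticAt_pi_iff.1 (hw b)) a
    have hGa : ∀ a b, AnalyticAt ℂ (fun z => (Λ * F z) a b) z₀ := fun a b => by
      simp_rw [Matrix.mul_apply]
      exact Finset.analyticAt_fun_sum _ fun c _ => analyticAt_const.mul (hFa c b)
    have hG0 : (Λ * F z₀).det ≠ 0 := by
      rw [hF, hΛ, Matrix.det_one]
      exact one_ne_zero
    have hGn : ∀ᶠ z in 𝓝 z₀, (Λ * F z).det ≠ 0 := by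
      have h1 : AnalyticAt ℂ (fun z => (Λ * F z).det) z₀ :=
        det_mem_subring (analyticSubring z₀) hGa
      exact h1.continuousAt.eventually_ne hG0
    -- The coordinates for which Λ(v - Fc) = 0; they are analytic because ΛF is the identity at z₀.
    set c : ℂ → Fin k → ℂ := fun z => (Λ * F z)⁻¹ *ᵥ (Λ *ᵥ v 0 z) with hc
    have hva : ∀ a, AnalyticAt ℂ (fun z => v 0 z a) z₀ := fun a => (analyticAt_pi_iff.1 (hv 0)) a
    have hca : ∀ a, AnalyticAt ℂ (fun z => c z a) z₀ := fun a => by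
      simp only [hc, Matrix.mulVec, dotProduct]
      exact Finset.analyticAt_fun_sum _ fun b _ => (analyticAt_inv_entry hGa hG0 a b).mul
        (Finset.analyticAt_fun_sum _ fun d _ => analyticAt_const.mul (hva d))
    set v' : ℂ → N → ℂ := fun z => v 0 z - F z *ᵥ c z with hv'
    have hv'a : AnalyticAt ℂ v' z₀ := by
      rw [analyticAt_pi_iff]
      intro a
      simp only [Pi.sub_apply, Matrix.mulVec, dotProduct]
      exact (hva a).fun_sub (Finset.analyticAt_fun_sum _ fun b _ => (hFa a b).mul (hca b))
    have hFc : ∀ z, F z *ᵥ c z ∈ Submodule.span ℂ (Set.range fun i => w i z) := by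
      intro z
      have : F z *ᵥ c z = ∑ i, c z i • w i z := by
        ext a
        simp [hF, Matrix.mulVec, dotProduct, mul_comm]
      rw [this]
      exact sum_mem fun i _ => Submodule.smul_mem _ _ (Submodule.subset_span ⟨i, rfl⟩)
    have hrange : ∀ z, Submodule.span ℂ (Set.range fun j => v j z) =
        Submodule.span ℂ {v 0 z} ⊔ Submodule.span ℂ (Set.range fun j : Fin m => v j.succ z) := by
      intro z
      have : (fun j => v j z) = Fin.cons (v 0 z) fun j : Fin m => v j.succ z := by
        ext j
        refine Fin.cases ?_ (fun j => ?_) j <;> simp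
      rw [this, Fin.range_cons, Submodule.span_insert]
    by_cases hzero : ∀ᶠ z in 𝓝 z₀, v' z = 0
    · refine ⟨k, w, hw, hli, ?_⟩
      filter_upwards [hspan, hzero.filter_mono nhdsWithin_le_nhds] with z h1 h2
      rw [hrange, h1]
      refine sup_eq_right.2 ?_
      rw [Submodule.span_singleton_le_iff_mem, sub_eq_zero.1 h2]
      exact hFc z
    · obtain ⟨a, g, hga, hg0, hg⟩ := (hv'a.exists_eventuallyEq_pow_smul_nonzero_iff).2 hzero
      have hΛv' : ∀ᶠ z in 𝓝 z₀, Λ *ᵥ v' z = 0 := by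
        filter_upwards [hGn] with z hz
        simp only [hv', hc, Matrix.mulVec_sub, Matrix.mulVec_mulVec]
        rw [← Matrix.mul_assoc, Matrix.mul_nonsing_inv_cancel_left _ _ (isUnit_iff_ne_zero.2 hz),
          sub_self]
      have hΛg : Λ *ᵥ g z₀ = 0 := by
        have hcont : ContinuousAt (fun z => Λ *ᵥ g z) z₀ :=
          ((Matrix.mulVecLin Λ).toContinuousLinearMap.continuous.continuousAt).comp
            hga.continuousAt
        refine eq_of_eventuallyEq_nhdsNE (M := ℂ) hcont continuousAt_const ?_
        filter_upwards [(hΛv'.and hg).filter_mono nhdsWithin_le_nhds, self_mem_nhdsWithin]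
          with z hz hne
        rw [hz.2, Matrix.mulVec_smul] at hz
        exact (smul_eq_zero.1 hz.1).resolve_left (pow_ne_zero _ (sub_ne_zero.2 hne))
      refine ⟨k + 1, Fin.cons g w, ?_, ?_, ?_⟩
      · intro i
        refine Fin.cases ?_ (fun i => ?_) i
        · simpa using hga
        · simpa using hw i
      · have : (fun i => (Fin.cons g w : Fin (k + 1) → ℂ → N → ℂ) i z₀) =
            Fin.cons (g z₀) fun i => w i z₀ := by
          ext i
          refine Fin.cases ?_ (fun i => ?_) i <;> simp
        rw [this, linearIndependent_finCons]
        refine ⟨hli, fun hmem => hg0 ?_⟩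
        obtain ⟨b, hb⟩ := (Submodule.mem_span_range_iff_exists_fun ℂ).1 hmem
        have hb' : g z₀ = F z₀ *ᵥ b := by
          rw [← hb]
          ext i
          simp [hF, Matrix.mulVec, dotProduct, mul_comm]
        rw [hb', Matrix.mulVec_mulVec, hF, hΛ, Matrix.one_mulVec] at hΛg
        rw [hb', hΛg, Matrix.mulVec_zero]
      · filter_upwards [hspan, hg.filter_mono nhdsWithin_le_nhds, self_mem_nhdsWithin]
          with z h1 h2 h3
        have : (fun i => (Fin.cons g w : Fin (k + 1) → ℂ → N → ℂ) i z) =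
            Fin.cons (g z) fun i => w i z := by
          ext i
          refine Fin.cases ?_ (fun i => ?_) i <;> simp
        rw [hrange, h1, this, Fin.range_cons, Submodule.span_insert]
        refine sup_span_singleton_eq (pow_ne_zero a (sub_ne_zero.2 h3)) ?_
        rw [← h2, hv', sub_sub_cancel]
        exact hFc z

end Saturation

/-! ### Orthogonal projections -/

section Projections

variable {n : ℕ}

/-- Equal ranges give RR' = R' and R'R = R; taking adjoints in the second identity yields RR' = R.
-/
theorem IsOrthProj.eq_of_range_eq {R R' : Mat n} (h : IsOrthProj R) (h' : IsOrthProj R')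
    (hr : LinearMap.range R.mulVecLin = LinearMap.range R'.mulVecLin) : R = R' := by
  have key : ∀ {A B : Mat n}, IsOrthProj A →
      LinearMap.range B.mulVecLin ≤ LinearMap.range A.mulVecLin → A * B = B := by
    intro A B hA hAB
    refine Matrix.mulVec_injective (funext fun v => ?_)
    obtain ⟨u, hu⟩ := hAB ⟨v, rfl⟩
    simp only [Matrix.mulVecLin_apply] at hu
    rw [← Matrix.mulVec_mulVec, ← hu, Matrix.mulVec_mulVec, hA.mul_self]
  have h1 := key h hr.ge
  have h2 := congrArg Matrix.conjTranspose (key h' hr.le)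
  rw [Matrix.conjTranspose_mul, h.conjTranspose, h'.conjTranspose, h1] at h2
  exact h2.symm

open scoped ComplexOrder in
theorem det_conjTranspose_mul_self_ne_zero {N κ : Type*} [Fintype N] [Fintype κ] [DecidableEq κ]
    {F : Matrix N κ ℂ} (hF : Function.Injective F.mulVec) : (Fᴴ * F).det ≠ 0 := by
  intro h
  obtain ⟨v, hv0, hv⟩ := Matrix.exists_mulVec_eq_zero_iff.2 h
  rw [Matrix.conjTranspose_mul_self_mulVec_eq_zero] at hv
  exact hv0 (hF (by rw [hv, Matrix.mulVec_zero]))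

/-- The orthogonal projection onto the span of the columns of `F`. -/
def projOf {k : ℕ} (F : Matrix (Fin n) (Fin k) ℂ) : Mat n := F * (Fᴴ * F)⁻¹ * Fᴴ

theorem isOrthProj_projOf {k : ℕ} {F : Matrix (Fin n) (Fin k) ℂ} (h : (Fᴴ * F).det ≠ 0) :
    IsOrthProj (projOf F) where
  mul_self := by
    have hu : IsUnit (Fᴴ * F).det := isUnit_iff_ne_zero.2 h
    have : projOf F * projOf F = F * ((Fᴴ * F)⁻¹ * (Fᴴ * F)) * (Fᴴ * F)⁻¹ * Fᴴ := by
      simp only [projOf, Matrix.mul_assoc]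
    rw [this, Matrix.nonsing_inv_mul _ hu, Matrix.mul_one, projOf]
  conjTranspose := by
    simp only [projOf, Matrix.conjTranspose_mul, Matrix.conjTranspose_conjTranspose,
      Matrix.conjTranspose_nonsing_inv, Matrix.mul_assoc]

theorem range_projOf {k : ℕ} {F : Matrix (Fin n) (Fin k) ℂ} (h : (Fᴴ * F).det ≠ 0) :
    LinearMap.range (projOf F).mulVecLin = LinearMap.range F.mulVecLin := by
  have hu : IsUnit (Fᴴ * F).det := isUnit_iff_ne_zero.2 h
  apply le_antisymm
  · rw [projOf, Matrix.mul_assoc, Matrix.mulVecLin_mul]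
    exact LinearMap.range_comp_le_range _ _
  · have h1 : projOf F * F = F := by
      rw [projOf, Matrix.mul_assoc, Matrix.mul_assoc, Matrix.nonsing_inv_mul _ hu, Matrix.mul_one]
    conv_lhs => rw [← h1, Matrix.mulVecLin_mul]
    exact LinearMap.range_comp_le_range _ _

variable {M : Type*} [TopologicalSpace M] [ChartedSpace ℂ M] [T1Space M]

/-- A field of subspaces which generically is the range of `K`, and near every point is spanned
generically by a smooth frame, extends to a smooth field of subspaces. -/
theorem exists_smooth_proj (K : M → Mat n)
    (h : ∀ p, ∃ (k : ℕ) (F : M → Matrix (Fin n) (Fin k) ℂ), (∀ᶠ q in 𝓝 p, MatSmoothAt F q) ∧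
      ((F p)ᴴ * F p).det ≠ 0 ∧
      ∀ᶠ q in 𝓝[≠] p, LinearMap.range (F q).mulVecLin = LinearMap.range (K q).mulVecLin) :
    ∃ R : M → Mat n, (∀ p, IsOrthProj (R p)) ∧ (∀ p, MatSmoothAt R p) ∧
      ∀ᶠ p in codiscrete M, LinearMap.range (R p).mulVecLin = LinearMap.range (K p).mulVecLin := by
  choose k F hF hdet hr using h
  have hsm : ∀ p, MatSmoothAt (F p) p := fun p => (hF p).self_of_nhds
  have hdet' : ∀ p, ∀ᶠ q in 𝓝 p, ((F p q)ᴴ * F p q).det ≠ 0 := fun p =>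
    ((hsm p).conjTranspose.mul (hsm p)).eventually_det_ne_zero (hdet p)
  have hproj : ∀ p, ∀ᶠ q in 𝓝 p, MatSmoothAt (fun q => projOf (F p q)) q := by
    intro p
    filter_upwards [hF p, hdet' p] with q h1 h2
    exact (h1.mul ((h1.conjTranspose.mul h1).inv h2)).mul h1.conjTranspose
  -- For q near p, the projections built from the frames at p and at q agree generically around q,
  -- both having the range of K, and so by continuity at q itself. The pointwise choice q ↦ `projOf
  -- (F q q)` is thereby locally a single smooth map.
  have hloc : ∀ p, ∀ᶠ q in 𝓝 p, projOf (F q q) = projOf (F p q) := by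
    intro p
    have h1 := eventually_nhdsWithin_iff.1 (eventually_nhdsNE_eventually_nhds
      ((hr p).and ((hdet' p).filter_mono nhdsWithin_le_nhds)))
    filter_upwards [h1, hproj p] with q h2 h3
    by_cases hqp : q = p
    · rw [hqp]
    · refine eq_of_eventuallyEq_nhdsNE (f := fun x => projOf (F q x))
        (g := fun x => projOf (F p x)) (hproj q).self_of_nhds.continuousAt h3.continuousAt ?_
      filter_upwards [(h2 hqp).filter_mono nhdsWithin_le_nhds, hr q,
        (hdet' q).filter_mono nhdsWithin_le_nhds] with x h4 h5 h6
      refine (isOrthProj_projOf h6).eq_of_range_eq (isOrthProj_projOf h4.2) ?_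
      rw [range_projOf h6, range_projOf h4.2, h4.1, h5]
  refine ⟨fun p => projOf (F p p), fun p => isOrthProj_projOf (hdet p), fun p => ?_, ?_⟩
  · exact (hproj p).self_of_nhds.congr (hloc p)
  · rw [eventually_codiscrete_iff]
    intro p
    filter_upwards [(hloc p).filter_mono nhdsWithin_le_nhds, hr p,
      (hdet' p).filter_mono nhdsWithin_le_nhds] with q h1 h2 h3
    rw [h1, range_projOf h3, h2]

end Projections

/-! ### Extended solutions in terms of their coefficients -/

section ExtendedSolutions

variable {M : Type*} [TopologicalSpace M] [ChartedSpace ℂ M] {n r : ℕ}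
  {Φ : M → Circle → Mat n} {e : OpenPartialHomeomorph M ℂ} {p : M}

/-- `A^φ_z` for the harmonic map `φ = Φ_{-1}`. -/
abbrev connA (e : OpenPartialHomeomorph M ℂ) (Φ : M → Circle → Mat n) (p : M) : Mat n :=
  Az e (fun q => Φ q (-1)) p

/-- Polynomial extended solutions of degree at most `r`, in terms of their coefficients. -/
structure PolySolution (r : ℕ) (Φ : M → Circle → Mat n) : Prop where
  mem : ∀ p, Φ p ∈ OmegaPoly r n
  smooth : ∀ (k : ℤ) p, MatSmoothAt (fun q => loopCoeff (Φ q) k) p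
  ddM_eq : ∀ e ∈ IsManifold.maximalAtlas 𝓘(ℂ) ω M, ∀ p ∈ e.source, ∀ k : ℤ,
    ddM (-Complex.I) e (fun q => loopCoeff (Φ q) k) p =
      loopCoeff (Φ p) k * connA e Φ p - loopCoeff (Φ p) (k + 1) * connA e Φ p

theorem ddM_eval (hmem : ∀ p, Φ p ∈ OmegaPoly r n)
    (hsm : ∀ (k : ℤ) p, MatSmoothAt (fun q => loopCoeff (Φ q) k) p)
    (he : e ∈ IsManifold.maximalAtlas 𝓘(ℂ) ω M) (hp : p ∈ e.source) (c : ℂ) (z : Circle) :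
    ddM c e (fun q => Φ q z) p = ∑ k ∈ Finset.range (r + 1),
      (z : ℂ) ^ k • ddM c e (fun q => loopCoeff (Φ q) k) p := by
  have h1 : (fun q => Φ q z) = fun q => ∑ k ∈ Finset.range (r + 1),
      (z : ℂ) ^ k • loopCoeff (Φ q) k :=
    funext fun q => (OmegaPoly.isLaurent (hmem q)).eq_sum_range
      (fun k hk => OmegaPoly.support (hmem q) hk) z
  rw [h1, ddM_sum]
  · refine Finset.sum_congr rfl fun k _ => ?_
    rw [ddM_const_smul _ ((hsm k p).matDiffAt he hp) hp]
  · exact fun k _ => ((hsm k p).matDiffAt he hp).const_smul _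

theorem isLaurent_ddM (hmem : ∀ p, Φ p ∈ OmegaPoly r n)
    (hsm : ∀ (k : ℤ) p, MatSmoothAt (fun q => loopCoeff (Φ q) k) p)
    (he : e ∈ IsManifold.maximalAtlas 𝓘(ℂ) ω M) (hp : p ∈ e.source) (c : ℂ) :
    IsLaurent (fun z => ddM c e (fun q => Φ q z) p) :=
  (IsLaurent.of_sum_range (T := fun k => ddM c e (fun q => loopCoeff (Φ q) k) p)
    fun z => ddM_eval hmem hsm he hp c z).1

theorem loopCoeff_ddM (hmem : ∀ p, Φ p ∈ OmegaPoly r n)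
    (hsm : ∀ (k : ℤ) p, MatSmoothAt (fun q => loopCoeff (Φ q) k) p)
    (he : e ∈ IsManifold.maximalAtlas 𝓘(ℂ) ω M) (hp : p ∈ e.source) (c : ℂ) (k : ℤ) :
    loopCoeff (fun z => ddM c e (fun q => Φ q z) p) k =
      ddM c e (fun q => loopCoeff (Φ q) k) p := by
  have h1 : (fun z : Circle => ddM c e (fun q => Φ q z) p) = fun z : Circle =>
      ∑ k ∈ (Finset.range (r + 1)).map Nat.castEmbedding,
        (z : ℂ) ^ k • ddM c e (fun q => loopCoeff (Φ q) k) p := by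
    ext1 z
    rw [ddM_eval hmem hsm he hp, Finset.sum_map]
    simp
  rw [h1, loopCoeff_sum_zpow]
  split_ifs with h
  · rfl
  · have h2 : (fun q => loopCoeff (Φ q) k) = fun _ => 0 := by
      ext1 q
      refine OmegaPoly.coeff_eq_zero (hmem q) ?_
      by_contra hcon
      apply h
      simp only [Finset.mem_map, Finset.mem_range, Nat.castEmbedding_apply]
      exact ⟨k.toNat, by omega, by omega⟩
    rw [h2, ddM_const]

theorem matSmoothAt_eval (hmem : ∀ p, Φ p ∈ OmegaPoly r n)
    (hsm : ∀ (k : ℤ) p, MatSmoothAt (fun q => loopCoeff (Φ q) k) p) (z : Circle) (p : M) :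
    MatSmoothAt (fun q => Φ q z) p := by
  have h1 : (fun q => Φ q z) = fun q => ∑ k ∈ Finset.range (r + 1),
      (z : ℂ) ^ k • loopCoeff (Φ q) k :=
    funext fun q => (OmegaPoly.isLaurent (hmem q)).eq_sum_range
      (fun k hk => OmegaPoly.support (hmem q) hk) z
  rw [h1]
  exact MatSmoothAt.sum _ fun k _ => (hsm k p).const_smul _

theorem loopCoeff_mul_one_sub {γ : Circle → Mat n} (h : IsLaurent γ) (A : Mat n) (k : ℤ) :
    loopCoeff (fun z => γ z * ((1 - (z : ℂ)⁻¹) • A)) k =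
      loopCoeff γ k * A - loopCoeff γ (k + 1) * A := by
  have h1 : (fun z : Circle => γ z * ((1 - (z : ℂ)⁻¹) • A)) = fun z : Circle =>
      γ z * A + (z : ℂ) ^ (-1 : ℤ) • (γ z * (-A)) := by
    ext1 z
    rw [sub_smul, one_smul, mul_sub, Matrix.mul_smul, zpow_neg_one, mul_neg, smul_neg,
      sub_eq_add_neg]
  rw [h1, loopCoeff_add (h.mul_const A).continuous ((h.mul_const (-A)).zpow_smul (-1)).continuous,
    loopCoeff_mul_const h.continuous, loopCoeff_zpow_smul, loopCoeff_mul_const h.continuous,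
    sub_neg_eq_add, mul_neg, sub_eq_add_neg]

theorem isLaurent_mul_one_sub {γ : Circle → Mat n} (h : IsLaurent γ) (A : Mat n) :
    IsLaurent (fun z => γ z * ((1 - (z : ℂ)⁻¹) • A)) := by
  have h1 : (fun z : Circle => γ z * ((1 - (z : ℂ)⁻¹) • A)) = fun z : Circle =>
      γ z * A + (z : ℂ) ^ (-1 : ℤ) • (γ z * (-A)) := by
    ext1 z
    rw [sub_smul, one_smul, mul_sub, Matrix.mul_smul, zpow_neg_one, mul_neg, smul_neg,
      sub_eq_add_neg]
  rw [h1]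
  exact (h.mul_const A).add ((h.mul_const (-A)).zpow_smul (-1))

/-- The defining equation of an extended solution. -/
theorem PolySolution.ddM_eval_eq (h : PolySolution r Φ)
    (he : e ∈ IsManifold.maximalAtlas 𝓘(ℂ) ω M) (hp : p ∈ e.source) (z : Circle) :
    ddM (-Complex.I) e (fun q => Φ q z) p = Φ p z * ((1 - (z : ℂ)⁻¹) • connA e Φ p) := by
  have hl := OmegaPoly.isLaurent (h.mem p)
  refine congrFun (IsLaurent.ext (isLaurent_ddM h.mem h.smooth he hp _)
    (isLaurent_mul_one_sub hl (connA e Φ p)) fun k => ?_) z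
  rw [loopCoeff_ddM h.mem h.smooth he hp, loopCoeff_mul_one_sub hl, h.ddM_eq e he p hp]

/-- Differentiate ΦΦ* = 1 and insert the adjoint of the ∂_z equation; on the circle the conjugate of
1 - λ⁻¹ is 1 - λ. -/
theorem PolySolution.ddM_bar_eval_eq (h : PolySolution r Φ)
    (he : e ∈ IsManifold.maximalAtlas 𝓘(ℂ) ω M) (hp : p ∈ e.source) (z : Circle) :
    ddM Complex.I e (fun q => Φ q z) p = Φ p z * ((1 - (z : ℂ)) • -(connA e Φ p)ᴴ) := by
  have hd := (matSmoothAt_eval h.mem h.smooth z p).matDiffAt he hp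
  have h1 := ddM_mul (c := Complex.I) hd hd.conjTranspose hp
  simp_rw [OmegaPoly.mul_conjTranspose (h.mem _)] at h1
  rw [ddM_const, ddM_conjTranspose hd, Complex.conj_I, h.ddM_eval_eq he hp,
    Matrix.conjTranspose_mul, Matrix.conjTranspose_smul, ← Matrix.mul_assoc] at h1
  have h2 := congrArg (· * Φ p z) h1
  simp only [add_mul, zero_mul, mul_assoc, OmegaPoly.conjTranspose_mul (h.mem p), mul_one] at h2
  rw [eq_neg_of_add_eq_zero_left h2.symm]
  have h3 : star (1 - (z : ℂ)⁻¹) = 1 - (z : ℂ) := by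
    rw [← starRingEnd_apply, map_sub, map_one, ← Circle.coe_inv, ← Circle.coe_inv_eq_conj, inv_inv]
  rw [h3, smul_neg, mul_neg]

theorem PolySolution.ddM_bar_eq (h : PolySolution r Φ)
    (he : e ∈ IsManifold.maximalAtlas 𝓘(ℂ) ω M) (hp : p ∈ e.source) (k : ℤ) :
    ddM Complex.I e (fun q => loopCoeff (Φ q) k) p =
      loopCoeff (Φ p) (k - 1) * (connA e Φ p)ᴴ - loopCoeff (Φ p) k * (connA e Φ p)ᴴ := by
  have hl := OmegaPoly.isLaurent (h.mem p)
  rw [← loopCoeff_ddM h.mem h.smooth he hp]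
  have h1 : (fun z : Circle => ddM Complex.I e (fun q => Φ q z) p) = fun z : Circle =>
      Φ p z * (-(connA e Φ p)ᴴ) + (z : ℂ) ^ (1 : ℤ) • (Φ p z * (connA e Φ p)ᴴ) := by
    ext1 z
    rw [h.ddM_bar_eval_eq he hp, sub_smul, one_smul, mul_sub, Matrix.mul_smul, zpow_one, mul_neg,
      smul_neg, sub_neg_eq_add]
  rw [h1, loopCoeff_add (hl.mul_const _).continuous ((hl.mul_const _).zpow_smul 1).continuous,
    loopCoeff_mul_const hl.continuous, loopCoeff_zpow_smul, loopCoeff_mul_const hl.continuous,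
    mul_neg, neg_add_eq_sub]

theorem contMDiff_entry_mul_pow {T : M → ℂ} (hT : ∀ p, SmoothAt T p) (k : ℕ) :
    ContMDiff (𝓘(ℝ, ℂ).prod (𝓡 1)) 𝓘(ℝ, ℂ) ∞
      (fun x : M × Circle => (x.2 : ℂ) ^ k * T x.1) := by
  have h1 : ContMDiff 𝓘(ℝ, ℂ) 𝓘(ℝ, ℂ) ∞ T := hT
  have h2 : ContMDiff (𝓘(ℝ, ℂ).prod (𝓡 1)) 𝓘(ℝ, ℂ × ℂ) ∞
      (fun x : M × Circle => ((x.2 : ℂ), T x.1)) :=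
    (contMDiff_coe_circle.comp contMDiff_snd).prodMk_space (h1.comp contMDiff_fst)
  have h3 : ContDiff ℝ ∞ (fun w : ℂ × ℂ => w.1 ^ k * w.2) := by fun_prop
  exact h3.contMDiff.comp h2

theorem PolySolution.isExtendedSolutionU (h : PolySolution r Φ) : IsExtendedSolutionU Φ := by
  refine ⟨fun p => (h.mem p).1, fun a b => ?_, fun e he => ⟨connA e Φ, fun p hp =>
    ⟨trivial, fun z => ?_⟩⟩⟩
  · have h1 : (fun x : M × Circle => Φ x.1 x.2 a b) = fun x : M × Circle =>
        ∑ k ∈ Finset.range (r + 1), (x.2 : ℂ) ^ k * loopCoeff (Φ x.1) k a b := by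
      ext1 x
      rw [(OmegaPoly.isLaurent (h.mem x.1)).eq_sum_range
        (fun k hk => OmegaPoly.support (h.mem x.1) hk), Matrix.sum_apply]
      simp
    rw [h1]
    exact contMDiff_finsetSum fun k _ =>
      contMDiff_entry_mul_pow (T := fun q => loopCoeff (Φ q) k a b) (fun p => h.smooth k p a b) k
  · rw [dzMat_eq_ddM, h.ddM_eval_eq he hp, ← mul_assoc, Matrix.nonsing_inv_mul, one_mul]
    exact Matrix.isUnit_det_of_left_inverse (OmegaPoly.conjTranspose_mul (h.mem p) z)

theorem infinite_circle : Infinite Circle := by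
  refine Infinite.of_injective (fun k : ℕ => Circle.exp (1 / (k + 1 : ℝ))) fun j k hjk => ?_
  have h : ∀ k : ℕ, (Circle.exp (1 / (k + 1 : ℝ)) : ℂ).arg = 1 / (k + 1 : ℝ) := by
    intro k
    have h1 : (0 : ℝ) < 1 / (k + 1 : ℝ) := by positivity
    have h2 : 1 / (k + 1 : ℝ) ≤ 1 := by
      rw [div_le_one (by positivity)]
      linarith [(Nat.cast_nonneg k : (0 : ℝ) ≤ k)]
    exact Circle.arg_exp (by linarith [Real.pi_pos]) (by linarith [Real.pi_gt_three])
  have h3 := h j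
  rw [show Circle.exp (1 / (j + 1 : ℝ)) = Circle.exp (1 / (k + 1 : ℝ)) from hjk, h k] at h3
  rw [one_div, one_div, inv_inj] at h3
  exact_mod_cast (add_right_cancel h3).symm

/-- Interpolation at r + 1 distinct points of the circle: inverting the Vandermonde matrix makes
each coefficient a fixed linear combination of values. Smoothness of the values in the surface
variable thus passes to the coefficients. -/
theorem exists_coeff_formula (r n : ℕ) (k : ℤ) : ∃ (z : Fin (r + 1) → Circle)
    (c : Fin (r + 1) → ℂ), ∀ γ ∈ OmegaPoly r n, loopCoeff γ k = ∑ j, c j • γ (z j) := by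
  by_cases hk : 0 ≤ k ∧ k ≤ r
  · have : Infinite Circle := infinite_circle
    set z : Fin (r + 1) → Circle := fun j => Infinite.natEmbedding Circle j
    have hz : Function.Injective fun j => (z j : ℂ) := by
      intro i j hij
      exact Fin.ext ((Infinite.natEmbedding Circle).injective (Subtype.ext hij))
    have hV : IsUnit (Matrix.vandermonde fun j => (z j : ℂ)).det :=
      isUnit_iff_ne_zero.2 (Matrix.det_vandermonde_ne_zero_iff.2 hz)
    set V := Matrix.vandermonde fun j => (z j : ℂ) with hVdef
    have hkr : k.toNat < r + 1 := by omega
    refine ⟨z, fun j => V⁻¹ ⟨k.toNat, hkr⟩ j, fun γ hγ => ?_⟩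
    have h1 : ∀ j, γ (z j) = ∑ i : Fin (r + 1), V j i • loopCoeff γ (i : ℕ) := by
      intro j
      rw [(OmegaPoly.isLaurent hγ).eq_sum_range fun k hk => OmegaPoly.support hγ hk,
        Finset.sum_range]
      rfl
    simp_rw [h1, Finset.smul_sum, smul_smul]
    rw [Finset.sum_comm]
    simp_rw [← Finset.sum_smul, ← Matrix.mul_apply, Matrix.nonsing_inv_mul _ hV, Matrix.one_apply,
      ite_smul, one_smul, zero_smul]
    rw [Finset.sum_ite_eq, if_pos (Finset.mem_univ _)]
    congr 1
    simp only
    omega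
  · exact ⟨fun _ => 1, fun _ => 0, fun γ hγ => by
      rw [OmegaPoly.coeff_eq_zero hγ (by omega)]
      simp⟩

theorem polySolution_of_isExtendedSolutionU (h : IsExtendedSolutionU Φ)
    (hmem : ∀ p, Φ p ∈ OmegaPoly r n) : PolySolution r Φ := by
  have hval : ∀ z p, MatSmoothAt (fun q => Φ q z) p := by
    intro z p a b
    exact ((h.2.1 a b).comp (contMDiff_id.prodMk (contMDiff_const (c := z)))).contMDiffAt
  have hsm : ∀ (k : ℤ) p, MatSmoothAt (fun q => loopCoeff (Φ q) k) p := by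
    intro k p
    obtain ⟨z, c, hc⟩ := exists_coeff_formula r n k
    simp_rw [hc _ (hmem _)]
    exact MatSmoothAt.sum _ fun j _ => (hval (z j) p).const_smul _
  refine ⟨hmem, hsm, fun e he p hp k => ?_⟩
  obtain ⟨A, hA⟩ := h.2.2 e he
  have hl := OmegaPoly.isLaurent (hmem p)
  have h1 : ∀ z, ddM (-Complex.I) e (fun q => Φ q z) p = Φ p z * ((1 - (z : ℂ)⁻¹) • A p) := by
    intro z
    rw [← (hA p hp).2 z, ← mul_assoc, Matrix.mul_nonsing_inv, one_mul, dzMat_eq_ddM]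
    exact Matrix.isUnit_det_of_left_inverse (OmegaPoly.conjTranspose_mul (hmem p) z)
  -- At λ = -1 the factor 1 - λ⁻¹ equals 2, which cancels the ½ in the definition of A^φ_z.
  have h2 : connA e Φ p = A p := by
    rw [connA, Az, (hA p hp).2 (-1), smul_smul, Circle.coe_neg, Circle.coe_one]
    norm_num
  rw [h2, ← loopCoeff_ddM hmem hsm he hp, funext h1, loopCoeff_mul_one_sub hl]

end ExtendedSolutions

/-! ### Block Toeplitz matrices -/

section Blocks

variable {R n : ℕ}

/-- The matrix with blocks `t a b`. -/
def blk (t : Fin R → Fin R → Mat n) : Matrix (Fin R × Fin n) (Fin R × Fin n) ℂ :=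
  Matrix.of fun x y => t x.1 y.1 x.2 y.2

theorem blk_mul (t u : Fin R → Fin R → Mat n) :
    blk t * blk u = blk fun a b => ∑ c, t a c * u c b := by
  ext x y
  simp [blk, Matrix.mul_apply, Fintype.sum_prod_type, Matrix.sum_apply]

theorem blk_conjTranspose (t : Fin R → Fin R → Mat n) : (blk t)ᴴ = blk fun a b => (t b a)ᴴ := rfl

theorem blk_one : (1 : Matrix (Fin R × Fin n) (Fin R × Fin n) ℂ) =
    blk fun a b => if a = b then 1 else 0 := by
  ext x y
  by_cases h : x.1 = y.1
  · simp [blk, h, Matrix.one_apply, Prod.ext_iff]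
  · simp [blk, h, Prod.ext_iff]

theorem blk_add (t u : Fin R → Fin R → Mat n) : blk t + blk u = blk fun a b => t a b + u a b := rfl

theorem blk_zero : blk (fun _ _ => 0 : Fin R → Fin R → Mat n) = 0 := rfl

/-- The matrix of multiplication by `γ` on `H₊ / λ^R H₊`. -/
def toep (R : ℕ) (γ : Circle → Mat n) : Matrix (Fin R × Fin n) (Fin R × Fin n) ℂ :=
  blk fun a b => loopCoeff γ ((a : ℕ) - (b : ℕ) : ℤ)

/-- The matrix of multiplication by `γ` from `λ^{-R} H₊ / H₊` to `H₊ / λ^R H₊`. -/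
def hank (R : ℕ) (γ : Circle → Mat n) : Matrix (Fin R × Fin n) (Fin R × Fin n) ℂ :=
  blk fun a b => loopCoeff γ ((a : ℕ) + (b : ℕ) + 1 : ℤ)

variable {r : ℕ} {γ : Circle → Mat n}

/-- The (a, b) block is the relation ∑_j T_{a+j}(T_{b+j})* = δ_ab from γγ* = 1: the indices j = -c ≤
0 form the Toeplitz product and j = c + 1 > 0 the Hankel product. The bound r ≤ R makes R blocks
enough. -/
theorem toep_add_hank (hγ : γ ∈ OmegaPoly r n) (hR : r ≤ R) :
    toep R γ * (toep R γ)ᴴ + hank R γ * (hank R γ)ᴴ = 1 := by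
  rw [toep, hank, blk_conjTranspose, blk_conjTranspose, blk_mul, blk_mul, blk_add, blk_one]
  congr 1
  ext1 a
  ext1 b
  obtain ⟨f1, hf1⟩ : ∃ f : Fin R ↪ ℤ, ∀ c, f c = -((c : ℕ) : ℤ) :=
    ⟨⟨fun c => -(c : ℕ), fun c d h => by simpa [Fin.ext_iff] using h⟩, fun _ => rfl⟩
  obtain ⟨f2, hf2⟩ : ∃ f : Fin R ↪ ℤ, ∀ c, f c = ((c : ℕ) : ℤ) + 1 :=
    ⟨⟨fun c => (c : ℕ) + 1, fun c d h => by simpa [Fin.ext_iff] using h⟩, fun _ => rfl⟩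
  have hdisj : Disjoint (Finset.univ.map f1) (Finset.univ.map f2) := by
    rw [Finset.disjoint_left]
    intro x h1 h2
    simp only [Finset.mem_map, Finset.mem_univ, true_and, hf1, hf2] at h1 h2
    obtain ⟨c, hc⟩ := h1
    obtain ⟨d, hd⟩ := h2
    omega
  have key := OmegaPoly.sum_mul_conjTranspose hγ (a : ℕ) (b : ℕ)
    ((Finset.univ.map f1).disjUnion (Finset.univ.map f2) hdisj) fun j hj => by
      have h1 := OmegaPoly.support hγ hj
      have := b.2
      simp only [Finset.mem_disjUnion, Finset.mem_map, Finset.mem_univ, true_and, hf1, hf2]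
      rcases le_or_gt j 0 with h2 | h2
      · exact Or.inl ⟨⟨(-j).toNat, by omega⟩, by simp only; omega⟩
      · exact Or.inr ⟨⟨(j - 1).toNat, by omega⟩, by simp only; omega⟩
  rw [Finset.sum_disjUnion, Finset.sum_map, Finset.sum_map] at key
  simp only [hf1, hf2, Nat.cast_inj, ← Fin.ext_iff, ← add_assoc, ← sub_eq_add_neg] at key
  exact key

/-- An off-diagonal coefficient of γ*γ = 1. The column index `b` is any nonnegative integer, not
just a block index, because the ∂_z̄ derivative produces the column b + 1 as well. -/
theorem hank_conjTranspose_mul_aux (hγ : γ ∈ OmegaPoly r n) (hR : r ≤ R) (a : Fin R) (b : ℤ)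
    (hb : 0 ≤ b) :
    ∑ c : Fin R, (loopCoeff γ ((c : ℕ) + (a : ℕ) + 1 : ℤ))ᴴ * loopCoeff γ ((c : ℕ) - b : ℤ) =
      0 := by
  obtain ⟨f, hf⟩ : ∃ f : Fin R ↪ ℤ, ∀ c, f c = ((c : ℕ) : ℤ) :=
    ⟨⟨fun c => (c : ℕ), fun c d h => by simpa [Fin.ext_iff] using h⟩, fun _ => rfl⟩
  have key := OmegaPoly.sum_conjTranspose_mul hγ (-b) ((a : ℕ) + 1 : ℤ)
    -- The negative j are added only to cover the support of T_{a+1+j}; for them T_{j-b} = 0, so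
    -- they contribute nothing.
    ((Finset.univ.map f) ∪ Finset.Icc (-(a : ℕ) - 1 : ℤ) (-1)) fun j hj => by
      have h1 := OmegaPoly.support hγ hj
      simp only [Finset.mem_union, Finset.mem_Icc, Finset.mem_map, Finset.mem_univ, true_and, hf]
      rcases le_or_gt 0 j with h2 | h2
      · exact Or.inl ⟨⟨j.toNat, by omega⟩, by simp only; omega⟩
      · exact Or.inr ⟨by omega, by omega⟩
  rw [if_neg (by omega), Finset.sum_union, Finset.sum_map] at key
  · rw [Finset.sum_eq_zero (s := Finset.Icc _ _), add_zero] at key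
    · have := congrArg Matrix.conjTranspose key
      rw [Matrix.conjTranspose_sum, Matrix.conjTranspose_zero] at this
      rw [← this]
      refine Finset.sum_congr rfl fun c _ => ?_
      rw [Matrix.conjTranspose_mul, Matrix.conjTranspose_conjTranspose]
      congr 2
      · congr 1
        rw [hf]
        ring
      · rw [hf]
        ring
    · intro j hj
      rw [Finset.mem_Icc] at hj
      rw [OmegaPoly.coeff_eq_zero hγ (k := -b + j) (by omega), Matrix.conjTranspose_zero, zero_mul]
  · rw [Finset.disjoint_left]
    intro x h1 h2
    simp only [Finset.mem_map, Finset.mem_univ, true_and, Finset.mem_Icc, hf] at h1 h2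
    obtain ⟨c, hc⟩ := h1
    omega

theorem hank_conjTranspose_mul_toep (hγ : γ ∈ OmegaPoly r n) (hR : r ≤ R) :
    (hank R γ)ᴴ * toep R γ = 0 := by
  rw [toep, hank, blk_conjTranspose, blk_mul, ← blk_zero]
  congr 1
  ext1 a
  ext1 b
  exact hank_conjTranspose_mul_aux hγ hR a _ (by omega)

/-- The orthogonal projection onto `γ H₊ / λ^R H₊`. -/
def grassProj (R : ℕ) (γ : Circle → Mat n) : Matrix (Fin R × Fin n) (Fin R × Fin n) ℂ :=
  toep R γ * (toep R γ)ᴴ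

theorem grassProj_eq (hγ : γ ∈ OmegaPoly r n) (hR : r ≤ R) :
    grassProj R γ = 1 - hank R γ * (hank R γ)ᴴ :=
  eq_sub_of_add_eq (toep_add_hank hγ hR)

/-- The adjoint of the Hankel matrix detects the negative coefficients of γ*f, so the columns it
kills are those lying in W modulo λ^R H₊. -/
theorem grassProj_mul_of_hank {κ : Type*} (hγ : γ ∈ OmegaPoly r n) (hR : r ≤ R)
    {B : Matrix (Fin R × Fin n) κ ℂ} (h : (hank R γ)ᴴ * B = 0) : grassProj R γ * B = B := by
  rw [grassProj_eq hγ hR, Matrix.sub_mul, Matrix.one_mul, Matrix.mul_assoc, h, Matrix.mul_zero,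
    sub_zero]

theorem grassProj_mul_toep (hγ : γ ∈ OmegaPoly r n) (hR : r ≤ R) :
    grassProj R γ * toep R γ = toep R γ :=
  grassProj_mul_of_hank hγ hR (hank_conjTranspose_mul_toep hγ hR)

theorem grassProj_mul_self (hγ : γ ∈ OmegaPoly r n) (hR : r ≤ R) :
    grassProj R γ * grassProj R γ = grassProj R γ := by
  conv_lhs => rw [grassProj, ← mul_assoc]
  rw [← grassProj, grassProj_mul_toep hγ hR, grassProj]

theorem hank_mul_grassProj (hγ : γ ∈ OmegaPoly r n) (hR : r ≤ R) :
    (hank R γ)ᴴ * grassProj R γ = 0 := by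
  rw [grassProj, ← Matrix.mul_assoc, hank_conjTranspose_mul_toep hγ hR, Matrix.zero_mul]

end Blocks

/-! ### Holomorphic frames and gauges -/

section Frames

variable {M : Type*} [TopologicalSpace M] [ChartedSpace ℂ M] {n r R : ℕ}
  {Φ : M → Circle → Mat n} {e : OpenPartialHomeomorph M ℂ} {p : M} {c : ℂ}

theorem PolySolution.toep_smooth (h : PolySolution r Φ) (R : ℕ) (p : M) :
    MatSmoothAt (fun q => toep R (Φ q)) p := fun _ _ => h.smooth _ p _ _

theorem PolySolution.grassProj_smooth (h : PolySolution r Φ) (R : ℕ) (p : M) :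
    MatSmoothAt (fun q => grassProj R (Φ q)) p :=
  (h.toep_smooth R p).mul (h.toep_smooth R p).conjTranspose

omit [ChartedSpace ℂ M] in
theorem ddM_toep (c : ℂ) (e : OpenPartialHomeomorph M ℂ) (R : ℕ) (Φ : M → Circle → Mat n) (p : M) :
    ddM c e (fun q => toep R (Φ q)) p =
      blk fun a b => ddM c e (fun q => loopCoeff (Φ q) ((a : ℕ) - (b : ℕ) : ℤ)) p := rfl

/-- Holomorphicity of W as a bundle. Since ∂_z̄ T_k = (T_{k-1} - T_k)A*, the derivative of the
Toeplitz matrix has columns built from T_{a-b} and T_{a-b-1}, and the adjoint of the Hankel matrix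
kills both families. -/
theorem PolySolution.grassProj_mul_ddM_bar_toep (h : PolySolution r Φ) (hR : r ≤ R)
    (he : e ∈ IsManifold.maximalAtlas 𝓘(ℂ) ω M) (hp : p ∈ e.source) :
    grassProj R (Φ p) * ddM Complex.I e (fun q => toep R (Φ q)) p =
      ddM Complex.I e (fun q => toep R (Φ q)) p := by
  refine grassProj_mul_of_hank (h.mem p) hR ?_
  rw [ddM_toep, hank, blk_conjTranspose, blk_mul, ← blk_zero]
  congr 1
  ext1 a
  ext1 b
  simp_rw [h.ddM_bar_eq he hp, mul_sub, ← mul_assoc]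
  rw [Finset.sum_sub_distrib, ← Finset.sum_mul, ← Finset.sum_mul,
    hank_conjTranspose_mul_aux (h.mem p) hR a _ (by omega)]
  simp_rw [sub_sub]
  rw [hank_conjTranspose_mul_aux (h.mem p) hR a _ (by omega)]
  simp

/-- Near every point, `γ H₊ / λ^R H₊` is the range of a holomorphic matrix. -/
theorem PolySolution.exists_holomorphic_frame (h : PolySolution r Φ) (hR : r ≤ R)
    (he : e ∈ IsManifold.maximalAtlas 𝓘(ℂ) ω M) (hp : p ∈ e.source) :
    ∃ s : M → Matrix (Fin R × Fin n) (Fin R × Fin n) ℂ,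
      s p = grassProj R (Φ p) ∧ ∀ᶠ q in 𝓝 p, MatSmoothAt s q ∧ ddM Complex.I e s q = 0 ∧
        grassProj R (Φ q) * s q = s q ∧ s q * grassProj R (Φ q) = grassProj R (Φ q) ∧
        grassProj R (Φ p) * s q = grassProj R (Φ p) ∧ s q * grassProj R (Φ p) = s q := by
  set Q : M → Matrix (Fin R × Fin n) (Fin R × Fin n) ℂ := fun q => grassProj R (Φ q) with hQ
  have hQQ : ∀ q, Q q * Q q = Q q := fun q => grassProj_mul_self (h.mem q) hR
  have hQs : ∀ q, MatSmoothAt Q q := fun q => h.grassProj_smooth R q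
  set G : M → Matrix (Fin R × Fin n) (Fin R × Fin n) ℂ := fun q => (1 - Q p) + Q p * Q q with hG
  set K : M → Matrix (Fin R × Fin n) (Fin R × Fin n) ℂ := fun q => (1 - Q q) + Q p with hK
  have hGs : ∀ q, MatSmoothAt G q := fun q =>
    (matSmoothAt_const _).add ((matSmoothAt_const _).mul (hQs q))
  have hKs : ∀ q, MatSmoothAt K q := fun q =>
    ((matSmoothAt_const _).sub (hQs q)).add (matSmoothAt_const _)
  have hGp : G p = 1 := by simp only [hG, hQQ, sub_add_cancel]
  have hKp : K p = 1 := by simp only [hK, sub_add_cancel]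
  have hGd : ∀ᶠ q in 𝓝 p, (G q).det ≠ 0 := (hGs p).eventually_det_ne_zero (by simp [hGp])
  have hKd : ∀ᶠ q in 𝓝 p, (K q).det ≠ 0 := (hKs p).eventually_det_ne_zero (by simp [hKp])
  -- Near p the projection of W_q into W_p is invertible; s q is its inverse, extended by zero on
  -- the complement of W_p.
  set s : M → Matrix (Fin R × Fin n) (Fin R × Fin n) ℂ := fun q => Q q * (G q)⁻¹ * Q p with hs
  have hss : ∀ᶠ q in 𝓝 p, MatSmoothAt s q := by
    filter_upwards [hGd] with q hq
    exact ((hQs q).mul ((hGs q).inv hq)).mul (matSmoothAt_const _)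
  have hQsq : ∀ q, Q q * s q = s q := fun q => by
    simp only [hs, ← mul_assoc, hQQ]
  have hpis : ∀ᶠ q in 𝓝 p, Q p * s q = Q p := by
    filter_upwards [hGd] with q hq
    have h1 : Q p * Q q = Q p * G q := by
      simp only [hG, mul_add, mul_sub, mul_one, ← mul_assoc, hQQ, sub_self, zero_add]
    simp only [hs, ← mul_assoc, h1]
    rw [Matrix.mul_nonsing_inv_cancel_right _ _ (isUnit_iff_ne_zero.2 hq), hQQ]
  -- Near p no nonzero vector of W_q is killed by the projection onto W_p. Uniqueness of s and its
  -- holomorphy both follow from this.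
  have hKinj : ∀ q, (K q).det ≠ 0 → ∀ B : Matrix (Fin R × Fin n) (Fin R × Fin n) ℂ,
      Q q * B = B → Q p * B = 0 → B = 0 := by
    intro q hq B h1 h2
    have h3 : K q * B = 0 := by
      simp only [hK, add_mul, sub_mul, one_mul, h1, h2, sub_self, add_zero]
    rw [← Matrix.nonsing_inv_mul_cancel_left _ B (isUnit_iff_ne_zero.2 hq), h3, mul_zero]
  refine ⟨s, ?_, ?_⟩
  · change Q p * (G p)⁻¹ * Q p = Q p
    rw [hGp, inv_one, mul_one, hQQ]
  · filter_upwards [hss, hpis.eventually_nhds, hpis, hKd, hGd, e.open_source.mem_nhds hp]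
      with q h1 h2 h3 h4 h5 h6
    refine ⟨h1, ?_, hQsq q, ?_, h3, ?_⟩
    -- The derivative ∂_z̄ s has values in W_q, because ∂_z̄ of the Toeplitz matrix does, and Q_p
    -- ∂_z̄ s = ∂_z̄(Q_p s) = 0 since Q_p s is locally constant.
    · apply hKinj q h4
      · have hY : MatSmoothAt (fun x => (toep R (Φ x))ᴴ * (G x)⁻¹ * Q p) q :=
          ((h.toep_smooth R q).conjTranspose.mul ((hGs q).inv h5)).mul (matSmoothAt_const _)
        have h7 : s = fun x => toep R (Φ x) * ((toep R (Φ x))ᴴ * (G x)⁻¹ * Q p) := by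
          ext1 x
          simp only [hs, hQ, grassProj, mul_assoc]
        rw [h7, ddM_mul ((h.toep_smooth R q).matDiffAt he h6) (hY.matDiffAt he h6) h6, mul_add,
          ← mul_assoc (Q q) (ddM _ _ _ _), ← mul_assoc (Q q) (toep _ _),
          show Q q * ddM _ _ _ _ = _ from h.grassProj_mul_ddM_bar_toep hR he h6,
          show Q q * toep _ _ = _ from grassProj_mul_toep (h.mem q) hR]
      · rw [← ddM_const_mul (Q p) (h1.matDiffAt he h6) h6, ddM_congr h6 h2, ddM_const]
    · have h7 := hKinj q h4 (s q * Q q - Q q) (by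
        rw [mul_sub, ← mul_assoc, hQsq, hQQ]) (by
        rw [mul_sub, ← mul_assoc, h3, sub_self])
      exact sub_eq_zero.1 h7
    · change Q q * (G q)⁻¹ * Q p * Q p = _
      rw [mul_assoc, hQQ]

/-- A local frame of `M × ℂⁿ` which is holomorphic for the `∂̄`-operator `∂_z̄ - A*`. -/
theorem PolySolution.exists_gauge (h : PolySolution r Φ)
    (he : e ∈ IsManifold.maximalAtlas 𝓘(ℂ) ω M) (hp : p ∈ e.source) :
    ∃ g : M → Mat n, (g p).det ≠ 0 ∧ ∀ᶠ q in 𝓝 p, MatSmoothAt g q ∧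
      ddM Complex.I e g q = (connA e Φ q)ᴴ * g q := by
  obtain ⟨s, hsp, hs⟩ := h.exists_holomorphic_frame (R := r + 1) (Nat.le_succ r) he hp
  -- E is P_0 Φ⁻¹ and E' is P_{-1} Φ⁻¹ on H₊ / λ^(r+1) H₊. Now E' vanishes on W while ∂_z̄ E = A*(E
  -- - E'), so E carries holomorphic sections of W to solutions of ∂_z̄ g = A*g. Using r + 1 blocks
  -- makes all of T_0, …, T_r occur in E.
  set E : M → Matrix (Fin n) (Fin (r + 1) × Fin n) ℂ := fun q =>
    Matrix.of fun i x => (loopCoeff (Φ q) (x.1 : ℕ))ᴴ i x.2 with hE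
  set E' : M → Matrix (Fin n) (Fin (r + 1) × Fin n) ℂ := fun q =>
    Matrix.of fun i x => (loopCoeff (Φ q) ((x.1 : ℕ) + 1 : ℤ))ᴴ i x.2 with hE'
  have hEs : ∀ q, MatSmoothAt E q := fun q i x => (h.smooth (x.1 : ℕ) q x.2 i).conj
  have hEd : ∀ q ∈ e.source, ddM Complex.I e E q =
      (connA e Φ q)ᴴ * E q - (connA e Φ q)ᴴ * E' q := by
    intro q hq
    ext i x
    have h1 : ddM Complex.I e (fun q => (loopCoeff (Φ q) (x.1 : ℕ))ᴴ) q =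
        (connA e Φ q)ᴴ * (loopCoeff (Φ q) (x.1 : ℕ))ᴴ -
        (connA e Φ q)ᴴ * (loopCoeff (Φ q) ((x.1 : ℕ) + 1 : ℤ))ᴴ := by
      rw [ddM_conjTranspose ((h.smooth _ q).matDiffAt he hq), Complex.conj_I,
        h.ddM_eq e he q hq, Matrix.conjTranspose_sub, Matrix.conjTranspose_mul,
        Matrix.conjTranspose_mul]
    exact congrFun (congrFun h1 i) x.2
  have hE's : ∀ q, grassProj (r + 1) (Φ q) * s q = s q → E' q * s q = 0 := by
    intro q hq
    have h1 : E' q = Matrix.of fun i x => (hank (r + 1) (Φ q))ᴴ ((0 : Fin (r + 1)), i) x := by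
      ext i x
      simp [hE', hank, blk]
    have h2 : (hank (r + 1) (Φ q))ᴴ * s q = 0 := by
      rw [← hq, ← Matrix.mul_assoc, hank_mul_grassProj (h.mem q) (Nat.le_succ r), Matrix.zero_mul]
    rw [h1]
    ext i y
    exact congrFun (congrFun h2 ((0 : Fin (r + 1)), i)) y
  -- The columns of B represent Φ(p)v for constant v, so E B = 1 at p and the n resulting solutions
  -- form a frame.
  set B : Matrix (Fin (r + 1) × Fin n) (Fin n) ℂ :=
    Matrix.of fun x j => toep (r + 1) (Φ p) x ((0 : Fin (r + 1)), j) with hB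
  have hQB : grassProj (r + 1) (Φ p) * B = B := by
    ext x j
    exact congrFun (congrFun (grassProj_mul_toep (h.mem p) (Nat.le_succ r)) x) _
  have hEB : E p * B = 1 := by
    have h1 : ∑ c : Fin (r + 1), (loopCoeff (Φ p) (c : ℕ))ᴴ * loopCoeff (Φ p) (c : ℕ) = 1 := by
      obtain ⟨f, hf⟩ : ∃ f : Fin (r + 1) ↪ ℤ, ∀ c, f c = ((c : ℕ) : ℤ) :=
        ⟨⟨fun c => (c : ℕ), fun c d h => by simpa [Fin.ext_iff] using h⟩, fun _ => rfl⟩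
      have key := OmegaPoly.sum_conjTranspose_mul (h.mem p) 0 0 (Finset.univ.map f) fun j hj => by
        have h1 := OmegaPoly.support (h.mem p) hj
        simp only [Finset.mem_map, Finset.mem_univ, true_and, hf]
        exact ⟨⟨j.toNat, by omega⟩, by simp only; omega⟩
      rw [Finset.sum_map, if_pos rfl] at key
      simpa [hf] using key
    rw [← h1]
    ext i j
    simp [hE, hB, toep, blk, Matrix.mul_apply, Fintype.sum_prod_type, Matrix.sum_apply]
  refine ⟨fun q => E q * s q * B, ?_, ?_⟩
  · change (E p * s p * B).det ≠ 0
    rw [hsp, Matrix.mul_assoc, hQB, hEB, Matrix.det_one]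
    exact one_ne_zero
  · filter_upwards [hs, e.open_source.mem_nhds hp] with q h1 h2
    refine ⟨((hEs q).mul h1.1).mul (matSmoothAt_const _), ?_⟩
    have hd := ((hEs q).mul h1.1).matDiffAt he h2
    rw [ddM_mul_const B hd h2, ddM_mul ((hEs q).matDiffAt he h2) (h1.1.matDiffAt he h2) h2,
      h1.2.1, Matrix.mul_zero, add_zero, hEd q h2, Matrix.sub_mul, Matrix.mul_assoc _ (E' q),
      hE's q h1.2.2.1, Matrix.mul_zero, sub_zero, Matrix.mul_assoc, Matrix.mul_assoc,
      Matrix.mul_assoc]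

end Frames

/-! ### Kernel and image bundles of the extreme coefficients -/

section ImageFrames

variable {M : Type*} [TopologicalSpace M] [ChartedSpace ℂ M] {n r : ℕ}
  {Φ : M → Circle → Mat n} {e : OpenPartialHomeomorph M ℂ} {p : M}

theorem analyticAt_of_dd_bar_eq_zero {f : M → ℂ} (he : e ∈ IsManifold.maximalAtlas 𝓘(ℂ) ω M)
    (hp : p ∈ e.source) (hf : ∀ᶠ q in 𝓝 p, SmoothAt f q ∧ dd Complex.I e f q = 0) :
    AnalyticAt ℂ (f ∘ e.symm) (e p) := by
  rw [Complex.analyticAt_iff_eventually_differentiableAt]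
  filter_upwards [(eventually_nhds_chart hp).2 hf, e.open_target.mem_nhds (e.map_source hp)]
    with z hz hzt
  have h1 : e (e.symm z) = z := e.right_inv hzt
  rw [← h1, differentiableAt_complex_iff]
  exact ⟨hz.1.diffAt he (e.map_target hzt), hz.2⟩

theorem smoothAt_comp_chart {w : ℂ → ℂ} (he : e ∈ IsManifold.maximalAtlas 𝓘(ℂ) ω M)
    (hp : p ∈ e.source) (hw : AnalyticAt ℂ w (e p)) : SmoothAt (fun q => w (e q)) p := by
  refine smoothAt_of_contDiffAt he hp ?_
  have h1 : ContDiffAt ℝ ∞ w (e p) := hw.restrictScalars.contDiffAt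
  refine h1.congr_of_eventuallyEq ?_
  filter_upwards [e.open_target.mem_nhds (e.map_source hp)] with z hz
  simp [e.right_inv hz]

/-- The image of a holomorphic matrix extends to a bundle across isolated points. -/
theorem exists_frame_of_holomorphic {h : M → Mat n} (he : e ∈ IsManifold.maximalAtlas 𝓘(ℂ) ω M)
    (hp : p ∈ e.source) (hh : ∀ᶠ q in 𝓝 p, MatSmoothAt h q ∧ ddM Complex.I e h q = 0) :
    ∃ (k : ℕ) (W : M → Matrix (Fin n) (Fin k) ℂ), (∀ᶠ q in 𝓝 p, MatSmoothAt W q) ∧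
      Function.Injective (W p).mulVec ∧
      ∀ᶠ q in 𝓝[≠] p, LinearMap.range (W q).mulVecLin = LinearMap.range (h q).mulVecLin := by
  obtain ⟨k, w, hw, hli, hspan⟩ := exists_analytic_frame (N := Fin n) (e p) n
    (fun j z i => h (e.symm z) i j) fun j => by
      rw [analyticAt_pi_iff]
      intro i
      exact analyticAt_of_dd_bar_eq_zero (f := fun q => h q i j) he hp
        (hh.mono fun q hq => ⟨hq.1 i j, congrFun (congrFun hq.2 i) j⟩)
  refine ⟨k, fun q => Matrix.of fun i j => w j (e q) i, ?_, ?_, ?_⟩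
  · have h1 : ∀ᶠ z in 𝓝 (e p), ∀ i, AnalyticAt ℂ (w i) z :=
      eventually_all.2 fun i => (hw i).eventually_analyticAt
    filter_upwards [(e.continuousAt hp).eventually h1, e.open_source.mem_nhds hp] with q hq hqs
    intro i j
    exact smoothAt_comp_chart he hqs (analyticAt_pi_iff.1 (hq j) i)
  · rw [Matrix.mulVec_injective_iff]
    exact hli
  · have h1 := (eventually_nhdsNE_chart (P := fun q =>
      Submodule.span ℂ (Set.range fun j i => h q i j) =
        Submodule.span ℂ (Set.range fun i => w i (e q))) hp).1 (by
        filter_upwards [hspan, nhdsWithin_le_nhds (e.open_target.mem_nhds (e.map_source hp))]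
          with z hz hzt
        rwa [e.right_inv hzt])
    filter_upwards [h1] with q hq
    rw [Matrix.range_mulVecLin, Matrix.range_mulVecLin]
    exact hq.symm

/-- The range of the adjoint of the top coefficient extends to a smooth bundle. -/
theorem PolySolution.exists_smooth_proj_top [T1Space M] [IsManifold 𝓘(ℂ) ω M] (h : PolySolution r Φ) :
    ∃ S : M → Mat n, (∀ p, IsOrthProj (S p)) ∧ (∀ p, MatSmoothAt S p) ∧
      ∀ᶠ p in codiscrete M, LinearMap.range (S p).mulVecLin =
        LinearMap.range ((loopCoeff (Φ p) r)ᴴ).mulVecLin := by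
  refine exists_smooth_proj _ fun p => ?_
  have he := chartAt_mem p
  have hp := mem_chart_source ℂ p
  generalize chartAt ℂ p = e at he hp
  obtain ⟨g, hgp, hg⟩ := h.exists_gauge he hp
  have hgd : ∀ᶠ q in 𝓝 p, (g q).det ≠ 0 := hg.self_of_nhds.1.eventually_det_ne_zero hgp
  have hgh : ∀ q, (g q).det ≠ 0 → g q * ((g q)⁻¹ * (loopCoeff (Φ q) r)ᴴ) =
      (loopCoeff (Φ q) r)ᴴ := fun q hq =>
    Matrix.mul_nonsing_inv_cancel_left _ _ (isUnit_iff_ne_zero.2 hq)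
  -- As T_{r+1} = 0, the adjoint of the ∂_z equation reads ∂_z̄ T_r* = A*T_r*. Both g and T_r* solve
  -- this equation, so g⁻¹T_r* is holomorphic.
  obtain ⟨k, W, hW, hWp, hWr⟩ := exists_frame_of_holomorphic
    (h := fun q => (g q)⁻¹ * (loopCoeff (Φ q) r)ᴴ) he hp (by
      filter_upwards [hg, hgd, hgd.eventually_nhds, e.open_source.mem_nhds hp] with q h1 h2 h3 h4
      have hsm : MatSmoothAt (fun q => (g q)⁻¹ * (loopCoeff (Φ q) r)ᴴ) q :=
        (h1.1.inv h2).mul (h.smooth r q).conjTranspose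
      refine ⟨hsm, ?_⟩
      have h5 := ddM_mul (c := Complex.I) (h1.1.matDiffAt he h4) (hsm.matDiffAt he h4) h4
      rw [ddM_congr h4 (h3.mono hgh), ddM_conjTranspose ((h.smooth r q).matDiffAt he h4),
        Complex.conj_I, h.ddM_eq e he q h4,
        OmegaPoly.coeff_eq_zero (h.mem q) (k := (r : ℤ) + 1) (by omega), zero_mul, sub_zero,
        Matrix.conjTranspose_mul, h1.2, mul_assoc, hgh q h2, left_eq_add] at h5
      rw [← Matrix.nonsing_inv_mul_cancel_left (g q) (ddM Complex.I e _ q)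
        (isUnit_iff_ne_zero.2 h2), h5, mul_zero])
  refine ⟨k, fun q => g q * W q, ?_, ?_, ?_⟩
  · filter_upwards [hg, hW] with q h1 h2
    exact h1.1.mul h2
  · refine det_conjTranspose_mul_self_ne_zero fun v w hvw => hWp ?_
    simp only [← Matrix.mulVec_mulVec] at hvw
    exact Matrix.mulVec_injective_of_isUnit
      ((Matrix.isUnit_iff_isUnit_det _).2 (isUnit_iff_ne_zero.2 hgp)) hvw
  · filter_upwards [hWr, hgd.filter_mono nhdsWithin_le_nhds] with q h1 h2
    rw [Matrix.mulVecLin_mul, LinearMap.range_comp, h1, ← LinearMap.range_comp,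
      ← Matrix.mulVecLin_mul, hgh q h2]

end ImageFrames

/-! ### One step of the factorization -/

section Step

variable {M : Type*} [TopologicalSpace M] [ChartedSpace ℂ M] {n r : ℕ}
  {Φ : M → Circle → Mat n} {e : OpenPartialHomeomorph M ℂ} {p : M}

/-- Any A satisfying the coefficient equations must be the one determined at λ = -1, so its
existence at each point suffices. -/
theorem PolySolution.of_exists (hmem : ∀ p, Φ p ∈ OmegaPoly r n)
    (hsm : ∀ (k : ℤ) p, MatSmoothAt (fun q => loopCoeff (Φ q) k) p)
    (hA : ∀ e ∈ IsManifold.maximalAtlas 𝓘(ℂ) ω M, ∀ p ∈ e.source, ∃ A : Mat n, ∀ k : ℤ,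
      ddM (-Complex.I) e (fun q => loopCoeff (Φ q) k) p =
        loopCoeff (Φ p) k * A - loopCoeff (Φ p) (k + 1) * A) : PolySolution r Φ := by
  refine ⟨hmem, hsm, fun e he p hp k => ?_⟩
  obtain ⟨A, hA⟩ := hA e he p hp
  have hl := OmegaPoly.isLaurent (hmem p)
  have h1 : ddM (-Complex.I) e (fun q => Φ q (-1)) p = Φ p (-1) * ((1 - ((-1 : Circle) : ℂ)⁻¹) • A) :=
    congrFun (IsLaurent.ext (isLaurent_ddM hmem hsm he hp _) (isLaurent_mul_one_sub hl A)
      fun k => by rw [loopCoeff_ddM hmem hsm he hp, loopCoeff_mul_one_sub hl, hA]) (-1)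
  have h2 : connA e Φ p = A := by
    rw [connA, Az, dzMat_eq_ddM, h1, Matrix.nonsing_inv_mul_cancel_left, smul_smul,
      Circle.coe_neg, Circle.coe_one]
    · norm_num
    · exact Matrix.isUnit_det_of_left_inverse (OmegaPoly.conjTranspose_mul (hmem p) (-1))
  rw [h2, hA]

/-- Conjugation exchanges ∂_z with ∂_z̄ and reverses the order of the coefficients, so the equation
for ∂_z̄ T_k becomes one for ∂_z, with A replaced by minus the conjugate of A*. -/
theorem PolySolution.conjLoop (h : PolySolution r Φ) :
    PolySolution r (fun p => conjLoop r (Φ p)) := by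
  refine PolySolution.of_exists (fun p => conjLoop_mem (h.mem p)) (fun k p => ?_)
    fun e he p hp => ⟨-((connA e Φ p)ᴴ.map (starRingEnd ℂ)), fun k => ?_⟩
  · simp_rw [loopCoeff_conjLoop]
    exact (h.smooth _ p).map_conj
  · simp_rw [loopCoeff_conjLoop]
    have h1 : ddM (-Complex.I) e (fun q => (loopCoeff (Φ q) (r - k)).map (starRingEnd ℂ)) p =
        (ddM Complex.I e (fun q => loopCoeff (Φ q) (r - k)) p).map (starRingEnd ℂ) := by
      ext a b
      have := dd_conj (c := -Complex.I) ((h.smooth (r - k) p).matDiffAt he hp a b)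
      rw [map_neg, Complex.conj_I, neg_neg] at this
      exact this
    rw [h1, h.ddM_bar_eq he hp, Matrix.map_sub _ (map_sub _), map_conj_mul, map_conj_mul,
      show (r : ℤ) - (k + 1) = r - k - 1 by ring]
    simp only [mul_neg]
    abel

theorem PolySolution.continuousAt_connA (h : PolySolution r Φ)
    (he : e ∈ IsManifold.maximalAtlas 𝓘(ℂ) ω M) (hp : p ∈ e.source) :
    ContinuousAt (connA e Φ) p := by
  have h1 := matSmoothAt_eval h.mem h.smooth (-1) p
  have h2 : connA e Φ = fun q => (1 / 2 : ℂ) •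
      ((Φ q (-1))ᴴ * ddM (-Complex.I) e (fun q => Φ q (-1)) q) := by
    ext1 q
    rw [connA, Az, dzMat_eq_ddM, Matrix.inv_eq_left_inv (OmegaPoly.conjTranspose_mul (h.mem q) _)]
  rw [h2]
  exact ContinuousAt.const_smul (M := ℂ)
    (h1.conjTranspose.continuousAt.mul (h1.continuousAt_ddM he hp)) _

theorem mul_eq_zero_of_range_le {A B C : Mat n}
    (h : LinearMap.range B.mulVecLin ≤ LinearMap.range C.mulVecLin) (hAC : A * C = 0) :
    A * B = 0 := by
  refine Matrix.mulVec_injective (funext fun v => ?_)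
  obtain ⟨u, hu⟩ := h ⟨v, rfl⟩
  simp only [Matrix.mulVecLin_apply] at hu
  rw [← Matrix.mulVec_mulVec, ← hu, Matrix.mulVec_mulVec, hAC, Matrix.zero_mulVec,
    Matrix.zero_mulVec]

theorem conjTranspose_mul_eq_zero_comm {A B : Mat n} : Aᴴ * B = 0 ↔ Bᴴ * A = 0 := by
  rw [← Matrix.conjTranspose_eq_zero, Matrix.conjTranspose_mul, Matrix.conjTranspose_conjTranspose]

/-- Let N = r + 1 and let S extend the projection onto range T_N*; then R = 1 - S. Generically T_N B
= 0 is equivalent to SB = 0, which gives four identities: T_0 S = 0 from orthogonality of extreme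
coefficients, T_N(1 - S) = 0, AS = 0 from ∂_z̄ T_{N+1} = 0, and S(A(1 - S) - ∂_z S) = 0 from
differentiating T_N(1 - S) = 0. All four extend to every point by continuity. The first two bound
the degree, the last two give the extended solution equation. -/
theorem PolySolution.exists_segal_step [T1Space M] [IsManifold 𝓘(ℂ) ω M] (h : PolySolution (r + 1) Φ) :
    ∃ R : M → Mat n, (∀ p, IsOrthProj (R p)) ∧ (∀ p, MatSmoothAt R p) ∧
      PolySolution r (fun p => stepDown (Φ p) (R p)) ∧
      ∀ᶠ p in codiscrete M, IsStep false (r + 1) (Φ p) (R p) := by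
  obtain ⟨S, hS, hSs, hr⟩ := h.exists_smooth_proj_top
  set N : ℤ := ((r + 1 : ℕ) : ℤ) with hN
  have hTs := fun k p => (h.smooth k p).continuousAt
  have hr' := eventually_codiscrete_iff.1 hr
  -- the top coefficient kills exactly the complement of the range of `S`
  have hTS : ∀ q, LinearMap.range (S q).mulVecLin =
      LinearMap.range ((loopCoeff (Φ q) N)ᴴ).mulVecLin → ∀ B : Mat n,
      loopCoeff (Φ q) N * B = 0 ↔ S q * B = 0 := by
    intro q hq B
    constructor
    · intro h1
      rw [← (hS q).conjTranspose, conjTranspose_mul_eq_zero_comm]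
      refine mul_eq_zero_of_range_le hq.le ?_
      rw [← Matrix.conjTranspose_mul, h1, Matrix.conjTranspose_zero]
    · intro h1
      rw [← Matrix.conjTranspose_conjTranspose (loopCoeff (Φ q) N), conjTranspose_mul_eq_zero_comm]
      refine mul_eq_zero_of_range_le hq.ge ?_
      have := congrArg Matrix.conjTranspose h1
      rwa [Matrix.conjTranspose_mul, (hS q).conjTranspose, Matrix.conjTranspose_zero] at this
  have hbot : ∀ q, loopCoeff (Φ q) 0 * S q = 0 := fun q =>
    eq_of_eventuallyEq_nhdsNE ((hTs 0 q).mul (hSs q).continuousAt) continuousAt_const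
      ((hr' q).mono fun x hx => by
        refine mul_eq_zero_of_range_le hx.le ?_
        have := congrArg Matrix.conjTranspose (OmegaPoly.top_mul_bot (h.mem x))
        rwa [Matrix.conjTranspose_mul, Matrix.conjTranspose_conjTranspose,
          Matrix.conjTranspose_zero] at this)
  have htop : ∀ q, loopCoeff (Φ q) N * (1 - S q) = 0 := fun q =>
    eq_of_eventuallyEq_nhdsNE ((hTs N q).mul (continuousAt_const.sub (hSs q).continuousAt))
      continuousAt_const ((hr' q).mono fun x hx => (hTS x hx _).2 (hS x).mul_compl)
  have hAS : ∀ e ∈ IsManifold.maximalAtlas 𝓘(ℂ) ω M, ∀ q ∈ e.source,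
      connA e Φ q * S q = 0 := fun e he q hq =>
    eq_of_eventuallyEq_nhdsNE ((h.continuousAt_connA he hq).mul (hSs q).continuousAt)
      continuousAt_const (by
        filter_upwards [hr' q, nhdsWithin_le_nhds (e.open_source.mem_nhds hq)] with x hx hxe
        refine mul_eq_zero_of_range_le hx.le ?_
        have h1 := h.ddM_bar_eq he hxe (N + 1)
        have h2 : (fun q => loopCoeff (Φ q) (N + 1)) = fun _ => 0 :=
          funext fun q => OmegaPoly.coeff_eq_zero (h.mem q) (by omega)
        rw [h2, ddM_const, add_sub_cancel_right,
          OmegaPoly.coeff_eq_zero (h.mem x) (k := N + 1) (by omega), zero_mul, sub_zero] at h1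
        have := congrArg Matrix.conjTranspose h1
        rwa [Matrix.conjTranspose_mul, Matrix.conjTranspose_conjTranspose,
          Matrix.conjTranspose_zero, eq_comm] at this)
  have hSd : ∀ e ∈ IsManifold.maximalAtlas 𝓘(ℂ) ω M, ∀ q ∈ e.source,
      S q * (connA e Φ q * (1 - S q) - ddM (-Complex.I) e S q) = 0 := fun e he q hq =>
    eq_of_eventuallyEq_nhdsNE ((hSs q).continuousAt.mul (((h.continuousAt_connA he hq).mul
      (continuousAt_const.sub (hSs q).continuousAt)).sub ((hSs q).continuousAt_ddM he hq)))
      continuousAt_const (by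
        filter_upwards [hr' q, nhdsWithin_le_nhds (e.open_source.mem_nhds hq)] with x hx hxe
        change S x * (connA e Φ x * (1 - S x) - ddM (-Complex.I) e S x) = 0
        rw [← hTS x hx]
        have h1 := ddM_mul (c := -Complex.I) ((h.smooth N x).matDiffAt he hxe)
          (((matDiffAt_const 1).sub ((hSs x).matDiffAt he hxe))) hxe
        rw [funext htop, ddM_const, ddM_const_sub 1 ((hSs x).matDiffAt he hxe) hxe,
          h.ddM_eq e he x hxe, OmegaPoly.coeff_eq_zero (h.mem x) (k := N + 1) (by omega),
          zero_mul, sub_zero] at h1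
        rw [h1]
        noncomm_ring)
  have hl := fun q => OmegaPoly.isLaurent (h.mem q)
  have hR := fun q => (hS q).one_sub
  have hRs : ∀ q, MatSmoothAt (fun x => 1 - S x) q := fun q => (matSmoothAt_const 1).sub (hSs q)
  refine ⟨fun q => 1 - S q, hR, hRs, PolySolution.of_exists (fun q =>
    stepDown_mem (h.mem q) (hR q) (by rw [sub_sub_cancel]; exact hbot q) (htop q)) ?_ ?_, ?_⟩
  · intro k q
    simp_rw [loopCoeff_stepDown (hl _), sub_sub_cancel]
    exact ((h.smooth k q).mul (hRs q)).add ((h.smooth (k + 1) q).mul (hSs q))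
  · intro e he q hq
    -- The new connection form is A - ∂_z S; the identities AS = 0 and SA = S ∂_z S turn the product
    -- rule into the required equation.
    refine ⟨connA e Φ q - ddM (-Complex.I) e S q, fun k => ?_⟩
    simp_rw [loopCoeff_stepDown (hl _), sub_sub_cancel]
    rw [ddM_add, ddM_mul, ddM_mul, h.ddM_eq e he q hq, h.ddM_eq e he q hq,
      ddM_const_sub 1 ((hSs q).matDiffAt he hq) hq]
    · have h1 := hAS e he q hq
      have h2 := hSd e he q hq
      generalize connA e Φ q = A at *
      generalize ddM (-Complex.I) e S q = D at *
      have h3 : S q * D = S q * A := by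
        rw [mul_sub, mul_sub, h1, sub_zero, mul_one] at h2
        exact (sub_eq_zero.1 h2).symm
      simp only [add_mul, mul_assoc, mul_zero, sub_mul, mul_sub, mul_neg, h1, h3, mul_one, sub_zero]
      abel
    all_goals first
      | exact hq
      | exact (hSs q).matDiffAt he hq
      | exact (hRs q).matDiffAt he hq
      | exact (h.smooth _ q).matDiffAt he hq
      | exact ((h.smooth _ q).mul (hRs q)).matDiffAt he hq
      | exact ((h.smooth _ q).mul (hSs q)).matDiffAt he hq
  · filter_upwards [hr] with q hq v
    rw [sub_sub_cancel]
    -- A vector is encoded as the square matrix with all columns equal to it, because `hTS` is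
    -- stated for square matrices.
    have key : ∀ A : Mat n, act A v = 0 ↔
        A * Matrix.of (fun i (_ : Fin n) => v i) = 0 := by
      intro A
      constructor
      · intro h1
        ext i j
        exact congrArg (fun w : E n => w i) h1
      · intro h1
        ext i
        exact congrFun (congrFun h1 i) i
    rw [key, key]
    exact hTS q hq _

theorem conjLoop_conjLoop (r : ℕ) (γ : Circle → Mat n) : conjLoop r (conjLoop r γ) = γ := by
  ext1 z
  ext a b
  simp only [UnitonFact.conjLoop, Matrix.smul_apply, Matrix.map_apply, smul_eq_mul, map_mul,
    Complex.conj_conj, ← mul_assoc, map_zpow₀]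
  rw [← mul_zpow, Complex.mul_conj, Circle.normSq_coe, Complex.ofReal_one, one_zpow, one_mul]

/-- An Uhlenbeck step for Φ is the conjugate of a Segal step for λ^(r+1) conj Φ, which is again an
extended solution. -/
theorem PolySolution.exists_step [T1Space M] [IsManifold 𝓘(ℂ) ω M] (b : Bool) (h : PolySolution (r + 1) Φ) :
    ∃ R : M → Mat n, (∀ p, IsOrthProj (R p)) ∧ (∀ p, MatSmoothAt R p) ∧
      PolySolution r (fun p => stepDown (Φ p) (R p)) ∧
      ∀ᶠ p in codiscrete M, IsStep b (r + 1) (Φ p) (R p) := by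
  cases b with
  | false => exact h.exists_segal_step
  | true =>
    obtain ⟨R, hR, hRs, hsol, hstep⟩ := h.conjLoop.exists_segal_step
    refine ⟨fun p => 1 - (R p).map (starRingEnd ℂ), fun p => (hR p).map_conj.one_sub,
      fun p => (matSmoothAt_const 1).sub (hRs p).map_conj, ?_, ?_⟩
    · have h1 := hsol.conjLoop
      simp_rw [conjLoop_stepDown, conjLoop_conjLoop] at h1
      exact h1
    · filter_upwards [hstep] with p hp
      have := hp.conjLoop
      rwa [conjLoop_conjLoop] at this

end Step

/-! ### Unitons -/

section Column

variable {n : ℕ}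

/-- A vector as a one-column matrix. -/
def col (v : E n) : Matrix (Fin n) Unit ℂ := Matrix.of fun i _ => v i

theorem col_act (A : Mat n) (v : E n) : col (act A v) = A * col v := rfl

theorem col_injective : Function.Injective (col (n := n)) := fun v w h => by
  ext i
  exact congrFun (congrFun h i) ()

theorem IsOrthProj.mem_range_iff {R : Mat n} (hR : IsOrthProj R) {v : E n} :
    v ∈ LinearMap.range (act R) ↔ (1 - R) * col v = 0 := by
  constructor
  · rintro ⟨w, rfl⟩
    rw [col_act, ← Matrix.mul_assoc, hR.compl_mul, Matrix.zero_mul]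
  · intro h
    refine ⟨v, col_injective ?_⟩
    rw [col_act]
    rw [Matrix.sub_mul, Matrix.one_mul] at h
    exact (sub_eq_zero.1 h).symm

theorem projMat_range {R : Mat n} (hR : IsOrthProj R) :
    projMat (LinearMap.range (act R)) = R := by
  rw [projMat, LinearEquiv.symm_apply_eq]
  refine LinearMap.ext fun v => ?_
  refine Submodule.eq_starProjection_of_mem_of_inner_eq_zero (LinearMap.mem_range_self _ v) ?_
  rintro _ ⟨w, rfl⟩
  rw [← LinearMap.adjoint_inner_left, ← Matrix.toEuclideanLin_conjTranspose_eq_adjoint,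
    hR.conjTranspose, map_sub, ← act_mul, hR.mul_self, sub_self, inner_zero_left]

theorem eta_range {R : Mat n} (hR : IsOrthProj R) (z : Circle) :
    eta (LinearMap.range (act R)) z = R + (z : ℂ) • (1 - R) := by
  have h1 : ∀ V : Submodule ℂ (E n), projMat Vᗮ = 1 - projMat V := by
    intro V
    rw [projMat, projMat, LinearEquiv.symm_apply_eq, map_sub, LinearEquiv.apply_symm_apply]
    refine LinearMap.ext fun v => ?_
    simp [Submodule.starProjection_orthogonal_val]
  rw [eta, h1, projMat_range hR]

end Column

section Unitons

variable {M : Type*} [TopologicalSpace M] [ChartedSpace ℂ M] {n r : ℕ}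
  {Φ : M → Circle → Mat n} {R : M → Mat n} {e : OpenPartialHomeomorph M ℂ} {p : M} {c : ℂ}

/-- The matrix U_q = R_q R_p + (1 - R_q)(1 - R_p) satisfies U_q R_p = R_q U_q and equals 1 at q = p.
Where it is invertible, it carries a fixed basis of the range at p to a smooth frame of the range at
q. -/
theorem isSmoothSubbundle_range (hR : ∀ p, IsOrthProj (R p)) (hRs : ∀ p, MatSmoothAt R p) :
    IsSmoothSubbundle fun p => LinearMap.range (act (R p)) := by
  intro p
  set U : M → Mat n := fun q => R q * R p + (1 - R q) * (1 - R p) with hU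
  have hUs : ∀ q, MatSmoothAt U q := fun q => ((hRs q).mul (matSmoothAt_const _)).add
    (((matSmoothAt_const 1).sub (hRs q)).mul (matSmoothAt_const _))
  have hUR : ∀ q, U q * R p = R q * U q := fun q => by
    simp only [hU, add_mul, mul_add, mul_assoc, (hR p).mul_self, (hR p).compl_mul, mul_zero,
      add_zero, ← mul_assoc (R q) (R q), (hR q).mul_self, ← mul_assoc (R q) (1 - R q),
      (hR q).mul_compl, zero_mul]
  have hdet : Continuous fun q => (U q).det := by
    rw [continuous_iff_continuousAt]
    exact fun q => ContMDiffAt.continuousAt (I := 𝓘(ℝ, ℂ)) (I' := 𝓘(ℝ, ℂ)) (n := ∞)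
      (det_mem_subring (smoothSubring q) (hUs q))
  refine ⟨{q | (U q).det ≠ 0}, isOpen_ne_fun hdet continuous_const, ?_, ?_⟩
  · simp [hU, (hR p).mul_self, (hR p).one_sub.mul_self]
  · set V := LinearMap.range (act (R p))
    set b := Module.finBasis ℂ V
    refine ⟨_, fun i q => act (U q) (b i : E n), fun i => ?_, fun q hq => ?_⟩
    · intro q _
      refine ContMDiffAt.contMDiffWithinAt ?_
      have h1 : (fun q => act (U q) (b i : E n)) = fun q => (EuclideanSpace.equiv (Fin n) ℂ).symm
          fun a => ∑ j, U q a j * (b i : E n) j := by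
        ext q a
        rfl
      change SmoothAt (fun q => act (U q) (b i : E n)) q
      rw [h1]
      refine SmoothAt.comp_contDiffAt (f := fun q a => ∑ j, U q a j * (b i : E n) j)
        (φ := fun x => (EuclideanSpace.equiv (Fin n) ℂ).symm x)
        (((EuclideanSpace.equiv (Fin n) ℂ).symm.toContinuousLinearMap.restrictScalars
          ℝ).contDiff.contDiffAt) ?_
      exact contMDiffAt_pi_space.2 fun a => contMDiffAt_finsetSum fun j _ =>
        (hUs q a j).mul contMDiffAt_const
    · have hu : IsUnit (U q) := (Matrix.isUnit_iff_isUnit_det _).2 (isUnit_iff_ne_zero.2 hq)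
      have hinj : LinearMap.ker (act (U q)) = ⊥ := by
        rw [LinearMap.ker_eq_bot']
        intro v hv
        obtain ⟨u, hu⟩ := hu
        rw [← act_one v, ← Units.inv_mul u, act_mul, hu, hv, map_zero]
      have hsurj : LinearMap.range (act (U q)) = ⊤ := by
        rw [LinearMap.range_eq_top]
        intro v
        obtain ⟨u, hu⟩ := hu
        exact ⟨act (↑u⁻¹ : Mat n) v, by rw [← hu, ← act_mul, Units.mul_inv, act_one]⟩
      constructor
      · exact (b.linearIndependent.map' V.subtype V.ker_subtype).map' _ hinj
      · have h1 : Submodule.span ℂ (Set.range fun i => (b i : E n)) = V := by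
          have := congrArg (Submodule.map V.subtype) b.span_eq
          rw [Submodule.map_span, ← Set.range_comp, Submodule.map_top,
            Submodule.range_subtype] at this
          exact this
        have h2 : act (R q) ∘ₗ act (U q) = act (U q) ∘ₗ act (R p) := by
          refine LinearMap.ext fun v => ?_
          rw [LinearMap.comp_apply, LinearMap.comp_apply, ← act_mul, ← act_mul, hUR]
        have h3 : (Set.range fun i => act (U q) (b i : E n)) =
            act (U q) '' Set.range fun i => (b i : E n) := by
          rw [← Set.range_comp]
          rfl
        rw [h3, ← Submodule.map_span, h1, ← LinearMap.range_comp, ← h2, LinearMap.range_comp,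
          hsurj, Submodule.map_top]

omit [ChartedSpace ℂ M] in
theorem dd_apply_eq {σ : M → E n} (hσ : DiffAt e σ p) (i : Fin n) :
    dd c e (fun q => σ q i) p = dd c e σ p i :=
  dd_clm (EuclideanSpace.proj i : E n →L[ℂ] ℂ) hσ

theorem compl_mul_conj_mul {S R A D : Mat n} {w : ℂ} (hw : w ≠ 0) (hR : R * R = R)
    (hS : S * S = S) (hSR : S * R = 0) :
    S * ((R + w⁻¹ • S) * A * (R + w • S) - w • ((R + w⁻¹ • S) * D)) * R =
      w⁻¹ • (S * A * R) - S * D * R := by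
  have a : S * (R + w⁻¹ • S) = w⁻¹ • S := by rw [mul_add, hSR, Matrix.mul_smul, hS, zero_add]
  have b : (R + w • S) * R = R := by rw [add_mul, hR, Matrix.smul_mul, hSR, smul_zero, add_zero]
  calc _ = (S * (R + w⁻¹ • S)) * A * ((R + w • S) * R) - w • ((S * (R + w⁻¹ • S)) * D * R) := by
        simp only [mul_sub, sub_mul, Matrix.mul_assoc, Matrix.mul_smul, Matrix.smul_mul]
    _ = _ := by
        rw [a, b]
        simp only [Matrix.smul_mul, smul_smul, mul_inv_cancel₀ hw, one_smul]

theorem mul_conj_mul_compl {S R A D : Mat n} {w : ℂ} (hR : R * R = R)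
    (hS : S * S = S) (hRS : R * S = 0) :
    R * ((R + w⁻¹ • S) * A * (R + w • S) - w • ((R + w⁻¹ • S) * D)) * S =
      w • (R * A * S - R * D * S) := by
  have a : R * (R + w⁻¹ • S) = R := by rw [mul_add, hR, Matrix.mul_smul, hRS, smul_zero, add_zero]
  have b : (R + w • S) * S = w • S := by rw [add_mul, hRS, Matrix.smul_mul, hS, zero_add]
  calc _ = (R * (R + w⁻¹ • S)) * A * ((R + w • S) * S) - w • ((R * (R + w⁻¹ • S)) * D * S) := by
        simp only [mul_sub, sub_mul, Matrix.mul_assoc, Matrix.mul_smul, Matrix.smul_mul]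
    _ = _ := by
        rw [a, b]
        simp only [Matrix.mul_smul, smul_sub]

/-- Differentiating Φ = Φ'η with η = R + λ(1 - R) gives A = η⁻¹A'η - λη⁻¹∂_z R for every λ ≠ 1 on
the circle. The two off-diagonal blocks of the right-hand side are λ⁻¹(1 - R)A'R - (1 - R)(∂_z R)R
and λR(A' - ∂_z R)(1 - R), while the left-hand side does not involve λ. Two values of λ therefore
suffice to conclude. -/
theorem PolySolution.stepDown_relations (h : PolySolution (r + 1) Φ)
    (h' : PolySolution r fun p => stepDown (Φ p) (R p)) (hR : ∀ p, IsOrthProj (R p))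
    (hRs : ∀ p, MatSmoothAt R p)
    (he : e ∈ IsManifold.maximalAtlas 𝓘(ℂ) ω M) (hp : p ∈ e.source) :
    (1 - R p) * connA e (fun p => stepDown (Φ p) (R p)) p * R p = 0 ∧
      R p * connA e (fun p => stepDown (Φ p) (R p)) p * (1 - R p) =
        R p * ddM (-Complex.I) e R p * (1 - R p) := by
  set A := connA e Φ p with hA
  set A' := connA e (fun p => stepDown (Φ p) (R p)) p with hA'
  set D := ddM (-Complex.I) e R p with hD
  have key : ∀ z : Circle, (z : ℂ) ≠ 1 →
      (R p + (z : ℂ)⁻¹ • (1 - R p)) * A' * (R p + (z : ℂ) • (1 - R p)) -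
        (z : ℂ) • ((R p + (z : ℂ)⁻¹ • (1 - R p)) * D) = A := by
    intro z hz
    have hz0 : (z : ℂ) ≠ 0 := Circle.coe_ne_zero z
    have hz1 : (1 - (z : ℂ)⁻¹) ≠ 0 := by
      rw [sub_ne_zero]
      intro h0
      exact hz (by rw [← inv_inv (z : ℂ), ← h0, inv_one])
    have h1 : (fun q => Φ q z) = fun q =>
        stepDown (Φ q) (R q) z * (R q + (z : ℂ) • (1 - R q)) :=
      funext fun q => (stepDown_mul (hR q) (Φ q) z).symm
    have h2 := h.ddM_eval_eq he hp z
    have hd1 : MatDiffAt e (fun q => stepDown (Φ q) (R q) z) p :=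
      (matSmoothAt_eval h'.mem h'.smooth z p).matDiffAt he hp
    have hd2 : MatDiffAt e R p := (hRs p).matDiffAt he hp
    have hd3 : MatDiffAt e (fun q => (z : ℂ) • (1 - R q)) p :=
      ((matDiffAt_const 1).sub hd2).const_smul _
    rw [h1, ddM_mul hd1 (hd2.add hd3) hp, ddM_add hd2 hd3,
      ddM_const_smul _ ((matDiffAt_const 1).sub hd2) hp, ddM_const_sub _ hd2 hp,
      h'.ddM_eval_eq he hp z, ← hA, ← hA', ← hD] at h2
    have h3 := congrArg (fun B => (1 - (z : ℂ)⁻¹)⁻¹ • ((Φ p z)ᴴ * B)) h2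
    beta_reduce at h3
    rw [← mul_assoc _ (Φ p z), OmegaPoly.conjTranspose_mul (h.mem p), one_mul, smul_smul,
      inv_mul_cancel₀ hz1, one_smul] at h3
    rw [← h3]
    have h4 : ∀ B, (Φ p z)ᴴ * (stepDown (Φ p) (R p) z * B) =
        (R p + (z : ℂ)⁻¹ • (1 - R p)) * B := fun B => by
      rw [stepDown, ← mul_assoc, ← mul_assoc, OmegaPoly.conjTranspose_mul (h.mem p), one_mul]
    have h5 : D + (z : ℂ) • -D = (1 - (z : ℂ)) • D := by
      rw [smul_neg, sub_smul, one_smul, sub_eq_add_neg]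
    have h6 : (1 - (z : ℂ)⁻¹)⁻¹ * (1 - (z : ℂ)) = -z := by
      have h7 : (1 - (z : ℂ)) = (1 - (z : ℂ)⁻¹) * (-z) := by
        rw [sub_mul, one_mul, mul_neg, inv_mul_cancel₀ hz0]
        ring
      rw [h7, inv_mul_cancel_left₀ hz1]
    rw [mul_add (Φ p z)ᴴ, h5, mul_assoc (stepDown (Φ p) (R p) z), h4, h4, smul_add, Matrix.mul_smul,
      smul_smul, h6, Matrix.smul_mul, Matrix.mul_smul, smul_smul, inv_mul_cancel₀ hz1, one_smul,
      neg_smul, ← sub_eq_add_neg, mul_assoc]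
  -- The values λ = i and λ = -1 are compared: they differ from each other, have different inverses,
  -- and avoid 1, where the equation carries no information.
  have hi : ∃ z : Circle, (z : ℂ) = Complex.I := ⟨⟨Complex.I, by simp [Submonoid.unitSphere]⟩, rfl⟩
  obtain ⟨zi, hzi⟩ := hi
  have hm : ((-1 : Circle) : ℂ) = -1 := by simp
  have hi1 : (zi : ℂ) ≠ 1 := by rw [hzi]; simp [Complex.ext_iff]
  have hm1 : ((-1 : Circle) : ℂ) ≠ 1 := by rw [hm]; norm_num
  constructor
  · have hk : ∀ z : Circle, (z : ℂ) ≠ 1 → (z : ℂ)⁻¹ • ((1 - R p) * A' * R p) -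
        (1 - R p) * D * R p = (1 - R p) * A * R p := by
      intro z hz
      rw [← key z hz, compl_mul_conj_mul (Circle.coe_ne_zero z) (hR p).mul_self
        (hR p).one_sub.mul_self (hR p).compl_mul]
    have h1 := (hk zi hi1).trans (hk (-1) hm1).symm
    rw [sub_left_inj, hzi, hm, ← sub_eq_zero, ← sub_smul, smul_eq_zero] at h1
    exact h1.resolve_left (by simp [Complex.ext_iff])
  · have hk : ∀ z : Circle, (z : ℂ) ≠ 1 → (z : ℂ) • (R p * A' * (1 - R p) -
        R p * D * (1 - R p)) = R p * A * (1 - R p) := by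
      intro z hz
      rw [← key z hz, mul_conj_mul_compl (hR p).mul_self (hR p).one_sub.mul_self (hR p).mul_compl]
    have h1 := (hk zi hi1).trans (hk (-1) hm1).symm
    rw [hzi, hm, ← sub_eq_zero, ← sub_smul, smul_eq_zero] at h1
    exact sub_eq_zero.1 (h1.resolve_left (by simp [Complex.ext_iff]))

/-- The relation (1 - R)A'R = 0 is invariance under A'. For holomorphy, differentiating (1 - R)σ = 0
gives (1 - R)∂_z̄ σ = (∂_z̄ R)σ, and the adjoint of the second relation of `stepDown_relations`
identifies (1 - R)(∂_z̄ R)σ with (1 - R)A'*σ; since A^φ_z̄ = -A'*, the two contributions cancel. -/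
theorem PolySolution.isUniton_range (h : PolySolution (r + 1) Φ)
    (h' : PolySolution r fun p => stepDown (Φ p) (R p)) (hR : ∀ p, IsOrthProj (R p))
    (hRs : ∀ p, MatSmoothAt R p) :
    IsUniton (fun p => stepDown (Φ p) (R p) (-1)) fun p => LinearMap.range (act (R p)) := by
  refine ⟨isSmoothSubbundle_range hR hRs, fun e he U hU hUe σ hσ hσα p hp => ?_⟩
  have hpe := hUe hp
  obtain ⟨h1, h2⟩ := h.stepDown_relations h' hR hRs he hpe
  have hAz : Azbar e (fun p => stepDown (Φ p) (R p) (-1)) p =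
      -(connA e (fun p => stepDown (Φ p) (R p)) p)ᴴ := by
    rw [Azbar, dzbarMat_eq_ddM, h'.ddM_bar_eval_eq he hpe (-1), Matrix.nonsing_inv_mul_cancel_left,
      smul_smul, Circle.coe_neg, Circle.coe_one]
    · norm_num
    · exact Matrix.isUnit_det_of_left_inverse (OmegaPoly.conjTranspose_mul (h'.mem p) (-1))
  rw [hAz]
  change _ ∧ act (connA e (fun p => stepDown (Φ p) (R p)) p) (σ p) ∈ _
  set A := connA e (fun p => stepDown (Φ p) (R p)) p
  have hσp : R p * col (σ p) = col (σ p) := by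
    have := (hR p).mem_range_iff.1 (hσα p hp)
    rw [Matrix.sub_mul, Matrix.one_mul] at this
    exact (sub_eq_zero.1 this).symm
  simp only [(hR p).mem_range_iff]
  constructor
  · have hσs : SmoothAt σ p := (hσ p hp).contMDiffAt (hU.mem_nhds hp)
    have hσd : DiffAt e σ p := hσs.diffAt he hpe
    have hcol : MatDiffAt e (fun q => col (σ q)) p := fun i _ =>
      ((EuclideanSpace.proj i : E n →L[ℂ] ℂ).restrictScalars ℝ).differentiableAt.comp _ hσd
    have h3 : col (dzbar e σ p) = ddM Complex.I e (fun q => col (σ q)) p := by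
      ext i j
      exact (dd_apply_eq hσd i).symm
    have h4 := ddM_mul (c := Complex.I) ((matDiffAt_const 1).sub ((hRs p).matDiffAt he hpe)) hcol hpe
    rw [ddM_congr hpe (G := fun _ => 0) (by
      filter_upwards [hU.mem_nhds hp] with q hq
      exact (hR q).mem_range_iff.1 (hσα q hq)), ddM_const,
      ddM_const_sub _ ((hRs p).matDiffAt he hpe) hpe, ← h3] at h4
    have h5 : ddM Complex.I e R p = (ddM (-Complex.I) e R p)ᴴ := by
      have := ddM_conjTranspose (c := Complex.I) ((hRs p).matDiffAt he hpe)
      simp_rw [(hR _).conjTranspose, Complex.conj_I] at this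
      exact this
    have h6 := congrArg Matrix.conjTranspose h2
    simp only [Matrix.conjTranspose_mul, (hR p).conjTranspose, (hR p).one_sub.conjTranspose,
      ← h5] at h6
    have h7 : (1 - R p) * (col (dzbar e σ p)) = ddM Complex.I e R p * col (σ p) := by
      rw [Matrix.neg_mul, eq_comm, neg_add_eq_zero] at h4
      exact h4.symm
    have h8 : (1 - R p) * (Aᴴ * col (σ p)) = (1 - R p) * (ddM Complex.I e R p * col (σ p)) := by
      have := congrArg (· * col (σ p)) h6
      simp only [Matrix.mul_assoc, hσp] at this
      exact this
    have h9 : col (dzbar e σ p + act (-Aᴴ) (σ p)) = col (dzbar e σ p) - Aᴴ * col (σ p) := by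
      rw [← col_act]
      change _ = col (dzbar e σ p - act Aᴴ (σ p))
      rw [sub_eq_add_neg, ← LinearMap.neg_apply, ← map_neg Matrix.toEuclideanLin]
    change (1 - R p) * col (dzbar e σ p + act (-Aᴴ) (σ p)) = 0
    rw [h9, Matrix.mul_sub, h8, ← h7, ← Matrix.mul_assoc, (hR p).one_sub.mul_self, sub_self]
  · rw [col_act, ← hσp, ← Matrix.mul_assoc, ← Matrix.mul_assoc, h1, Matrix.zero_mul]

end Unitons

/-! ### Factorizations -/

section Factorization

variable {M : Type*} [TopologicalSpace M] [ChartedSpace ℂ M] {n r : ℕ}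
  {Φ : M → Circle → Mat n} {R : ℕ → M → Mat n} {b : ℕ → Bool}

/-- The subspaces onto which the projections `R i p` project. -/
abbrev ranges (R : ℕ → M → Mat n) : ℕ → M → Submodule ℂ (E n) :=
  fun i p => LinearMap.range (act (R i p))

omit [TopologicalSpace M] [ChartedSpace ℂ M] in
theorem partialProd_succ (α : ℕ → M → Submodule ℂ (E n)) (i : ℕ) (p : M) (z : Circle) :
    partialProd α (i + 1) p z = partialProd α i p z * eta (α (i + 1) p) z := rfl

omit [TopologicalSpace M] [ChartedSpace ℂ M] in
theorem partialProd_congr {α α' : ℕ → M → Submodule ℂ (E n)} :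
    ∀ {i : ℕ}, (∀ j, j ≤ i → α j = α' j) → partialProd α i = partialProd α' i
  | 0, _ => rfl
  | i + 1, h => by
    ext1 p
    ext1 z
    rw [partialProd_succ, partialProd_succ, partialProd_congr fun j hj => h j (by omega),
      h (i + 1) le_rfl]

omit [TopologicalSpace M] [ChartedSpace ℂ M] in
theorem stepDown_partialProd_succ (hR : ∀ i p, IsOrthProj (R i p)) (i : ℕ) (p : M) :
    stepDown (partialProd (ranges R) (i + 1) p) (R (i + 1) p) = partialProd (ranges R) i p := by
  ext1 z
  rw [stepDown, partialProd_succ, eta_range (hR _ _), mul_assoc]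
  have h1 := stepFactor_mul (hR (i + 1) p) z⁻¹
  rw [Circle.coe_inv, inv_inv] at h1
  rw [h1, mul_one]

theorem OmegaPoly.eq_one {γ : Circle → Mat n} (h : γ ∈ OmegaPoly 0 n) (z : Circle) : γ z = 1 := by
  obtain ⟨h1, T, hT⟩ := h
  have h2 := h1.2.1
  rw [hT] at h2 ⊢
  simpa using h2

/-- A factorization of `Φ` into `r` factors, such that the step from the `i+1`-st partial product
to the `i`-th one is of type `b i`. -/
structure IsFactorization (b : ℕ → Bool) (r : ℕ) (Φ : M → Circle → Mat n)
    (R : ℕ → M → Mat n) : Prop where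
  proj : ∀ i p, IsOrthProj (R i p)
  eq : partialProd (ranges R) r = Φ
  sol : ∀ i ≤ r, PolySolution i (partialProd (ranges R) i)
  uniton : ∀ i < r, IsUniton (fun p => partialProd (ranges R) i p (-1)) (ranges R (i + 1))
  step : ∀ i < r, ∀ᶠ p in codiscrete M,
    IsStep (b i) (i + 1) (partialProd (ranges R) (i + 1) p) (R (i + 1) p)

/-- Induction on the degree, splitting off the last factor by a step of the prescribed type. A loop
of degree 0 is 1, so the induction ends with an empty product. -/
theorem PolySolution.exists_factorization [T1Space M] [IsManifold 𝓘(ℂ) ω M] (b : ℕ → Bool) :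
    ∀ {r : ℕ} {Φ : M → Circle → Mat n}, PolySolution r Φ → ∃ R, IsFactorization b r Φ R
  | 0, Φ, h => ⟨fun _ _ => 1,
    { proj := fun _ _ => ⟨mul_one 1, Matrix.conjTranspose_one⟩
      eq := by
        ext1 p
        ext1 z
        rw [OmegaPoly.eq_one (h.mem p) z]
        rfl
      sol := fun i hi => by
        obtain rfl : i = 0 := by omega
        have : Φ = partialProd (ranges fun _ _ => 1) 0 := by
          ext1 p
          ext1 z
          rw [OmegaPoly.eq_one (h.mem p) z]
          rfl
        rwa [← this]
      uniton := fun i hi => by omega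
      step := fun i hi => by omega }⟩
  | r + 1, Φ, h => by
    obtain ⟨S, hS, hSs, hsol, hstep⟩ := h.exists_step (b r)
    obtain ⟨R, hR⟩ := PolySolution.exists_factorization b hsol
    -- Only the entry at r + 1 is new; the partial products up to r do not see it.
    set R' : ℕ → M → Mat n := fun i => if i = r + 1 then S else R i with hR'
    have hlow : ∀ i ≤ r, R' i = R i := fun i hi => by
      rw [hR']
      exact if_neg (by omega)
    have htop : R' (r + 1) = S := if_pos rfl
    have hrtop : ∀ p, ranges R' (r + 1) p = LinearMap.range (act (S p)) := fun p => by
      simp only [ranges, htop]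
    have hrlow : ∀ i ≤ r, ranges R' i = ranges R i := fun i hi => by
      ext1 p
      simp only [ranges, hlow i hi]
    have hpp : ∀ i ≤ r, partialProd (ranges R') i = partialProd (ranges R) i := fun i hi =>
      partialProd_congr fun j hj => hrlow j (by omega)
    have heq : partialProd (ranges R') (r + 1) = Φ := by
      ext1 p
      ext1 z
      rw [partialProd_succ, hpp r le_rfl, hR.eq, hrtop, eta_range (hS p), stepDown_mul (hS p)]
    refine ⟨R', ?_, heq, ?_, ?_, ?_⟩
    · intro i p
      by_cases hi : i = r + 1
      · rw [hi, htop]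
        exact hS p
      · have h1 : R' i = R i := if_neg hi
        rw [h1]
        exact hR.proj i p
    · intro i hi
      rcases Nat.lt_or_ge r i with h1 | h1
      · obtain rfl : i = r + 1 := by omega
        rwa [heq]
      · rw [hpp i h1]
        exact hR.sol i h1
    · intro i hi
      rw [hpp i (by omega)]
      rcases Nat.lt_or_ge i r with h1 | h1
      · rw [hrlow (i + 1) (by omega)]
        exact hR.uniton i h1
      · obtain rfl : i = r := by omega
        rw [hR.eq, funext hrtop]
        exact h.isUniton_range hsol hS hSs
    · intro i hi
      rcases Nat.lt_or_ge i r with h1 | h1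
      · rw [hpp (i + 1) (by omega), hlow (i + 1) (by omega)]
        exact hR.step i h1
      · obtain rfl : i = r := by omega
        rw [heq, htop]
        exact hstep

theorem IsFactorization.isUnitonFactorization (h : IsFactorization b r Φ R) :
    IsUnitonFactorization r Φ (ranges R) := by
  refine ⟨h.eq.symm, fun i hi hir => ?_⟩
  obtain ⟨i, rfl⟩ : ∃ j, i = j + 1 := ⟨i - 1, by omega⟩
  exact ⟨(h.sol i (by omega)).isExtendedSolutionU, h.uniton i (by omega)⟩

theorem IsFactorization.grass_eq (h : IsFactorization b r Φ R) {i : ℕ} (hi : i < r) :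
    ∀ᶠ p in codiscrete M, grass (partialProd (ranges R) i p) =
      stepGrass (b i) i (grass (partialProd (ranges R) (i + 1) p)) := by
  filter_upwards [h.step i hi] with p hp
  rw [← hp.grass_eq (h.proj _ _) ((h.sol (i + 1) hi).mem p), stepDown_partialProd_succ h.proj]

/-- The types of the steps of the alternating filtration. -/
def altType (startU : Bool) (r i : ℕ) : Bool := decide (startU = true ↔ Even (r - (i + 1)))

theorem altType_not {startU : Bool} {r i : ℕ} (hi : i + 1 < r) :
    altType startU r i = !altType startU r (i + 1) := by
  have : Even (r - (i + 1)) ↔ ¬ Even (r - (i + 1 + 1)) := by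
    obtain ⟨d, hd⟩ : ∃ d, r - (i + 1) = d + 1 := ⟨r - (i + 1) - 1, by omega⟩
    rw [hd, show r - (i + 1 + 1) = d by omega, Nat.even_add_one]
  rw [altType, altType, ← decide_not, decide_eq_decide, this]
  tauto

theorem altCount_succ {startU : Bool} {r i : ℕ} (hi : i < r) : altCount startU r i =
    if altType startU r i then altCount startU r (i + 1) + 1 else altCount startU r (i + 1) := by
  simp only [altType, altCount, Nat.even_iff, decide_eq_true_eq]
  cases startU <;> simp only [if_true, true_iff, false_iff, Bool.false_eq_true, if_false] <;>
    split_ifs <;> omega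

theorem altCount_self (startU : Bool) (r : ℕ) : altCount startU r r = 0 := by
  cases startU <;> simp [altCount]

/-- This bound gives λ^{-u} λ^r H₊ ⊆ λ^i H₊, so generators that matter only modulo λ^r H₊ have no
effect on the i-th uniton. -/
theorem altCount_le (startU : Bool) {r i : ℕ} (hi : i ≤ r) : altCount startU r i + i ≤ r := by
  unfold altCount
  split_ifs <;> omega

theorem IsFactorization.isAlternatingFiltration {startU : Bool}
    (h : IsFactorization (altType startU r) r Φ R) :
    IsAlternatingFiltration startU r (partialProd (ranges R)) := by
  intro i hi hir
  obtain ⟨i, rfl⟩ : ∃ j, i = j + 1 := ⟨i - 1, by omega⟩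
  filter_upwards [h.grass_eq (i := i) (by omega)] with p hp
  rw [Nat.add_sub_cancel, hp, stepGrass, altType]
  refine ⟨fun h1 => by rw [if_pos (decide_eq_true h1)], fun h1 => ?_⟩
  rw [if_neg (by rwa [decide_eq_true_eq])]
  push_cast
  rw [add_sub_cancel_right]

theorem stepSpace_zero {W : Submodule ℂ (H n)} (h1 : W ≤ Hplus n)
    (h2 : shift (r : ℤ) (Hplus n) ≤ W) : stepSpace W 0 r = W := by
  rw [stepSpace, Nat.cast_zero, neg_zero, shift_zero, inf_eq_left.2 h1, sup_eq_left.2 h2]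

/-- Downward induction from W itself, for which u = 0 and i = r; `altCount` increases precisely at
the Uhlenbeck steps. -/
theorem IsFactorization.grass_eq_stepSpace {startU : Bool}
    (h : IsFactorization (altType startU r) r Φ R) {i : ℕ} (hi : i ≤ r) :
    ∀ᶠ p in codiscrete M, grass (partialProd (ranges R) i p) =
      stepSpace (grass (Φ p)) (altCount startU r i) i := by
  induction hi using Nat.decreasingInduction with
  | self =>
    refine Eventually.of_forall fun p => ?_
    have hmem := (h.sol r le_rfl).mem p
    rw [h.eq] at hmem ⊢
    rw [altCount_self, stepSpace_zero (OmegaPoly.grass_le hmem) (OmegaPoly.le_grass hmem)]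
  | of_succ i hi ih =>
    filter_upwards [ih, h.grass_eq hi] with p h1 h2
    rw [h2, h1, stepGrass_stepSpace, altCount_succ hi]

theorem IsFactorization.ranges_eq {startU : Bool}
    (h : IsFactorization (altType startU r) r Φ R) {i : ℕ} (hi : i < r) :
    ∀ᶠ p in codiscrete M, ranges R (i + 1) p =
      (stepSpace (grass (Φ p)) (altCount startU r (i + 1)) (i + 1)).map
        (evalMap (partialProd (ranges R) i p) (i + 1)) := by
  filter_upwards [h.grass_eq_stepSpace (i := i + 1) hi] with p hp
  have hm := (h.sol i hi.le).mem p
  rw [← stepDown_partialProd_succ h.proj] at hm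
  have key := map_evalMap_grass ((h.sol (i + 1) hi).mem p) (h.proj _ _) hm
  rw [stepDown_partialProd_succ h.proj] at key
  rw [← hp, key]

/-- Descent from the real loop Φ by pairs of steps of opposite types. At generic points this is
`OmegaReal.two_steps`; elsewhere reality is a closed condition on the smooth partial product. -/
theorem IsFactorization.isReal {startU : Bool} {s : ℕ}
    (h : IsFactorization (altType startU r) r Φ R) (hr : r = 2 * s)
    (hΦ : ∀ p, Φ p ∈ OmegaReal r n) {j : ℕ} (hj : j ≤ s) :
    ∀ p, partialProd (ranges R) (2 * j) p ∈ OmegaReal (2 * j) n := by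
  induction hj using Nat.decreasingInduction with
  | self =>
    rw [← hr, h.eq]
    exact hΦ
  | of_succ j hj ih =>
    have hgen : ∀ᶠ p in codiscrete M,
        partialProd (ranges R) (2 * j) p ∈ OmegaReal (2 * j) n := by
      filter_upwards [h.step (2 * j) (by omega), h.step (2 * j + 1) (by omega)] with p h1 h2
      rw [altType_not (by omega)] at h1
      have h3 := OmegaReal.two_steps (r := 2 * j) (γ := partialProd (ranges R) (2 * j + 1 + 1) p)
        (ih p) (h.proj _ _) (h.proj (2 * j + 1) p) h2 (by
          rw [stepDown_partialProd_succ h.proj]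
          exact h1)
      rwa [stepDown_partialProd_succ h.proj, stepDown_partialProd_succ h.proj] at h3
    have hsol := h.sol (2 * j) (by omega)
    intro p
    refine ⟨hsol.mem p, fun z => ?_⟩
    have hs := matSmoothAt_eval hsol.mem hsol.smooth z p
    exact eq_of_eventuallyEq_nhdsNE hs.map_conj.continuousAt (hs.const_smul _).continuousAt
      ((eventually_codiscrete_iff.1 hgen p).mono fun q hq => hq.2 z)

theorem eta_mul_eta_mem {R S : Mat n} (hR : IsOrthProj R) (hS : IsOrthProj S) :
    (fun z => eta (LinearMap.range (act R)) z * eta (LinearMap.range (act S)) z) ∈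
      OmegaPoly 2 n := by
  have hT : ∀ z : Circle, eta (LinearMap.range (act R)) z * eta (LinearMap.range (act S)) z =
      ∑ k ∈ Finset.range (2 + 1), (z : ℂ) ^ k •
        (fun k => if k = 0 then R * S else if k = 1 then R * (1 - S) + (1 - R) * S else
          (1 - R) * (1 - S) : ℕ → Mat n) k := by
    intro z
    rw [eta_range hR, eta_range hS]
    simp only [Finset.sum_range_succ, Finset.sum_range_zero, zero_add, pow_zero, one_smul, pow_one,
      if_true, one_ne_zero, if_false, OfNat.ofNat_ne_zero, OfNat.ofNat_ne_one, add_mul, mul_add,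
      Matrix.smul_mul, Matrix.mul_smul, smul_smul, smul_add, sq]
    abel
  obtain ⟨h1, h2⟩ := IsLaurent.of_sum_range hT
  have hu : ∀ {R : Mat n}, IsOrthProj R → ∀ z : Circle,
      (eta (LinearMap.range (act R)) z)ᴴ * eta (LinearMap.range (act R)) z = 1 := by
    intro R hR z
    rw [eta_range hR, ← stepFactor_conjTranspose hR, Matrix.conjTranspose_conjTranspose,
      stepFactor_conjTranspose hR, stepFactor_mul hR]
  refine OmegaPoly.mk h1 h2 (fun z => ?_) ?_
  · rw [Matrix.conjTranspose_mul, mul_assoc, ← mul_assoc _ (eta _ z), hu hR, one_mul, hu hS]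
  · simp [eta_range hR, eta_range hS]

/-- The quotient of consecutive even partial products, both real: cancelling the left factor F in
the reality equation for FG leaves that for G. -/
theorem IsFactorization.isReal_factor {startU : Bool} {s : ℕ}
    (h : IsFactorization (altType startU r) r Φ R) (hr : r = 2 * s)
    (hΦ : ∀ p, Φ p ∈ OmegaReal r n) {l : ℕ} (hl : l < s) (p : M) :
    (fun z => eta (ranges R (2 * l + 1) p) z * eta (ranges R (2 * l + 2) p) z) ∈
      OmegaReal 2 n := by
  refine ⟨eta_mul_eta_mem (h.proj _ _) (h.proj _ _), fun z => ?_⟩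
  set F := partialProd (ranges R) (2 * l) p z with hF
  set G := eta (ranges R (2 * l + 1) p) z * eta (ranges R (2 * l + 2) p) z
  have hFG : partialProd (ranges R) (2 * (l + 1)) p z = F * G := by
    rw [show 2 * (l + 1) = 2 * l + 1 + 1 by ring, partialProd_succ, partialProd_succ, mul_assoc]
  have h1 := (h.isReal hr hΦ hl.le p).2 z
  have h2 := (h.isReal hr hΦ (j := l + 1) hl p).2 z
  have hz := Circle.coe_ne_zero z
  rw [hFG, map_conj_mul, h1, Matrix.smul_mul] at h2
  have h3 := congrArg (fun B => (z : ℂ) ^ (((2 * l : ℕ) : ℤ)) • (Fᴴ * B)) h2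
  have hFF : Fᴴ * F = 1 := OmegaPoly.conjTranspose_mul ((h.isReal hr hΦ hl.le p).1) z
  simp only [Matrix.mul_smul, smul_smul, ← mul_assoc Fᴴ, hFF, one_mul, ← zpow_add₀ hz] at h3
  rw [add_neg_cancel, zpow_zero, one_smul, ← hF, hFF, one_mul] at h3
  change G.map _ = _ • G
  rw [h3]
  congr 2
  push_cast
  ring

end Factorization

/-! ### Holomorphic maps and their derivatives in coordinates -/

section Holomorphic

variable {M : Type*} [TopologicalSpace M] [ChartedSpace ℂ M] {e : OpenPartialHomeomorph M ℂ} {p : M}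
  {V W : Type*} [NormedAddCommGroup V] [NormedSpace ℂ V] [NormedAddCommGroup W] [NormedSpace ℂ W]
  {f g : M → V}

theorem mdifferentiableAt_iff_chart (he : e ∈ IsManifold.maximalAtlas 𝓘(ℂ) ω M)
    (hp : p ∈ e.source) :
    MDifferentiableAt 𝓘(ℂ) 𝓘(ℂ, V) f p ↔ DifferentiableAt ℂ (f ∘ e.symm) (e p) := by
  have he1 := mem_maximalAtlas_one he
  rw [← mdifferentiableAt_iff_differentiableAt]
  constructor
  · intro hf
    refine MDifferentiableAt.comp (I' := 𝓘(ℂ)) (e p) ?_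
      ((contMDiffAt_symm_of_mem_maximalAtlas he1 (e.map_source hp)).mdifferentiableAt one_ne_zero)
    rwa [e.left_inv hp]
  · intro hf
    have h1 : MDifferentiableAt 𝓘(ℂ) 𝓘(ℂ, V) ((f ∘ e.symm) ∘ e) p :=
      MDifferentiableAt.comp (I' := 𝓘(ℂ)) p hf
        ((contMDiffAt_of_mem_maximalAtlas he1 hp).mdifferentiableAt one_ne_zero)
    refine h1.congr_of_eventuallyEq ?_
    filter_upwards [e.open_source.mem_nhds hp] with q hq
    simp [e.left_inv hq]

/-- Holomorphy in a neighbourhood of a point. -/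
def HolAt (f : M → V) (p : M) : Prop := ∀ᶠ q in 𝓝 p, MDifferentiableAt 𝓘(ℂ) 𝓘(ℂ, V) f q

theorem HolAt.eventually (h : HolAt f p) : ∀ᶠ q in 𝓝 p, HolAt f q := eventually_eventually_nhds.2 h

theorem holAt_iff [CompleteSpace V] (he : e ∈ IsManifold.maximalAtlas 𝓘(ℂ) ω M)
    (hp : p ∈ e.source) : HolAt f p ↔ AnalyticAt ℂ (f ∘ e.symm) (e p) := by
  rw [Complex.analyticAt_iff_eventually_differentiableAt, HolAt, ← eventually_nhds_chart hp]
  refine eventually_congr ?_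
  filter_upwards [e.open_target.mem_nhds (e.map_source hp)] with z hz
  rw [mdifferentiableAt_iff_chart he (e.map_target hz), e.right_inv hz]

theorem HolAt.clm (h : HolAt f p) (L : V →L[ℂ] W) : HolAt (fun q => L (f q)) p :=
  h.mono fun _ hq => L.differentiableAt.comp_mdifferentiableAt hq

theorem IsMeromorphic.eventually_holAt [IsManifold 𝓘(ℂ) ω M] [CompleteSpace V]
    (hf : IsMeromorphic f) : ∀ᶠ p in codiscrete M, HolAt f p := by
  rw [eventually_codiscrete_iff]
  intro p
  rw [← eventually_nhdsNE_chart (mem_chart_source ℂ p)]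
  filter_upwards [(hf p).eventually_analyticAt, nhdsWithin_le_nhds
    ((chartAt ℂ p).open_target.mem_nhds (mem_chart_target ℂ p))] with z h1 h2
  rw [holAt_iff (chartAt_mem p) ((chartAt ℂ p).map_target h2), (chartAt ℂ p).right_inv h2]
  exact h1

omit [ChartedSpace ℂ M] in
theorem cderiv_zero (e : OpenPartialHomeomorph M ℂ) (f : M → V) (hp : p ∈ e.source) :
    cderiv e 0 f p = f p := by
  rw [cderiv, iteratedDeriv_zero, Function.comp_apply, e.left_inv hp]

omit [ChartedSpace ℂ M] in
theorem cderiv_congr (hp : p ∈ e.source) (h : ∀ᶠ q in 𝓝 p, f q = g q) (k : ℕ) :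
    cderiv e k f p = cderiv e k g p :=
  (comp_symm_eventuallyEq hp h).iteratedDeriv_eq k

omit [ChartedSpace ℂ M] in
theorem cderiv_comp_symm_eventuallyEq (hp : p ∈ e.source) (k : ℕ) (f : M → V) :
    cderiv e k f ∘ e.symm =ᶠ[𝓝 (e p)] iteratedDeriv k (f ∘ e.symm) := by
  filter_upwards [e.open_target.mem_nhds (e.map_source hp)] with z hz
  rw [Function.comp_apply, cderiv, e.right_inv hz]

theorem HolAt.cderiv [CompleteSpace V] (he : e ∈ IsManifold.maximalAtlas 𝓘(ℂ) ω M)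
    (hp : p ∈ e.source) (h : HolAt f p) (k : ℕ) : HolAt (cderiv e k f) p := by
  rw [holAt_iff he hp] at h ⊢
  have h1 := AnalyticAt.iterated_deriv h k
  rw [← iteratedDeriv_eq_iterate] at h1
  exact h1.congr (cderiv_comp_symm_eventuallyEq hp k f).symm

omit [ChartedSpace ℂ M] in
theorem cderiv_succ (hp : p ∈ e.source) (k : ℕ) (f : M → V) :
    cderiv e (k + 1) f p = deriv (cderiv e k f ∘ e.symm) (e p) := by
  rw [(cderiv_comp_symm_eventuallyEq hp k f).deriv_eq, cderiv, iteratedDeriv_succ]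

omit [ChartedSpace ℂ M] in
theorem cderiv_zero_fun (k : ℕ) : cderiv e k (fun _ => (0 : V)) p = 0 := by
  rw [cderiv]
  change iteratedDeriv k (fun _ => (0 : V)) (e p) = 0
  rw [iteratedDeriv_const]
  split_ifs <;> rfl

theorem cderiv_clm [CompleteSpace V] [CompleteSpace W] (he : e ∈ IsManifold.maximalAtlas 𝓘(ℂ) ω M)
    (hp : p ∈ e.source) (h : HolAt f p) (L : V →L[ℂ] W) (k : ℕ) :
    cderiv e k (fun q => L (f q)) p = L (cderiv e k f p) := by
  induction k generalizing p with
  | zero => rw [cderiv_zero e _ hp, cderiv_zero e _ hp]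
  | succ k ih =>
    rw [cderiv_succ hp, cderiv_succ hp]
    have h1 : cderiv e k (fun q => L (f q)) ∘ e.symm =ᶠ[𝓝 (e p)]
        (fun q => L (cderiv e k f q)) ∘ e.symm := by
      refine comp_symm_eventuallyEq hp ?_
      filter_upwards [h.eventually, e.open_source.mem_nhds hp] with q h1 h2
      exact ih h2 h1
    rw [h1.deriv_eq]
    have h2 := ((holAt_iff he hp).1 (h.cderiv he hp k)).differentiableAt
    exact (L.hasFDerivAt.comp_hasDerivAt (e p) h2.hasDerivAt).deriv

omit [ChartedSpace ℂ M] in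
theorem dd_eq_deriv [NormedSpace ℝ V] [IsScalarTower ℝ ℂ V]
    (h : DifferentiableAt ℂ (f ∘ e.symm) (e p)) :
    dd (-Complex.I) e f p = deriv (f ∘ e.symm) (e p) := by
  rw [dd, (h.hasFDerivAt.restrictScalars ℝ).fderiv]
  simp only [ContinuousLinearMap.coe_restrictScalars']
  have h1 : fderiv ℂ (f ∘ e.symm) (e p) Complex.I =
      Complex.I • fderiv ℂ (f ∘ e.symm) (e p) 1 := by
    rw [← map_smul, smul_eq_mul, mul_one]
  rw [h1, smul_smul, neg_mul, Complex.I_mul_I, neg_neg, one_smul, ← two_smul ℂ, smul_smul,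
    ← fderiv_apply_one_eq_deriv]
  norm_num

end Holomorphic

/-! ### Elements of the Grassmannian model in terms of coefficients -/

section Coefficients

variable {n r : ℕ} {γ : Circle → Mat n}

theorem coeff_eq_sum (v : Coef r n) (m : ℤ) :
    coeff v m = ∑ c : Fin r, if m = ((c : ℕ) : ℤ) then v c else 0 := by
  rw [coeff]
  split_ifs with h
  · rw [Finset.sum_eq_single ⟨m.toNat, h.2⟩]
    · rw [if_pos (by simp only; omega)]
    · intro c _ hc
      rw [if_neg]
      intro h1
      exact hc (Fin.ext (by simp only; omega))
    · simp
  · refine (Finset.sum_eq_zero fun c _ => if_neg fun h1 => h ⟨by omega, ?_⟩).symm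
    have := c.2
    omega

theorem coeff_fin (v : Coef r n) (c : Fin r) : coeff v ((c : ℕ) : ℤ) = v c := by
  rw [coeff, dif_pos ⟨by omega, by simp⟩]
  simp

/-- The `m`-th coefficient as a linear map. -/
def coeffL (r n : ℕ) (m : ℤ) : Coef r n →L[ℂ] E n :=
  ∑ c : Fin r, if m = ((c : ℕ) : ℤ) then ContinuousLinearMap.proj c else 0

theorem coeffL_apply (m : ℤ) (v : Coef r n) : coeffL r n m v = coeff v m := by
  rw [coeff_eq_sum, coeffL, sum_apply]
  refine Finset.sum_congr rfl fun c _ => ?_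
  split_ifs <;> rfl

/-- `laurent k` as a linear map. -/
def laurentL (r n k : ℕ) : Coef r n →ₗ[ℂ] H n where
  toFun := laurent k
  map_add' v w := by
    rw [laurent, laurent, laurent, ← map_add]
    congr 1
    ext t a
    simp [Finset.sum_add_distrib]
  map_smul' c v := by
    rw [laurent, laurent, ← map_smul]
    congr 1
    ext t a
    simp [Finset.mul_sum, mul_left_comm]

theorem laurentL_apply (k : ℕ) (v : Coef r n) : laurentL r n k v = laurent k v := rfl

/-- `∑_c T_{c+m}^* v_c`. -/
def dualCoeff (γ : Circle → Mat n) (m : ℤ) (v : Coef r n) : Matrix (Fin n) Unit ℂ :=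
  ∑ c : Fin r, (loopCoeff γ ((c : ℕ) + m))ᴴ * col (v c)

/-- The coefficient of γ*(λ^l v) in degree a is `dualCoeff γ (l - a) v`; negative a correspond to
indices at least l + 1. -/
theorem laurent_mem_grass_iff (hγ : γ ∈ OmegaPoly r n) (l : ℕ) (v : Coef r n) :
    laurent l v ∈ grass γ ↔ ∀ m : ℤ, (l : ℤ) + 1 ≤ m → dualCoeff γ m v = 0 := by
  obtain ⟨L, L', -, hL', -, hP, -, -⟩ := OmegaPoly.exists_isMul hγ
  rw [OmegaPoly.mem_grass hγ hL', mem_Hplus]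
  have key : ∀ a : ℤ, a < 0 → col (P a (L' (laurent l v))) = dualCoeff γ (l - a) v := by
    intro a ha
    have h1 : P a (L' (laurent l v)) =
        ∑ c : Fin r, act (loopCoeff γ ((c : ℕ) + (l - a)))ᴴ (v c) := by
      rw [hP]
      simp_rw [P_laurent, coeff_eq_sum, map_sum]
      rw [Finset.sum_comm]
      refine Finset.sum_congr rfl fun c _ => ?_
      -- Interchanging the sums leaves at most one index k = c + l - a for each c; if it exceeds r,
      -- the coefficient of γ is zero.
      by_cases hc : (c : ℕ) + ((l : ℤ) - a) ≤ r
      · rw [Finset.sum_eq_single ((c : ℕ) + ((l : ℤ) - a)).toNat]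
        · rw [if_pos (by omega), Int.toNat_of_nonneg (by omega)]
        · intro k _ hk
          rw [if_neg (by omega), map_zero]
        · intro hk
          rw [Finset.mem_range] at hk
          omega
      · rw [OmegaPoly.coeff_eq_zero hγ (by omega), Matrix.conjTranspose_zero,
          show act (0 : Mat n) (v c) = 0 by simp [act]]
        refine Finset.sum_eq_zero fun k hk => ?_
        rw [Finset.mem_range] at hk
        rw [if_neg (by omega), map_zero]
    rw [h1, dualCoeff]
    ext i j
    simp only [col, Matrix.of_apply, Matrix.sum_apply, WithLp.ofLp_sum, Finset.sum_apply]
    rfl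
  constructor
  · intro h m hm
    have := key (l - m) (by omega)
    rw [h _ (by omega), sub_sub_cancel] at this
    rw [← this]
    rfl
  · intro h a ha
    apply col_injective
    rw [key a ha, h _ (by omega)]
    rfl

theorem sub_laurent_mem (f : H n) (hf : f ∈ Hplus n) (r : ℕ) :
    f - laurent 0 (fun c : Fin r => P ((c : ℕ) : ℤ) f) ∈ shift (r : ℤ) (Hplus n) := by
  rw [mem_shift_Hplus]
  intro m hm
  rw [map_sub, P_laurent, Nat.cast_zero, sub_zero]
  rcases lt_or_ge m 0 with h | h
  · rw [mem_Hplus.1 hf m h, coeff, dif_neg (by omega), sub_zero]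
  · rw [coeff, dif_pos ⟨h, by omega⟩, sub_eq_zero]
    simp only [Int.toNat_of_nonneg h]

theorem laurent_mem_shift_Hplus {k : ℕ} {o : ℕ} {v : Coef r n}
    (hv : ∀ m : ℤ, m < o → coeff v m = 0) : laurent k v ∈ shift ((k + o : ℕ) : ℤ) (Hplus n) := by
  rw [mem_shift_Hplus]
  intro m hm
  rw [P_laurent]
  exact hv _ (by push_cast at hm; omega)

theorem coeff_of_neg (v : Coef r n) {m : ℤ} (hm : m < 0) : coeff v m = 0 := by
  rw [coeff, dif_neg (by omega)]

end Coefficients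

/-! ### Closure of W under λ∂_z -/

section Derivation

variable {M : Type*} [TopologicalSpace M] [ChartedSpace ℂ M] {n r : ℕ}
  {Φ : M → Circle → Mat n} {e : OpenPartialHomeomorph M ℂ} {p : M} {σ : M → Coef r n}

theorem ddM_col (hσ : HolAt σ p) (he : e ∈ IsManifold.maximalAtlas 𝓘(ℂ) ω M)
    (hp : p ∈ e.source) (c : Fin r) :
    MatDiffAt e (fun q => col (σ q c)) p ∧
      ddM (-Complex.I) e (fun q => col (σ q c)) p = col (cderiv e 1 σ p c) := by
  have h1 : ∀ i, HolAt (fun q => σ q c i) p := fun i =>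
    hσ.clm ((EuclideanSpace.proj i : E n →L[ℂ] ℂ) ∘L ContinuousLinearMap.proj c)
  have h2 : ∀ i, DifferentiableAt ℂ ((fun q => σ q c i) ∘ e.symm) (e p) := fun i =>
    ((holAt_iff he hp).1 (h1 i)).differentiableAt
  refine ⟨fun i _ => (h2 i).restrictScalars ℝ, ?_⟩
  ext i j
  change dd (-Complex.I) e (fun q => σ q c i) p = cderiv e 1 σ p c i
  rw [dd_eq_deriv (h2 i)]
  have h3 := cderiv_clm he hp hσ
    ((EuclideanSpace.proj i : E n →L[ℂ] ℂ) ∘L ContinuousLinearMap.proj c) 1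
  rw [cderiv, iteratedDeriv_one] at h3
  exact h3

/-- `W` is closed under `λ ∂_z`. -/
theorem PolySolution.dualCoeff_cderiv_one (h : PolySolution r Φ)
    (he : e ∈ IsManifold.maximalAtlas 𝓘(ℂ) ω M) (hp : p ∈ e.source) (hσ : HolAt σ p) {l : ℤ}
    (hW : ∀ᶠ q in 𝓝 p, ∀ m : ℤ, l ≤ m → dualCoeff (Φ q) m (σ q) = 0) {m : ℤ} (hm : l + 1 ≤ m) :
    dualCoeff (Φ p) m (cderiv e 1 σ p) = 0 := by
  have h1 : ddM (-Complex.I) e (fun q => dualCoeff (Φ q) m (σ q)) p = 0 := by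
    rw [ddM_congr (G := fun _ => 0) hp (hW.mono fun q hq => hq m (by omega)), ddM_const]
  have hT : ∀ k : ℤ, MatDiffAt e (fun q => (loopCoeff (Φ q) k)ᴴ) p := fun k =>
    (h.smooth k p).conjTranspose.matDiffAt he hp
  simp only [dualCoeff] at h1
  rw [ddM_sum _ fun c _ => (hT _).mul (ddM_col hσ he hp c).1] at h1
  -- From ∂_z(T_k*) = A(T_{k-1}* - T_k*): the derivative of `dualCoeff` in degree m brings in only
  -- the degrees m - 1 and m, where it already vanishes on σ. Hence the loss of one degree.
  have h2 : ∀ c : Fin r, ddM (-Complex.I) e (fun q => (loopCoeff (Φ q) ((c : ℕ) + m))ᴴ *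
      col (σ q c)) p = connA e Φ p * ((loopCoeff (Φ p) ((c : ℕ) + (m - 1)))ᴴ * col (σ p c)) -
      connA e Φ p * ((loopCoeff (Φ p) ((c : ℕ) + m))ᴴ * col (σ p c)) +
      (loopCoeff (Φ p) ((c : ℕ) + m))ᴴ * col (cderiv e 1 σ p c) := by
    intro c
    rw [ddM_mul (hT _) (ddM_col hσ he hp c).1 hp, (ddM_col hσ he hp c).2,
      ddM_conjTranspose ((h.smooth _ p).matDiffAt he hp), map_neg, Complex.conj_I, neg_neg,
      h.ddM_bar_eq he hp, Matrix.conjTranspose_sub, Matrix.conjTranspose_mul,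
      Matrix.conjTranspose_mul, Matrix.conjTranspose_conjTranspose, Matrix.sub_mul,
      Matrix.mul_assoc, Matrix.mul_assoc, add_sub_assoc]
  rw [Finset.sum_congr rfl fun c _ => h2 c, Finset.sum_add_distrib, Finset.sum_sub_distrib,
    ← Matrix.mul_sum, ← Matrix.mul_sum] at h1
  have h3 := hW.self_of_nhds
  rw [← dualCoeff, ← dualCoeff, ← dualCoeff, h3 m (by omega), h3 (m - 1) (by omega),
    Matrix.mul_zero, sub_zero, zero_add] at h1
  exact h1

/-- Each derivative costs one factor λ: on the k-th derivative the obstructions `dualCoeff` vanish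
from degree k + 1 on. The induction needs the hypotheses near the point, since the derivative sees a
neighbourhood. -/
theorem PolySolution.laurent_cderiv_mem (h : PolySolution r Φ)
    (he : e ∈ IsManifold.maximalAtlas 𝓘(ℂ) ω M) (hp : p ∈ e.source) (hσ : HolAt σ p)
    (hW : ∀ᶠ q in 𝓝 p, laurent 0 (σ q) ∈ grass (Φ q)) {k l : ℕ} (hkl : k ≤ l) :
    laurent l (cderiv e k σ p) ∈ grass (Φ p) := by
  have key : ∀ k : ℕ, ∀ q ∈ e.source, HolAt σ q →
      (∀ᶠ x in 𝓝 q, laurent 0 (σ x) ∈ grass (Φ x)) →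
      ∀ m : ℤ, (k : ℤ) + 1 ≤ m → dualCoeff (Φ q) m (cderiv e k σ q) = 0 := by
    intro k
    induction k with
    | zero =>
      intro q hq _ hWq
      rw [cderiv_zero e _ hq]
      exact (laurent_mem_grass_iff (h.mem q) 0 _).1 hWq.self_of_nhds
    | succ k ih =>
      intro q hq hσq hWq m hm
      have h1 : cderiv e (k + 1) σ q = cderiv e 1 (cderiv e k σ) q := by
        rw [cderiv_succ hq, cderiv, iteratedDeriv_one]
      rw [h1]
      refine h.dualCoeff_cderiv_one he hq (hσq.cderiv he hq k) (l := (k : ℤ) + 1) ?_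
        (by push_cast at hm; omega)
      filter_upwards [hσq.eventually, hWq.eventually_nhds, e.open_source.mem_nhds hq]
        with x h1 h2 h3
      exact ih x h3 h1 h2
  rw [laurent_mem_grass_iff (h.mem p)]
  exact fun m hm => key k p hp hσ hW m (by omega)

end Derivation

/-! ### Kernels of analytic matrices and global meromorphic frames -/

section MatrixRanges

variable {ι κ ν : Type*} [Fintype κ] [Fintype ν]

theorem exists_eq_mul_of_range_le {Z : Matrix ι κ ℂ} {V : Matrix ι ν ℂ}
    (h : LinearMap.range Z.mulVecLin ≤ LinearMap.range V.mulVecLin) :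
    ∃ C : Matrix ν κ ℂ, Z = V * C := by
  classical
  have h1 : ∀ j, ∃ c, V.mulVec c = Z.col j := fun j => by
    obtain ⟨c, hc⟩ := h ⟨Pi.single j 1, rfl⟩
    refine ⟨c, ?_⟩
    simpa using hc
  choose c hc using h1
  refine ⟨Matrix.of fun l j => c j l, ?_⟩
  ext i j
  have := congrFun (hc j) i
  simp only [Matrix.mulVec, dotProduct, Matrix.col_apply] at this
  simp only [Matrix.mul_apply, Matrix.of_apply]
  exact this.symm

theorem range_mul_le (V : Matrix ι ν ℂ) (C : Matrix ν κ ℂ) :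
    LinearMap.range (V * C).mulVecLin ≤ LinearMap.range V.mulVecLin := by
  rw [Matrix.mulVecLin_mul]
  exact LinearMap.range_comp_le_range _ _

theorem mulVec_injective_of_left_inverse [Fintype ι] [DecidableEq κ] {Λ : Matrix κ ι ℂ}
    {V : Matrix ι κ ℂ} (h : (Λ * V).det ≠ 0) : Function.Injective V.mulVec := by
  intro v w hvw
  have h1 : (Λ * V).mulVec v = (Λ * V).mulVec w := by
    rw [← Matrix.mulVec_mulVec, ← Matrix.mulVec_mulVec, hvw]
  exact Matrix.mulVec_injective_of_isUnit
    ((Matrix.isUnit_iff_isUnit_det _).2 (isUnit_iff_ne_zero.2 h)) h1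

end MatrixRanges

section AnalyticMatrices

variable {ι κ ν : Type*} {z₀ : ℂ}

theorem analyticAt_mul_entry [Fintype ν] {A : ℂ → Matrix ι ν ℂ} {B : ℂ → Matrix ν κ ℂ}
    (hA : ∀ a b, AnalyticAt ℂ (fun z => A z a b) z₀)
    (hB : ∀ a b, AnalyticAt ℂ (fun z => B z a b) z₀) (a : ι) (b : κ) :
    AnalyticAt ℂ (fun z => (A z * B z) a b) z₀ := by
  simp_rw [Matrix.mul_apply]
  exact Finset.analyticAt_fun_sum _ fun c _ => (hA a c).mul (hB c b)

theorem eventually_det_ne_zero_of_analyticAt [Fintype κ] [DecidableEq κ] {A : ℂ → Matrix κ κ ℂ}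
    (hA : ∀ a b, AnalyticAt ℂ (fun z => A z a b) z₀) (h : (A z₀).det ≠ 0) :
    ∀ᶠ z in 𝓝 z₀, (A z).det ≠ 0 := by
  have h1 : AnalyticAt ℂ (fun z => (A z).det) z₀ := det_mem_subring (analyticSubring z₀) hA
  exact h1.continuousAt.eventually_ne h

/-- The kernel of an analytic matrix is, off isolated points, the image of an analytic matrix. -/
theorem exists_analytic_kernel [Fintype ι] {k : ℕ} {B : ℂ → Matrix ι (Fin k) ℂ}
    (hB : ∀ a b, AnalyticAt ℂ (fun z => B z a b) z₀) :
    ∃ K : ℂ → Matrix (Fin k) (Fin k) ℂ, (∀ a b, AnalyticAt ℂ (fun z => K z a b) z₀) ∧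
      ∀ᶠ z in 𝓝[≠] z₀, LinearMap.range (K z).mulVecLin = LinearMap.ker (B z).mulVecLin := by
  classical
  obtain ⟨k', w, hw, hli, hspan⟩ := exists_analytic_frame z₀ (Fintype.card ι)
    (fun j z => B z ((Fintype.equivFin ι).symm j)) fun j => analyticAt_pi_iff.2 fun b => hB _ b
  obtain ⟨Λ, hΛ⟩ := exists_left_inverse_of_linearIndependent hli
  set W : ℂ → Matrix (Fin k') (Fin k) ℂ := fun z => Matrix.of fun i => w i z with hW
  have hWa : ∀ a b, AnalyticAt ℂ (fun z => W z a b) z₀ := fun a b => analyticAt_pi_iff.1 (hw a) b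
  have hWΛ : W z₀ * Λᵀ = 1 := by
    have := congrArg Matrix.transpose hΛ
    rwa [Matrix.transpose_mul, Matrix.transpose_transpose, Matrix.transpose_one] at this
  have hWΛa : ∀ a b, AnalyticAt ℂ (fun z => (W z * Λᵀ) a b) z₀ :=
    analyticAt_mul_entry (B := fun _ => Λᵀ) hWa fun a b => analyticAt_const
  have hdet : (W z₀ * Λᵀ).det ≠ 0 := by rw [hWΛ]; simp
  -- W frames the row space of B, hence has the same kernel off z₀; since WΛᵀ is invertible near z₀,
  -- this matrix is an analytic projection onto ker W.
  refine ⟨fun z => 1 - Λᵀ * (W z * Λᵀ)⁻¹ * W z, fun a b => ?_, ?_⟩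
  · have h1 := analyticAt_mul_entry (A := fun _ => Λᵀ) (fun a b => analyticAt_const)
      (analyticAt_inv_entry hWΛa hdet)
    exact AnalyticAt.sub (f := fun _ => (1 : Matrix (Fin k) (Fin k) ℂ) a b) analyticAt_const
      (analyticAt_mul_entry h1 hWa a b)
  · filter_upwards [hspan, nhdsWithin_le_nhds (eventually_det_ne_zero_of_analyticAt hWΛa hdet)]
      with z h1 h2
    have hker : ∀ x, (B z).mulVec x = 0 ↔ (W z).mulVec x = 0 := by
      intro x
      set f : (Fin k → ℂ) →ₗ[ℂ] ℂ := dotProductBilin ℂ ℂ |>.flip x with hf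
      have hfx : ∀ v, f v = v ⬝ᵥ x := fun v => rfl
      have h3 : ∀ {τ : Type} (v : τ → Fin k → ℂ), (∀ j, v j ⬝ᵥ x = 0) ↔
          Submodule.span ℂ (Set.range v) ≤ LinearMap.ker f := by
        intro τ v
        rw [Submodule.span_le]
        constructor
        · rintro h _ ⟨j, rfl⟩
          exact h j
        · exact fun h j => h ⟨j, rfl⟩
      have h4 : (B z).mulVec x = 0 ↔ ∀ j, B z ((Fintype.equivFin ι).symm j) ⬝ᵥ x = 0 := by
        rw [funext_iff]
        exact ((Fintype.equivFin ι).symm.forall_congr_right (q := fun i => B z i ⬝ᵥ x = 0)).symm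
      rw [h4, h3, h1, ← h3, funext_iff]
      rfl
    have hu : IsUnit (W z * Λᵀ).det := isUnit_iff_ne_zero.2 h2
    ext x
    rw [LinearMap.mem_ker, Matrix.mulVecLin_apply, hker]
    constructor
    · rintro ⟨y, rfl⟩
      rw [Matrix.mulVecLin_apply, Matrix.mulVec_mulVec, Matrix.mul_sub, Matrix.mul_one,
        ← Matrix.mul_assoc, ← Matrix.mul_assoc, Matrix.mul_nonsing_inv _ hu, Matrix.one_mul,
        sub_self, Matrix.zero_mulVec]
    · intro h
      refine ⟨x, ?_⟩
      rw [Matrix.mulVecLin_apply, Matrix.sub_mulVec, Matrix.one_mulVec, ← Matrix.mulVec_mulVec, h,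
        Matrix.mulVec_zero, sub_zero]

end AnalyticMatrices

/-! ### Global meromorphic frames by normalisation -/

section GlobalFrames

variable {M : Type*} [TopologicalSpace M] [ChartedSpace ℂ M] {N : Type*} [Fintype N]

theorem meromorphicAt_inv_entry {k : ℕ} {z₀ : ℂ} {G : ℂ → Matrix (Fin k) (Fin k) ℂ}
    (hG : ∀ a b, AnalyticAt ℂ (fun z => G z a b) z₀) (a b : Fin k) :
    MeromorphicAt (fun z => (G z)⁻¹ a b) z₀ := by
  have h1 : AnalyticAt ℂ (fun z => (G z).det) z₀ := det_mem_subring (analyticSubring z₀) hG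
  have h2 : AnalyticAt ℂ (fun z => (G z).adjugate a b) z₀ :=
    adjugate_mem_subring (analyticSubring z₀) hG a b
  simp_rw [Matrix.inv_def, Matrix.smul_apply, Ring.inverse_eq_inv', smul_eq_mul]
  exact h1.meromorphicAt.inv.mul h2.meromorphicAt

/-- A family of subspaces which locally has analytic spanning sets off isolated points has a global
meromorphic spanning set. -/
theorem exists_meromorphic_spanning [T1Space M] [ConnectedSpace M]
    (Y : M → Submodule ℂ (N → ℂ))
    (hY : ∀ p, ∃ (m : ℕ) (V : ℂ → Matrix N (Fin m) ℂ),
      (∀ a b, AnalyticAt ℂ (fun z => V z a b) (chartAt ℂ p p)) ∧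
      ∀ᶠ z in 𝓝[≠] (chartAt ℂ p p), Y ((chartAt ℂ p).symm z) = LinearMap.range (V z).mulVecLin) :
    ∃ (k : ℕ) (L : M → Matrix N (Fin k) ℂ),
      (∀ a b p, MeromorphicAt (fun z => L ((chartAt ℂ p).symm z) a b) (chartAt ℂ p p)) ∧
      ∀ᶠ p in codiscrete M, LinearMap.range (L p).mulVecLin = Y p := by
  classical
  have hY' : ∀ p, ∃ (m : ℕ) (V : ℂ → Matrix N (Fin m) ℂ) (Λ : Matrix (Fin m) N ℂ),
      (∀ a b, AnalyticAt ℂ (fun z => V z a b) (chartAt ℂ p p)) ∧ Λ * V (chartAt ℂ p p) = 1 ∧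
      ∀ᶠ z in 𝓝[≠] (chartAt ℂ p p),
        LinearMap.range (V z).mulVecLin = Y ((chartAt ℂ p).symm z) := by
    intro p
    obtain ⟨m, V, hV, hr⟩ := hY p
    obtain ⟨k, w, hw, hli, hspan⟩ := exists_analytic_frame (chartAt ℂ p p) m
      (fun j z i => V z i j) fun j => analyticAt_pi_iff.2 fun i => hV i j
    obtain ⟨Λ, hΛ⟩ := exists_left_inverse_of_linearIndependent hli
    refine ⟨k, fun z => (Matrix.of fun i => w i z)ᵀ, Λ, fun a b => analyticAt_pi_iff.1 (hw b) a,
      hΛ, ?_⟩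
    filter_upwards [hr, hspan] with z h1 h2
    rw [h1, Matrix.range_mulVecLin, Matrix.range_mulVecLin]
    exact h2.symm
  choose k V Λ hV hΛ hr using hY'
  obtain ⟨p₀⟩ := (inferInstance : Nonempty M)
  -- A spanning matrix Z of Y q normalised by ΛZ = 1, with Λ fixed at one base point, is unique when
  -- it exists. Uniqueness is what makes local frames fit together.
  set Iso : M → Prop := fun q => ∃ Z : Matrix N (Fin (k p₀)) ℂ, Λ p₀ * Z = 1 ∧
    LinearMap.range Z.mulVecLin = Y q with hIso
  have hVinj : ∀ p, ∀ᶠ z in 𝓝 (chartAt ℂ p p), Function.Injective (V p z).mulVec := by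
    intro p
    filter_upwards [eventually_det_ne_zero_of_analyticAt
      (analyticAt_mul_entry (fun a b => analyticAt_const (v := Λ p a b)) (hV p))
      (by rw [hΛ]; simp)] with z hz
    exact mulVec_injective_of_left_inverse hz
  have hdim : ∀ {m : ℕ} {A : Matrix N (Fin m) ℂ}, Function.Injective A.mulVec →
      Module.finrank ℂ (LinearMap.range A.mulVecLin) = m := by
    intro m A hA
    rw [LinearMap.finrank_range_of_inj hA, Module.finrank_fin_fun]
  have hZinj : ∀ {Z : Matrix N (Fin (k p₀)) ℂ}, Λ p₀ * Z = 1 → Function.Injective Z.mulVec :=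
    fun h => mulVec_injective_of_left_inverse (by rw [h]; simp)
  -- For a local analytic frame A, a normalised matrix exists exactly where A has the right number
  -- of columns and det(ΛA) ≠ 0; the analytic determinant is generically zero or generically
  -- nonzero.
  have hdk : ∀ p, (∀ᶠ z in 𝓝[≠] (chartAt ℂ p p), Iso ((chartAt ℂ p).symm z)) ∨
      ∀ᶠ z in 𝓝[≠] (chartAt ℂ p p), ¬ Iso ((chartAt ℂ p).symm z) := by
    intro p
    have hVp := hV p
    have hrp := hr p
    have hip := (hVinj p).filter_mono (nhdsWithin_le_nhds (s := {chartAt ℂ p p}ᶜ))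
    generalize V p = A at hVp hrp hip
    generalize k p = m at A
    by_cases hm : m = k p₀
    · subst hm
      have hd : AnalyticAt ℂ (fun z => (Λ p₀ * A z).det) (chartAt ℂ p p) :=
        det_mem_subring (analyticSubring _)
          (analyticAt_mul_entry (fun a b => analyticAt_const (v := Λ p₀ a b)) hVp)
      rcases hd.eventually_eq_zero_or_eventually_ne_zero with h0 | h0
      · right
        filter_upwards [h0.filter_mono nhdsWithin_le_nhds, hrp, hip] with z h1 h2 h3
        rintro ⟨Z, hZ, hZr⟩
        obtain ⟨C, hC⟩ := exists_eq_mul_of_range_le (hZr.trans h2.symm).le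
        have h4 : (Λ p₀ * A z) * C = 1 := by rw [Matrix.mul_assoc, ← hC, hZ]
        have h5 := congrArg Matrix.det h4
        rw [Matrix.det_mul, h1, zero_mul, Matrix.det_one] at h5
        exact zero_ne_one h5
      · left
        filter_upwards [h0, hrp] with z h1 h2
        have hu : IsUnit (Λ p₀ * A z).det := isUnit_iff_ne_zero.2 h1
        refine ⟨A z * (Λ p₀ * A z)⁻¹, ?_, ?_⟩
        · rw [← Matrix.mul_assoc, Matrix.mul_nonsing_inv _ hu]
        · rw [← h2]
          refine le_antisymm (range_mul_le _ _) ?_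
          conv_lhs => rw [← Matrix.mul_one (A z), ← Matrix.nonsing_inv_mul _ hu, ← Matrix.mul_assoc]
          exact range_mul_le _ _
    · right
      filter_upwards [hrp, hip] with z h2 h3
      rintro ⟨Z, hZ, hZr⟩
      apply hm
      rw [← hdim h3, ← hdim (hZinj hZ), hZr, h2]
  -- The local dichotomy propagates over the connected surface, and at the base point the favourable
  -- alternative holds because ΛV = 1 there.
  have hgen : ∀ᶠ p in codiscrete M, Iso p := by
    refine (eventually_codiscrete_or (fun p => nhdsNE_neBot p) fun p => ?_).resolve_right ?_
    · rw [← eventually_nhdsNE_chart (mem_chart_source ℂ p),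
        ← eventually_nhdsNE_chart (mem_chart_source ℂ p)]
      exact hdk p
    · intro hnot
      have h1 := (eventually_nhdsNE_chart (mem_chart_source ℂ p₀)).2
        (eventually_codiscrete_iff.1 hnot p₀)
      have h2 : ∀ᶠ z in 𝓝[≠] (chartAt ℂ p₀ p₀), Iso ((chartAt ℂ p₀).symm z) := by
        have hd := eventually_det_ne_zero_of_analyticAt
          (analyticAt_mul_entry (fun a b => analyticAt_const (v := Λ p₀ a b)) (hV p₀))
          (by rw [hΛ]; simp)
        filter_upwards [hd.filter_mono nhdsWithin_le_nhds, hr p₀] with z h1 h2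
        have hu : IsUnit (Λ p₀ * V p₀ z).det := isUnit_iff_ne_zero.2 h1
        refine ⟨V p₀ z * (Λ p₀ * V p₀ z)⁻¹, ?_, ?_⟩
        · rw [← Matrix.mul_assoc, Matrix.mul_nonsing_inv _ hu]
        · rw [← h2]
          refine le_antisymm (range_mul_le _ _) ?_
          conv_lhs => rw [← Matrix.mul_one (V p₀ z), ← Matrix.nonsing_inv_mul _ hu,
            ← Matrix.mul_assoc]
          exact range_mul_le _ _
      obtain ⟨z, hz1, hz2⟩ := (h1.and h2).exists
      exact hz1 hz2
  have hL : ∀ q, ∃ Z : Matrix N (Fin (k p₀)) ℂ, Iso q → Λ p₀ * Z = 1 ∧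
      LinearMap.range Z.mulVecLin = Y q := by
    intro q
    by_cases h : Iso q
    · obtain ⟨Z, hZ⟩ := h
      exact ⟨Z, fun _ => hZ⟩
    · exact ⟨0, fun h' => (h h').elim⟩
  choose L hL using hL
  refine ⟨k p₀, L, fun a b p => ?_, hgen.mono fun p hp => (hL p hp).2⟩
  have hIp := (eventually_nhdsNE_chart (mem_chart_source ℂ p)).2 (eventually_codiscrete_iff.1 hgen p)
  have hVp := hV p
  have hrp := hr p
  have hip := (hVinj p).filter_mono (nhdsWithin_le_nhds (s := {chartAt ℂ p p}ᶜ))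
  generalize V p = A at hVp hrp hip
  generalize k p = m at A
  obtain rfl : m = k p₀ := by
    obtain ⟨z, ⟨Z, hZ, hZr⟩, h2, h3⟩ := (hIp.and (hrp.and hip)).exists
    rw [← hdim h3, ← hdim (hZinj hZ), hZr, h2]
  -- By uniqueness the global frame is locally A(ΛA)⁻¹, with poles at most at zeros of the
  -- determinant.
  have hmero : MeromorphicAt (fun z => (A z * (Λ p₀ * A z)⁻¹) a b) (chartAt ℂ p p) := by
    simp_rw [Matrix.mul_apply (M := A _)]
    exact MeromorphicAt.fun_sum fun c _ => (hVp a c).meromorphicAt.mul (meromorphicAt_inv_entry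
      (analyticAt_mul_entry (fun a b => analyticAt_const (v := Λ p₀ a b)) hVp) c b)
  refine hmero.congr ?_
  filter_upwards [hIp, hrp] with z h1 h2
  obtain ⟨h3, h4⟩ := hL _ h1
  obtain ⟨C, hC⟩ := exists_eq_mul_of_range_le (h4.trans h2.symm).le
  have h5 : (Λ p₀ * A z) * C = 1 := by rw [Matrix.mul_assoc, ← hC, h3]
  rw [Matrix.inv_eq_right_inv h5, ← hC]

end GlobalFrames

/-! ### The holomorphic bundle defined by the Grassmannian model -/

section GrassBundle

variable {n r : ℕ} {γ : Circle → Mat n}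

theorem exists_injective_matrix_range {ι κ : Type*} [Fintype ι] [Fintype κ] (Q : Matrix ι κ ℂ) :
    ∃ (k : ℕ) (B : Matrix ι (Fin k) ℂ), Function.Injective B.mulVec ∧
      LinearMap.range B.mulVecLin = LinearMap.range Q.mulVecLin := by
  obtain ⟨f, -, hf, hli⟩ := Submodule.exists_fun_fin_finrank_span_eq ℂ
    (LinearMap.range Q.mulVecLin : Set (ι → ℂ))
  refine ⟨_, Matrix.of fun x i => f i x, ?_, ?_⟩
  · rw [Matrix.mulVec_injective_iff]
    exact hli
  · rw [Matrix.range_mulVecLin]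
    exact hf.trans (Submodule.span_eq _)

/-- Vectors in block form. -/
def toCoef (r n : ℕ) : (Fin r × Fin n → ℂ) ≃ₗ[ℂ] Coef r n where
  toFun x a := WithLp.toLp 2 fun i => x (a, i)
  invFun v x := v x.1 x.2
  map_add' _ _ := rfl
  map_smul' _ _ := rfl
  left_inv _ := rfl
  right_inv _ := rfl

/-- The subspace of `ℂ^{rn} ≅ H₊ / λ^r H₊` given by `γ H₊`. -/
def grassCoef (r : ℕ) (γ : Circle → Mat n) : Submodule ℂ (Coef r n) :=
  (grass γ).comap (laurentL r n 0)

theorem mem_grassCoef {v : Coef r n} : v ∈ grassCoef r γ ↔ laurent 0 v ∈ grass γ := Iff.rfl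

/-- Both sides say that the adjoint of the Hankel matrix kills the vector: its blocks are the
obstructions `dualCoeff` in degrees 1 to r, and those of higher degree vanish since γ has degree r.
-/
theorem toCoef_mem_grassCoef (hγ : γ ∈ OmegaPoly r n) {x : Fin r × Fin n → ℂ} :
    toCoef r n x ∈ grassCoef r γ ↔ x ∈ LinearMap.range (grassProj r γ).mulVecLin := by
  have h1 : toCoef r n x ∈ grassCoef r γ ↔ (hank r γ)ᴴ.mulVec x = 0 := by
    rw [mem_grassCoef, laurent_mem_grass_iff hγ, funext_iff]
    have key : ∀ (a : Fin r) (i : Fin n), (hank r γ)ᴴ.mulVec x (a, i) =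
        dualCoeff γ ((a : ℕ) + 1 : ℤ) (toCoef r n x) i () := by
      intro a i
      simp only [Matrix.mulVec, dotProduct, Fintype.sum_prod_type, dualCoeff, Matrix.sum_apply,
        Matrix.mul_apply]
      refine Finset.sum_congr rfl fun c _ => Finset.sum_congr rfl fun j _ => ?_
      rw [← add_assoc]
      rfl
    constructor
    · rintro h ⟨a, i⟩
      rw [key, h _ (by omega)]
      rfl
    · intro h m hm
      by_cases hmr : m ≤ r
      · ext i j
        have := key ⟨(m - 1).toNat, by omega⟩ i
        rw [h] at this
        simp only [Int.toNat_of_nonneg (show 0 ≤ m - 1 by omega),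
          sub_add_cancel] at this
        exact this.symm
      · refine Finset.sum_eq_zero fun c _ => ?_
        rw [OmegaPoly.coeff_eq_zero hγ (by omega), Matrix.conjTranspose_zero, Matrix.zero_mul]
  rw [h1]
  constructor
  · intro h
    refine ⟨x, ?_⟩
    rw [Matrix.mulVecLin_apply, grassProj_eq hγ le_rfl, Matrix.sub_mulVec, Matrix.one_mulVec,
      ← Matrix.mulVec_mulVec, h, Matrix.mulVec_zero, sub_zero]
  · rintro ⟨y, rfl⟩
    rw [Matrix.mulVecLin_apply, Matrix.mulVec_mulVec, hank_mul_grassProj hγ le_rfl,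
      Matrix.zero_mulVec]

theorem grassCoef_eq_map (hγ : γ ∈ OmegaPoly r n) :
    grassCoef r γ = (LinearMap.range (grassProj r γ).mulVecLin).map (toCoef r n).toLinearMap := by
  ext v
  obtain ⟨x, rfl⟩ := (toCoef r n).surjective v
  rw [toCoef_mem_grassCoef hγ]
  constructor
  · exact fun h => ⟨x, h, rfl⟩
  · rintro ⟨y, hy, hxy⟩
    rwa [← (toCoef r n).injective hxy]

/-- The projection onto the coefficients of degree less than `u`. -/
def lowProj (r n u : ℕ) : Matrix (Fin r × Fin n) (Fin r × Fin n) ℂ :=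
  Matrix.diagonal fun x => if (x.1 : ℕ) < u then 1 else 0

theorem lowProj_mulVec_eq_zero {u : ℕ} {x : Fin r × Fin n → ℂ} :
    (lowProj r n u).mulVec x = 0 ↔ ∀ m : ℕ, m < u → coeff (toCoef r n x) m = 0 := by
  rw [funext_iff]
  constructor
  · intro h m hm
    rw [coeff]
    split_ifs with h1
    · ext i
      have := h (⟨m, by simpa using h1.2⟩, i)
      rw [lowProj, Matrix.mulVec_diagonal, if_pos hm, one_mul] at this
      exact this
    · rfl
  · rintro h ⟨a, i⟩
    rw [lowProj, Matrix.mulVec_diagonal]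
    split_ifs with h1
    · have := h a h1
      rw [coeff_fin] at this
      rw [one_mul]
      exact congrArg (fun w : E n => w i) this
    · rw [zero_mul]
      rfl

end GrassBundle

/-! ### W modulo λ^r H₊ as a holomorphic bundle over the surface -/

section GrassBundleSurface

variable {M : Type*} [TopologicalSpace M] [ChartedSpace ℂ M] {n r : ℕ}
  {Φ : M → Circle → Mat n} {e : OpenPartialHomeomorph M ℂ} {p : M}

/-- The holomorphic family s of `exists_holomorphic_frame` maps W_p isomorphically onto W_q; it is
applied to a fixed basis of W_p. -/
theorem PolySolution.exists_grass_frame (h : PolySolution r Φ)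
    (he : e ∈ IsManifold.maximalAtlas 𝓘(ℂ) ω M) (hp : p ∈ e.source) :
    ∃ (k : ℕ) (V : M → Matrix (Fin r × Fin n) (Fin k) ℂ),
      (∀ a b, HolAt (fun q => V q a b) p) ∧ ∀ᶠ q in 𝓝 p, Function.Injective (V q).mulVec ∧
        LinearMap.range (V q).mulVecLin = LinearMap.range (grassProj r (Φ q)).mulVecLin := by
  obtain ⟨s, -, hs⟩ := h.exists_holomorphic_frame le_rfl he hp
  set Q := grassProj r (Φ p) with hQ
  obtain ⟨k, B, hBi, hBr⟩ := exists_injective_matrix_range Q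
  obtain ⟨C, hC⟩ := exists_eq_mul_of_range_le hBr.le
  obtain ⟨C', hC'⟩ := exists_eq_mul_of_range_le hBr.ge
  have hQB : Q * B = B := by
    rw [hC, ← Matrix.mul_assoc, grassProj_mul_self (h.mem p) le_rfl]
  refine ⟨k, fun q => s q * B, fun a b => ?_, ?_⟩
  · filter_upwards [hs, e.open_source.mem_nhds hp] with q h1 h2
    rw [mdifferentiableAt_iff_chart he h2, differentiableAt_complex_iff]
    refine ⟨(h1.1.mul (matSmoothAt_const B)).matDiffAt he h2 a b, ?_⟩
    have := ddM_mul_const (c := Complex.I) B (h1.1.matDiffAt he h2) h2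
    rw [h1.2.1, Matrix.zero_mul] at this
    exact congrFun (congrFun this a) b
  · filter_upwards [hs] with q ⟨_, _, h3, h4, h5, h6⟩
    constructor
    · intro v w hvw
      have h7 := congrArg Q.mulVec hvw
      rw [Matrix.mulVec_mulVec, Matrix.mulVec_mulVec, ← Matrix.mul_assoc, h5, hQB] at h7
      exact hBi h7
    · apply le_antisymm
      · rw [← h3, Matrix.mul_assoc]
        exact range_mul_le _ _
      · have h7 : grassProj r (Φ q) = s q * B * (C' * grassProj r (Φ q)) := by
          rw [Matrix.mul_assoc, ← Matrix.mul_assoc B, ← hC', ← Matrix.mul_assoc, h6, h4]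
        rw [h7]
        exact range_mul_le _ _

theorem PolySolution.isHolomorphicSubbundle [IsManifold 𝓘(ℂ) ω M] (h : PolySolution r Φ) :
    IsHolomorphicSubbundle fun p => grassCoef r (Φ p) := by
  intro p
  have hp := mem_chart_source ℂ p
  have he := chartAt_mem p
  obtain ⟨k, V, hV, hVr⟩ := h.exists_grass_frame he hp
  have hV' : ∀ᶠ q in 𝓝 p, ∀ a b, MDifferentiableAt 𝓘(ℂ) 𝓘(ℂ, ℂ) (fun q => V q a b) q :=
    eventually_all.2 fun a => eventually_all.2 fun b => hV a b
  obtain ⟨U, hU, hUo, hpU⟩ := eventually_nhds_iff.1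
    (hV'.and (hVr.and ((chartAt ℂ p).open_source.mem_nhds hp)))
  refine ⟨U, hUo, hpU, k, fun i q => toCoef r n fun x => V q x i, fun i q hq => ?_, fun q hq => ?_⟩
  · obtain ⟨h1, -, h3⟩ := hU q hq
    apply MDifferentiableAt.mdifferentiableWithinAt
    rw [mdifferentiableAt_iff_chart he h3]
    have h4 : DifferentiableAt ℂ (fun z x => V ((chartAt ℂ p).symm z) x i) (chartAt ℂ p q) :=
      differentiableAt_pi.2 fun x => (mdifferentiableAt_iff_chart he h3).1 (h1 x i)
    exact (toCoef r n).toContinuousLinearEquiv.differentiableAt.comp _ h4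
  · obtain ⟨-, ⟨h1, h2⟩, -⟩ := hU q hq
    constructor
    · exact ((Matrix.mulVec_injective_iff.1 h1)).map' (toCoef r n).toLinearMap
        (LinearEquiv.ker (toCoef r n))
    · beta_reduce
      rw [grassCoef_eq_map (h.mem q), ← h2, Matrix.range_mulVecLin, Submodule.map_span,
        ← Set.range_comp]
      rfl

/-- W / λ^r H₊ generates W: its own sections already give all of W with k = 0, and the further terms
λ^k ∂^k stay inside W. -/
theorem PolySolution.generates [IsManifold 𝓘(ℂ) ω M] (h : PolySolution r Φ) :
    Generates (fun p => grassCoef r (Φ p)) fun p => grass (Φ p) := by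
  refine Eventually.of_forall fun p => le_antisymm ?_ (sup_le ?_ (OmegaPoly.le_grass (h.mem p)))
  · intro f hf
    have h1 := sub_laurent_mem f (OmegaPoly.grass_le (h.mem p) hf) r
    rw [← sub_add_cancel f (laurent 0 fun c : Fin r => P ((c : ℕ) : ℤ) f), add_comm]
    refine Submodule.add_mem_sup ?_ h1
    set v : Coef r n := fun c : Fin r => P ((c : ℕ) : ℤ) f
    have hv : v ∈ grassCoef r (Φ p) := by
      rw [mem_grassCoef, ← sub_sub_cancel f (laurent 0 v)]
      exact Submodule.sub_mem _ hf (OmegaPoly.le_grass (h.mem p) h1)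
    -- For r = 0 no index k < r is available, but then the coefficient vector is zero anyway.
    rcases Nat.eq_zero_or_pos r with hr | hr
    · subst hr
      have : v = 0 := Subsingleton.elim _ _
      rw [this, ← laurentL_apply, map_zero]
      exact Submodule.zero_mem _
    · refine Submodule.subset_span ⟨0, hr, v, ?_, rfl⟩
      obtain ⟨U, hUo, hpU, k, f, hf, hfU⟩ := h.isHolomorphicSubbundle p
      have hspan := (hfU p hpU).2
      beta_reduce at hspan
      rw [hspan] at hv
      obtain ⟨c, hc⟩ := (Submodule.mem_span_range_iff_exists_fun ℂ).1 hv
      refine Submodule.subset_span ⟨chartAt ℂ p, chartAt_mem p, mem_chart_source ℂ p, U, hUo, hpU,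
        fun q => ∑ i, c i • f i q, fun q hq => ?_, fun q hq => ?_, 0, le_rfl, ?_⟩
      · have h2 := MDifferentiableWithinAt.sum (t := Finset.univ)
          fun i _ => (hf i q hq).const_smul (c i)
        have h3 : (fun q => ∑ i, c i • f i q) = ∑ i, c i • f i := by
          ext1 q
          simp only [Finset.sum_apply, Pi.smul_apply]
        rwa [h3]
      · have hspan := (hfU q hq).2
        beta_reduce at hspan
        beta_reduce
        rw [hspan]
        exact Submodule.sum_mem _ fun i _ =>
          Submodule.smul_mem _ _ (Submodule.subset_span ⟨i, rfl⟩)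
      · rw [cderiv_zero _ _ (mem_chart_source ℂ p), hc]
  · rw [Submodule.span_le]
    rintro _ ⟨k, -, v, hv, rfl⟩
    have h1 : osculating (fun p => grassCoef r (Φ p)) k p ≤ (grass (Φ p)).comap (laurentL r n k) := by
      rw [osculating, Submodule.span_le]
      rintro _ ⟨e, he, hp, U, hUo, hpU, σ, hσ, hσX, l, hl, rfl⟩
      refine h.laurent_cderiv_mem he hp ?_ ?_ hl
      · filter_upwards [hUo.mem_nhds hpU] with q hq
        exact (hσ q hq).mdifferentiableAt (hUo.mem_nhds hq)
      · filter_upwards [hUo.mem_nhds hpU] with q hq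
        exact hσX q hq
    exact h1 hv

/-- Meromorphic sections spanning the elements of `W ∩ λ^u H₊`. -/
theorem PolySolution.exists_meromorphic_low [T1Space M] [ConnectedSpace M] [IsManifold 𝓘(ℂ) ω M]
    (h : PolySolution r Φ) (u : ℕ) : ∃ (k : ℕ) (L : Fin k → M → Coef r n),
      (∀ j, IsMeromorphic (L j)) ∧ ∀ᶠ p in codiscrete M, ∀ v : Coef r n,
        v ∈ Submodule.span ℂ (Set.range fun j => L j p) ↔
          v ∈ grassCoef r (Φ p) ∧ ∀ m : ℕ, m < u → coeff v m = 0 := by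
  obtain ⟨k, L, hL, hr⟩ := exists_meromorphic_spanning
    (fun p => LinearMap.range (grassProj r (Φ p)).mulVecLin ⊓
      LinearMap.ker (lowProj r n u).mulVecLin) fun p => by
    obtain ⟨m, V, hV, hVr⟩ := h.exists_grass_frame (chartAt_mem p) (mem_chart_source ℂ p)
    have hVa : ∀ a b, AnalyticAt ℂ (fun z => V ((chartAt ℂ p).symm z) a b) (chartAt ℂ p p) :=
      fun a b => (holAt_iff (chartAt_mem p) (mem_chart_source ℂ p)).1 (hV a b)
    -- In terms of a frame V of W, the elements of W ∩ λ^u H₊ are Vx with x in the kernel of the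
    -- low-degree part of V.
    obtain ⟨K, hK, hKr⟩ := exists_analytic_kernel
      (analyticAt_mul_entry (A := fun _ => lowProj r n u) (fun a b => analyticAt_const) hVa)
    refine ⟨m, fun z => V ((chartAt ℂ p).symm z) * K z, analyticAt_mul_entry hVa hK, ?_⟩
    filter_upwards [hKr, nhdsWithin_le_nhds
      ((eventually_nhds_chart (mem_chart_source ℂ p)).2 hVr)] with z h1 h2
    rw [← h2.2, Matrix.mulVecLin_mul, LinearMap.range_comp, h1, Matrix.mulVecLin_mul,
      LinearMap.ker_comp, Submodule.map_comap_eq]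
  refine ⟨k, fun j q => toCoef r n fun x => L q x j, fun j p => ?_, ?_⟩
  · have h1 : (fun q => toCoef r n fun x => L q x j) ∘ (chartAt ℂ p).symm =
        fun z => ∑ x, L ((chartAt ℂ p).symm z) x j • toCoef r n (Pi.single x 1) := by
      ext1 z
      rw [Function.comp_apply, ← LinearEquiv.coe_toLinearMap, LinearMap.pi_apply_eq_sum_univ]
      refine Finset.sum_congr rfl fun x _ => ?_
      congr 2
      ext y
      simp [Pi.single_apply, eq_comm]
    rw [h1]
    exact MeromorphicAt.fun_sum fun x _ => (hL x j p).smul (MeromorphicAt.const _ _)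
  · filter_upwards [hr] with p hp v
    obtain ⟨x, rfl⟩ := (toCoef r n).surjective v
    rw [toCoef_mem_grassCoef (h.mem p), ← lowProj_mulVec_eq_zero]
    have h1 : Submodule.span ℂ (Set.range fun j => toCoef r n fun x => L p x j) =
        (LinearMap.range (L p).mulVecLin).map (toCoef r n).toLinearMap := by
      rw [Matrix.range_mulVecLin, Submodule.map_span, ← Set.range_comp]
      rfl
    rw [h1, hp]
    constructor
    · rintro ⟨y, hy, hxy⟩
      rwa [← (toCoef r n).injective hxy]
    · exact fun h => ⟨x, h, rfl⟩

end GrassBundleSurface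

/-! ### Orders of meromorphic sections -/

section Orders

variable {M : Type*} [TopologicalSpace M] {n r m : ℕ}

theorem exists_hasOrder {L : M → Coef r n} (h : ¬ ∀ᶠ p in codiscrete M, L p = 0) :
    ∃ o, HasOrder L o := by
  classical
  have h1 : ∃ o : ℕ, ¬ ∀ᶠ p in codiscrete M, coeff (L p) o = 0 := by
    by_contra! hcon
    apply h
    have h2 : ∀ᶠ p in codiscrete M, ∀ c : Fin r, coeff (L p) ((c : ℕ) : ℤ) = 0 :=
      eventually_all.2 fun c => hcon c
    filter_upwards [h2] with p hp
    ext1 c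
    rw [← coeff_fin (L p) c, hp c]
    rfl
  exact ⟨Nat.find h1, fun i hi => not_not.1 (Nat.find_min h1 hi), Nat.find_spec h1⟩

/-- Coefficients of index at least r vanish identically, so only finitely many generic conditions
have to hold at once. -/
theorem eventually_coeff_vanish (L : Fin m → M → Coef r n) : ∀ᶠ p in codiscrete M,
    ∀ (j : Fin m) (i : ℕ), (∀ᶠ x in codiscrete M, coeff (L j x) i = 0) →
      ∀ᶠ q in 𝓝 p, coeff (L j q) i = 0 := by
  have h1 : ∀ᶠ p in codiscrete M, ∀ (j : Fin m) (i : Fin r),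
      (∀ᶠ x in codiscrete M, coeff (L j x) ((i : ℕ) : ℤ) = 0) →
      ∀ᶠ q in 𝓝 p, coeff (L j q) ((i : ℕ) : ℤ) = 0 := by
    refine eventually_all.2 fun j => eventually_all.2 fun i => ?_
    by_cases h : ∀ᶠ x in codiscrete M, coeff (L j x) ((i : ℕ) : ℤ) = 0
    · exact (eventually_codiscrete_eventually_nhds h).mono fun p hp _ => hp
    · exact Eventually.of_forall fun p hp => (h hp).elim
  filter_upwards [h1] with p hp j i hi
  by_cases hir : i < r
  · exact hp j ⟨i, hir⟩ hi
  · refine Eventually.of_forall fun q => ?_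
    rw [coeff, dif_neg (by omega)]

theorem eventually_zero_of_not_hasOrder (L : Fin m → M → Coef r n) : ∀ᶠ p in codiscrete M,
    ∀ j, (¬ ∃ o, HasOrder (L j) o) → ∀ᶠ q in 𝓝 p, L j q = 0 := by
  refine eventually_all.2 fun j => ?_
  by_cases h : ∃ o, HasOrder (L j) o
  · exact Eventually.of_forall fun p hp => (hp h).elim
  · have h1 : ∀ᶠ p in codiscrete M, L j p = 0 := by
      by_contra hcon
      exact h (exists_hasOrder hcon)
    exact (eventually_codiscrete_eventually_nhds h1).mono fun p hp _ => hp

end Orders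

/-! ### Existence of adapted spanning sets -/

section Adapted

variable {M : Type*} [TopologicalSpace M] [ChartedSpace ℂ M] [IsManifold 𝓘(ℂ) ω M] {n r m : ℕ}
  {Φ : M → Circle → Mat n}

omit [IsManifold 𝓘(ℂ) ω M] in
theorem coeff_cderiv_eq_zero {L : M → Coef r n} {e : OpenPartialHomeomorph M ℂ} {p : M}
    (he : e ∈ IsManifold.maximalAtlas 𝓘(ℂ) ω M) (hp : p ∈ e.source) (hL : HolAt L p) {i : ℤ}
    (h : ∀ᶠ q in 𝓝 p, coeff (L q) i = 0) (k : ℕ) : coeff (cderiv e k L p) i = 0 := by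
  rw [← coeffL_apply, ← cderiv_clm he hp hL, cderiv_congr hp (g := fun _ => 0), cderiv_zero_fun]
  filter_upwards [h] with q hq
  rw [coeffL_apply, hq]

/-- A subfamily J that lies in λ^u H₊ and spans W ∩ λ^u H₊ modulo λ^r H₊ already yields everything
with k = l = 0; all other admissible generators lie in W ∩ λ^u H₊ by closure under λ∂_z and by their
order. -/
theorem PolySolution.isAdapted (h : PolySolution r Φ) {L : Fin m → M → Coef r n}
    (hL : ∀ j, IsMeromorphic (L j))
    (hmem : ∀ j, ∀ᶠ p in codiscrete M, L j p ∈ grassCoef r (Φ p)) {u : ℕ} (J : Set (Fin m))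
    (hJ : ∀ j ∈ J, ∀ i : ℕ, i < u → ∀ᶠ p in codiscrete M, coeff (L j p) i = 0)
    (hspan : ∀ᶠ p in codiscrete M, ∀ v : Coef r n, v ∈ grassCoef r (Φ p) →
      (∀ m : ℕ, m < u → coeff v m = 0) → v ∈ Submodule.span ℂ ((fun j => L j p) '' J)) (hu : u ≤ r) :
    IsAdapted (fun p => grass (Φ p)) L u := by
  have h1 : ∀ᶠ p in codiscrete M, ∀ j, HolAt (L j) p :=
    eventually_all.2 fun j => (hL j).eventually_holAt
  have h2 : ∀ᶠ p in codiscrete M, ∀ j, ∀ᶠ q in 𝓝 p, L j q ∈ grassCoef r (Φ q) :=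
    eventually_all.2 fun j => eventually_codiscrete_eventually_nhds (hmem j)
  filter_upwards [h1, h2, eventually_coeff_vanish L, eventually_zero_of_not_hasOrder L, hspan]
    with p h1 h2 h3 h4 h5 e he hp
  apply le_antisymm
  · rintro f ⟨hfW, hfu⟩
    have h6 := sub_laurent_mem f (OmegaPoly.grass_le (h.mem p) hfW) r
    rw [← sub_add_cancel f (laurent 0 fun c : Fin r => P ((c : ℕ) : ℤ) f), add_comm]
    refine Submodule.add_mem_sup ?_ h6
    set v : Coef r n := fun c : Fin r => P ((c : ℕ) : ℤ) f with hv
    have hvW : v ∈ grassCoef r (Φ p) := by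
      rw [mem_grassCoef, ← sub_sub_cancel f (laurent 0 v)]
      exact Submodule.sub_mem _ hfW (OmegaPoly.le_grass (h.mem p) h6)
    have hvu : ∀ m : ℕ, m < u → coeff v m = 0 := by
      intro m hm
      rw [coeff]
      split_ifs with h7
      · exact mem_shift_Hplus.1 hfu _ (by simp only [Int.toNat_natCast]; omega)
      · rfl
    have h7 : Submodule.span ℂ ((fun j => L j p) '' J) ≤ (Submodule.span ℂ
        {f | ∃ (j : Fin m) (k l o : ℕ), HasOrder (L j) o ∧ k ≤ l ∧ u ≤ o + l ∧
          f = laurent l (cderiv e k (L j) p)}).comap (laurentL r n 0) := by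
      rw [Submodule.span_le]
      rintro _ ⟨j, hj, rfl⟩
      by_cases ho : ∃ o, HasOrder (L j) o
      · obtain ⟨o, ho⟩ := ho
        refine Submodule.subset_span ⟨j, 0, 0, o, ho, le_rfl, ?_, ?_⟩
        · by_contra hcon
          exact ho.2 (hJ j hj o (by omega))
        · rw [cderiv_zero _ _ hp]
          rfl
      · beta_reduce
        rw [(h4 j ho).self_of_nhds]
        exact Submodule.zero_mem _
    exact h7 (h5 v hvW hvu)
  · refine sup_le ?_ (le_inf (OmegaPoly.le_grass (h.mem p)) ?_)
    · rw [Submodule.span_le]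
      rintro _ ⟨j, k, l, o, ho, hkl, hul, rfl⟩
      refine ⟨h.laurent_cderiv_mem he hp (h1 j) (h2 j) hkl, ?_⟩
      have h6 : shift ((l + o : ℕ) : ℤ) (Hplus n) ≤ shift (u : ℤ) (Hplus n) :=
        shift_Hplus_mono (by omega)
      refine h6 (laurent_mem_shift_Hplus (k := l) (o := o) fun i hi => ?_)
      rcases lt_or_ge i 0 with h7 | h7
      · exact coeff_of_neg _ h7
      · obtain ⟨i, rfl⟩ := Int.eq_ofNat_of_zero_le h7
        exact coeff_cderiv_eq_zero he hp (h1 j) (h3 j i (ho.1 i (by exact_mod_cast hi))) k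
    · exact shift_Hplus_mono (by omega)

/-- Concatenate meromorphic spanning sets of W ∩ λ^u H₊ for u = 0, …, r: the block u = 0 spans W,
and block u serves as the subfamily at level u. -/
theorem PolySolution.exists_adapted [T1Space M] [ConnectedSpace M] (h : PolySolution r Φ) :
    ∃ (m : ℕ) (L : Fin m → M → Coef r n),
      IsMeromorphicSpanningSet (fun p => grassCoef r (Φ p)) L ∧
      ∀ u ≤ r, IsAdapted (fun p => grass (Φ p)) L u := by
  choose k L hL hs using h.exists_meromorphic_low
  set ι := Σ u : Fin (r + 1), Fin (k u)
  set ε : Fin (Fintype.card ι) ≃ ι := (Fintype.equivFin ι).symm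
  have hmem : ∀ x : ι, ∀ᶠ p in codiscrete M, L x.1 x.2 p ∈ grassCoef r (Φ p) ∧
      ∀ i : ℕ, i < (x.1 : ℕ) → coeff (L x.1 x.2 p) i = 0 := fun x =>
    (hs x.1).mono fun p hp => (hp _).1 (Submodule.subset_span ⟨x.2, rfl⟩)
  refine ⟨Fintype.card ι, fun j => L (ε j).1 (ε j).2, ⟨fun j => hL _ _, ?_⟩, fun u hu => ?_⟩
  · have h1 : ∀ᶠ p in codiscrete M, ∀ x : ι, L x.1 x.2 p ∈ grassCoef r (Φ p) :=
      eventually_all.2 fun x => (hmem x).mono fun p hp => hp.1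
    filter_upwards [hs 0, h1] with p h2 h3
    apply le_antisymm
    · intro v hv
      have h4 := (h2 v).2 ⟨hv, fun m hm => by omega⟩
      refine Submodule.span_mono ?_ h4
      rintro _ ⟨j, rfl⟩
      refine ⟨ε.symm ⟨0, j⟩, ?_⟩
      beta_reduce
      rw [Equiv.apply_symm_apply]
      rfl
    · rw [Submodule.span_le]
      rintro _ ⟨j, rfl⟩
      exact h3 (ε j)
  · refine h.isAdapted (fun j => hL _ _) (fun j => (hmem (ε j)).mono fun p hp => hp.1)
      {j | ((ε j).1 : ℕ) = u} ?_ ?_ hu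
    · rintro j rfl i hi
      exact (hmem (ε j)).mono fun p hp => hp.2 i hi
    · filter_upwards [hs u] with p hp v hv hvu
      refine Submodule.span_mono ?_ ((hp v).2 ⟨hv, hvu⟩)
      rintro _ ⟨j, rfl⟩
      have hu' : ((⟨u, by omega⟩ : Fin (r + 1)) : ℕ) = u := rfl
      refine ⟨ε.symm ⟨⟨u, by omega⟩, j⟩, ?_, ?_⟩
      · rw [Set.mem_ofPred_eq, Equiv.apply_symm_apply]
      · beta_reduce
        rw [Equiv.apply_symm_apply]

end Adapted

/-! ### Change of coordinates for spans of derivatives -/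

section ChangeOfCoordinates

/-- Leibniz and chain rule: one differentiation replaces c by c' or passes from a to a + 1 with
coefficient c h'. Hence the induction runs over all c and a. -/
theorem iteratedDeriv_smul_comp_mem {V : Type*} [NormedAddCommGroup V] [NormedSpace ℂ V]
    [CompleteSpace V] {h : ℂ → ℂ} {g : ℂ → V} {z₀ : ℂ} (hh : AnalyticAt ℂ h z₀)
    (hg : AnalyticAt ℂ g (h z₀)) (m : ℕ) : ∀ (a : ℕ) {c : ℂ → ℂ}, AnalyticAt ℂ c z₀ →
    iteratedDeriv m (fun z => c z • iteratedDeriv a g (h z)) z₀ ∈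
      Submodule.span ℂ ((fun b => iteratedDeriv b g (h z₀)) '' {b | b ≤ a + m}) := by
  have hgi : ∀ a, AnalyticAt ℂ (iteratedDeriv a g) (h z₀) := fun a => by
    rw [iteratedDeriv_eq_iterate]
    exact hg.iterated_deriv a
  have hF : ∀ (a : ℕ) {c : ℂ → ℂ}, AnalyticAt ℂ c z₀ →
      AnalyticAt ℂ (fun z => c z • iteratedDeriv a g (h z)) z₀ := fun a c hc =>
    hc.smul ((hgi a).comp hh)
  induction m with
  | zero =>
    intro a c _
    rw [iteratedDeriv_zero]
    exact Submodule.smul_mem _ _ (Submodule.subset_span ⟨a, by simp, rfl⟩)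
  | succ m ih =>
    intro a c hc
    have h1 : deriv (fun z => c z • iteratedDeriv a g (h z)) =ᶠ[𝓝 z₀]
        (fun z => deriv c z • iteratedDeriv a g (h z)) +
          fun z => (c z * deriv h z) • iteratedDeriv (a + 1) g (h z) := by
      filter_upwards [hc.eventually_analyticAt, hh.eventually_analyticAt,
        hh.continuousAt.eventually (hgi a).eventually_analyticAt] with z h1 h2 h3
      have h4 := h1.differentiableAt.hasDerivAt.smul
        (h3.differentiableAt.hasDerivAt.scomp z h2.differentiableAt.hasDerivAt)
      rw [Pi.add_apply, iteratedDeriv_succ, mul_smul, add_comm]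
      exact h4.deriv
    rw [iteratedDeriv_succ', h1.iteratedDeriv_eq,
      iteratedDeriv_add (hF a hc.deriv).contDiffAt (hF (a + 1) (hc.fun_mul hh.deriv)).contDiffAt]
    refine Submodule.add_mem _ ?_ ?_
    · refine Submodule.span_mono (Set.image_mono fun b hb => ?_) (ih a hc.deriv)
      exact Nat.le_succ_of_le hb
    · refine Submodule.span_mono (Set.image_mono fun b hb => ?_) (ih (a + 1) (hc.fun_mul hh.deriv))
      rw [Set.mem_ofPred_eq] at hb ⊢
      omega

variable {M : Type*} [TopologicalSpace M] [ChartedSpace ℂ M]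
  {V : Type*} [NormedAddCommGroup V] [NormedSpace ℂ V] [CompleteSpace V]
  {e e' : OpenPartialHomeomorph M ℂ} {p : M} {ι : Type*} [Fintype ι]

theorem analyticAt_transition (he : e ∈ IsManifold.maximalAtlas 𝓘(ℂ) ω M)
    (he' : e' ∈ IsManifold.maximalAtlas 𝓘(ℂ) ω M) (hp : p ∈ e.source) (hp' : p ∈ e'.source) :
    AnalyticAt ℂ (e ∘ e'.symm) (e' p) := by
  rw [← holAt_iff he' hp', holAt_iff he hp]
  refine analyticAt_id.congr ?_
  filter_upwards [e.open_target.mem_nhds (e.map_source hp)] with z hz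
  exact (e.right_inv hz).symm

theorem cderiv_mem_span (he : e ∈ IsManifold.maximalAtlas 𝓘(ℂ) ω M)
    (he' : e' ∈ IsManifold.maximalAtlas 𝓘(ℂ) ω M) (hp : p ∈ e.source) (hp' : p ∈ e'.source)
    {L : ι → M → V} (hL : ∀ j, HolAt (L j) p) {c : ι → M → ℂ} (hc : ∀ j, HolAt (c j) p)
    {σ : M → V} (hσ : ∀ᶠ q in 𝓝 p, σ q = ∑ j, c j q • L j q) (l : ℕ) :
    cderiv e' l σ p ∈ Submodule.span ℂ {v | ∃ j, ∃ a ≤ l, v = cderiv e a (L j) p} := by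
  have hh := analyticAt_transition he he' hp hp'
  have hz : (e ∘ e'.symm) (e' p) = e p := by rw [Function.comp_apply, e'.left_inv hp']
  have hg : ∀ j, AnalyticAt ℂ (L j ∘ e.symm) ((e ∘ e'.symm) (e' p)) := fun j => by
    rw [hz]
    exact (holAt_iff he hp).1 (hL j)
  have hc' : ∀ j, AnalyticAt ℂ (c j ∘ e'.symm) (e' p) := fun j => (holAt_iff he' hp').1 (hc j)
  have h1 : σ ∘ e'.symm =ᶠ[𝓝 (e' p)] fun z => ∑ j, (c j ∘ e'.symm) z •
      iteratedDeriv 0 (L j ∘ e.symm) ((e ∘ e'.symm) z) := by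
    refine (eventually_nhds_chart (e := e') hp' (P := fun q => σ q = ∑ j, c j q •
      iteratedDeriv 0 (L j ∘ e.symm) (e q))).2 ?_
    filter_upwards [hσ, e.open_source.mem_nhds hp] with q h1 h2
    simp only [h1, iteratedDeriv_zero, Function.comp_apply, e.left_inv h2]
  rw [cderiv, h1.iteratedDeriv_eq, iteratedDeriv_fun_sum]
  · refine Submodule.sum_mem _ fun j _ => ?_
    refine Submodule.span_mono ?_ (iteratedDeriv_smul_comp_mem hh (hg j) l 0 (hc' j))
    rintro _ ⟨b, hb, rfl⟩
    rw [Set.mem_ofPred_eq, zero_add] at hb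
    refine ⟨j, b, hb, ?_⟩
    beta_reduce
    rw [hz]
    rfl
  · intro j _
    rw [iteratedDeriv_zero]
    exact ((hc' j).smul ((hg j).comp hh)).contDiffAt

end ChangeOfCoordinates

/-! ### Osculating spaces in terms of a spanning set -/

section Osculating

variable {M : Type*} [TopologicalSpace M] [ChartedSpace ℂ M] [IsManifold 𝓘(ℂ) ω M] {n r m : ℕ}
  {e : OpenPartialHomeomorph M ℂ} {p : M} {X : M → Submodule ℂ (Coef r n)}
  {L : Fin m → M → Coef r n}

/-- Members of the spanning set forming a basis at p remain a frame nearby, the rank of the bundle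
being locally constant; Cramer's rule then gives holomorphic coefficients. -/
theorem exists_holAt_coefficients (hX : IsHolomorphicSubbundle X) (hL : ∀ j, HolAt (L j) p)
    (hspan : ∀ᶠ q in 𝓝 p, X q = Submodule.span ℂ (Set.range fun j => L j q))
    {σ : M → Coef r n} (hσ : HolAt σ p) (hσX : ∀ᶠ q in 𝓝 p, σ q ∈ X q) :
    ∃ (k : ℕ) (τ : Fin k → Fin m) (c : Fin k → M → ℂ), (∀ i, HolAt (c i) p) ∧
      ∀ᶠ q in 𝓝 p, σ q = ∑ i, c i q • L (τ i) q := by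
  obtain ⟨U, hUo, hpU, d, f, hf, hfU⟩ := hX p
  have hrank : ∀ q ∈ U, Module.finrank ℂ (X q) = d := fun q hq => by
    rw [(hfU q hq).2, finrank_span_eq_card (hfU q hq).1, Fintype.card_fin]
  obtain ⟨w, hw, -, hwi⟩ := Submodule.exists_fun_fin_finrank_span_eq ℂ
    (Set.range fun j => L j p)
  have hk : Module.finrank ℂ (Submodule.span ℂ (Set.range fun j => L j p)) = d := by
    rw [← hspan.self_of_nhds, hrank p hpU]
  generalize Module.finrank ℂ (Submodule.span ℂ (Set.range fun j => L j p)) = k at w hw hwi hk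
  subst hk
  choose τ hτ using hw
  obtain ⟨Λ, hΛ⟩ := LinearMap.exists_leftInverse_of_injective
    (Fintype.linearCombination ℂ w) (LinearMap.ker_eq_bot.2
      (linearIndependent_iff_injective_fintypeLinearCombination.1 hwi))
  have he := chartAt_mem p
  have hp := mem_chart_source ℂ p
  let Λc : Coef r n →L[ℂ] (Fin k → ℂ) := Λ.toContinuousLinearMap
  set G : M → Matrix (Fin k) (Fin k) ℂ := fun q => Matrix.of fun a b => Λc (L (τ b) q) a with hG
  have hGh : ∀ a b, HolAt (fun q => G q a b) p := fun a b =>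
    (hL (τ b)).clm ((ContinuousLinearMap.proj a : (Fin k → ℂ) →L[ℂ] ℂ) ∘L Λc)
  have hGa : ∀ a b, AnalyticAt ℂ (fun z => G ((chartAt ℂ p).symm z) a b) (chartAt ℂ p p) :=
    fun a b => (holAt_iff he hp).1 (hGh a b)
  have hGp : G p = 1 := by
    ext a b
    have h1 := congrFun (LinearMap.congr_fun hΛ (Pi.single b 1)) a
    rw [LinearMap.comp_apply, Fintype.linearCombination_apply_single, one_smul] at h1
    have h2 : L (τ b) p = w b := hτ b
    change Λ (L (τ b) p) a = _
    rw [h2, h1, LinearMap.id_apply, Matrix.one_apply, Pi.single_apply]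
  have hG0 : (G ((chartAt ℂ p).symm (chartAt ℂ p p))).det ≠ 0 := by
    rw [(chartAt ℂ p).left_inv hp, hGp, Matrix.det_one]
    exact one_ne_zero
  have hdet : ∀ᶠ q in 𝓝 p, (G q).det ≠ 0 := by
    rw [← eventually_nhds_chart hp]
    exact (AnalyticAt.continuousAt (det_mem_subring (analyticSubring _) hGa)).eventually_ne hG0
  refine ⟨k, τ, fun i q => ((G q)⁻¹ *ᵥ Λc (σ q)) i, fun i => ?_, ?_⟩
  · rw [holAt_iff he hp]
    have h1 : ∀ b, AnalyticAt ℂ ((fun q => Λc (σ q) b) ∘ (chartAt ℂ p).symm) (chartAt ℂ p p) :=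
      fun b => (holAt_iff he hp).1
        (hσ.clm ((ContinuousLinearMap.proj b : (Fin k → ℂ) →L[ℂ] ℂ) ∘L Λc))
    have h2 : AnalyticAt ℂ (fun z => ∑ b, (G ((chartAt ℂ p).symm z))⁻¹ i b *
        ((fun q => Λc (σ q) b) ∘ (chartAt ℂ p).symm) z) (chartAt ℂ p p) :=
      Finset.analyticAt_fun_sum _ fun b _ => (analyticAt_inv_entry hGa hG0 i b).fun_mul (h1 b)
    exact h2
  · filter_upwards [hdet, hspan, hσX, hUo.mem_nhds hpU] with q h1 h2 h3 h4
    have hunit : IsUnit (G q).det := isUnit_iff_ne_zero.2 h1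
    have hcomb : ∀ x : Fin k → ℂ, Λc (∑ i, x i • L (τ i) q) = G q *ᵥ x := by
      intro x
      ext a
      simp [hG, Matrix.mulVec, dotProduct, mul_comm]
    have hli : LinearIndependent ℂ fun i => L (τ i) q := by
      rw [Fintype.linearIndependent_iff]
      intro x hx
      have h5 := hcomb x
      rw [hx, map_zero] at h5
      have h6 := Matrix.eq_zero_of_mulVec_eq_zero h1 h5.symm
      exact fun i => congrFun h6 i
    have hle : Submodule.span ℂ (Set.range fun i => L (τ i) q) ≤ X q := by
      rw [h2]
      refine Submodule.span_mono ?_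
      rintro _ ⟨i, rfl⟩
      exact ⟨τ i, rfl⟩
    have heq : Submodule.span ℂ (Set.range fun i => L (τ i) q) = X q := by
      refine Submodule.eq_of_le_of_finrank_eq hle ?_
      rw [finrank_span_eq_card hli, hrank q h4, Fintype.card_fin]
    rw [← heq, Submodule.mem_span_range_iff_exists_fun] at h3
    obtain ⟨x, hx⟩ := h3
    rw [← hx, hcomb, Matrix.mulVec_mulVec, Matrix.nonsing_inv_mul _ hunit, Matrix.one_mulVec]

/-- `osculating` allows every section and every coordinate; expanding in the spanning set and
changing coordinates produces only derivatives of order at most k of its members in the one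
coordinate `e`. -/
theorem osculating_le (hX : IsHolomorphicSubbundle X) (hL : ∀ j, HolAt (L j) p)
    (hspan : ∀ᶠ q in 𝓝 p, X q = Submodule.span ℂ (Set.range fun j => L j q))
    (he : e ∈ IsManifold.maximalAtlas 𝓘(ℂ) ω M) (hp : p ∈ e.source) (k : ℕ) :
    osculating X k p ≤ Submodule.span ℂ {v | ∃ j, ∃ a ≤ k, v = cderiv e a (L j) p} := by
  rw [osculating, Submodule.span_le]
  rintro _ ⟨e', he', hp', U, hUo, hpU, σ, hσ, hσX, l, hl, rfl⟩
  have hσ' : HolAt σ p := by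
    filter_upwards [hUo.mem_nhds hpU] with q hq
    exact (hσ q hq).mdifferentiableAt (hUo.mem_nhds hq)
  obtain ⟨d, τ, c, hc, hσc⟩ := exists_holAt_coefficients hX hL hspan hσ'
    (by filter_upwards [hUo.mem_nhds hpU] with q hq using hσX q hq)
  refine Submodule.span_mono ?_ (cderiv_mem_span he he' hp hp' (fun i => hL (τ i)) hc hσc l)
  rintro _ ⟨i, a, ha, rfl⟩
  exact ⟨τ i, a, ha.trans hl, rfl⟩

omit [IsManifold 𝓘(ℂ) ω M] in
theorem cderiv_mem_osculating {σ : M → Coef r n} (hσ : HolAt σ p)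
    (hσX : ∀ᶠ q in 𝓝 p, σ q ∈ X q) (he : e ∈ IsManifold.maximalAtlas 𝓘(ℂ) ω M)
    (hp : p ∈ e.source) {k l : ℕ} (hkl : k ≤ l) : cderiv e k σ p ∈ osculating X l p := by
  obtain ⟨U, hU, hUo, hpU⟩ := eventually_nhds_iff.1 (Eventually.and hσ hσX)
  exact Submodule.subset_span ⟨e, he, hp, U, hUo, hpU, σ,
    fun q hq => (hU q hq).1.mdifferentiableWithinAt, fun q hq => (hU q hq).2, k, hkl, rfl⟩

end Osculating

/-! ### Explicit formulae for the unitons -/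

section Formulae

variable {n r : ℕ}

theorem coeFn_laurent (k : ℕ) (v : Coef r n) :
    ∀ᵐ t ∂(AddCircle.haarAddCircle (T := (1 : ℝ))),
      laurent k v t = ∑ i : Fin r, ((t.toCircle : Circle) : ℂ) ^ (k + (i : ℕ)) • v i :=
  ContinuousMap.coeFn_toLp (p := 2) (𝕜 := ℂ) (AddCircle.haarAddCircle (T := (1 : ℝ))) _

theorem laurent_succ (l : ℕ) (v : Coef r n) : laurent (l + 1) v = shiftL 1 (laurent l v) := by
  apply Lp.ext
  filter_upwards [coeFn_laurent (l + 1) v, coeFn_laurent l v, coeFn_shiftL 1 (laurent l v)]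
    with t h1 h2 h3
  rw [h1, h3, h2, Finset.smul_sum]
  refine Finset.sum_congr rfl fun i _ => ?_
  rw [smul_smul, zpow_one, ← pow_succ']
  congr 2
  ring

theorem shiftL_mem_shift {f : H n} {a b : ℤ} (hf : f ∈ shift b (Hplus n)) :
    shiftL a f ∈ shift (a + b) (Hplus n) := by
  rw [mem_shift_Hplus] at hf ⊢
  intro m hm
  rw [P_shiftL]
  exact hf _ (by omega)

theorem shiftL_neg_mem {W : Submodule ℂ (H n)} {f : H n} {u : ℕ} (hf : f ∈ W) :
    shiftL (-(u : ℤ)) f ∈ shift (-(u : ℤ)) W := by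
  rw [mem_shift, shiftL_shiftL, neg_neg, add_neg_cancel, shiftL_zero]
  exact hf

theorem shiftL_neg_mem_stepSpace {W : Submodule ℂ (H n)} {f : H n} {u i : ℕ} (hf : f ∈ W)
    (hfu : f ∈ shift (u : ℤ) (Hplus n)) : shiftL (-(u : ℤ)) f ∈ stepSpace W u i := by
  refine Submodule.mem_sup_left ⟨shiftL_neg_mem hf, ?_⟩
  have := shiftL_mem_shift (a := -(u : ℤ)) hfu
  rwa [neg_add_cancel, shift_zero] at this

theorem evalMap_shiftL_laurent (γ : Circle → Mat n) (i u l : ℕ) (v : Coef r n) :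
    evalMap γ i (shiftL (-(u : ℤ)) (laurent l v)) =
      ∑ t ∈ Finset.range i, act (loopCoeff γ t)ᴴ (coeff v ((t : ℤ) + u - l)) := by
  rw [evalMap_apply]
  refine Finset.sum_congr rfl fun t _ => ?_
  rw [P_shiftL, P_laurent, sub_neg_eq_add]

theorem grass_le_stepDown {γ : Circle → Mat n} {R : Mat n} {i : ℕ}
    (hγ : γ ∈ OmegaPoly (i + 1) n) (hR : IsOrthProj R) (hm : stepDown γ R ∈ OmegaPoly i n) :
    grass γ ≤ grass (stepDown γ R) := by
  obtain ⟨L, L', hL, hL', -⟩ := OmegaPoly.exists_isMul hγ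
  intro f hf
  rw [OmegaPoly.mem_grass hγ hL', mem_Hplus] at hf
  rw [mem_grass_stepDown hR hm hL']
  refine ⟨fun m hm => hf m (by omega), ?_⟩
  rw [hf _ (by omega), map_zero]

end Formulae

/-! ### Evaluating the generators at a point -/

section Surface

variable {M : Type*} [TopologicalSpace M] [ChartedSpace ℂ M] {n r m : ℕ}
  {L : Fin m → M → Coef r n} {e : OpenPartialHomeomorph M ℂ} {p : M} {W : Submodule ℂ (H n)}
  {γ : Circle → Mat n} {u i : ℕ}

theorem cderiv_coeff {σ : M → Coef r n} (he : e ∈ IsManifold.maximalAtlas 𝓘(ℂ) ω M)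
    (hp : p ∈ e.source) (hσ : HolAt σ p) (k : ℕ) (a : ℤ) :
    cderiv e k (fun q => coeff (σ q) a) p = coeff (cderiv e k σ p) a := by
  simp_rw [← coeffL_apply]
  exact cderiv_clm he hp hσ (coeffL r n a) k

theorem sum_act_cderiv_eq_evalMap {σ : M → Coef r n} (he : e ∈ IsManifold.maximalAtlas 𝓘(ℂ) ω M)
    (hp : p ∈ e.source) (hσ : HolAt σ p) (k l : ℕ) {d : ℤ} (hd : d + l = u) :
    ∑ t ∈ Finset.range i, Matrix.toEuclideanLin (loopCoeff γ t)ᴴ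
      (cderiv e k (fun q => coeff (σ q) ((t : ℤ) + d)) p) =
        evalMap γ i (shiftL (-(u : ℤ)) (laurent l (cderiv e k σ p))) := by
  rw [evalMap_shiftL_laurent]
  refine Finset.sum_congr rfl fun t _ => ?_
  rw [cderiv_coeff he hp hσ, show (t : ℤ) + u - l = t + d by omega]

theorem sum_act_cderiv_eq_evalMap' {σ : M → Coef r n} (he : e ∈ IsManifold.maximalAtlas 𝓘(ℂ) ω M)
    (hp : p ∈ e.source) (hσ : HolAt σ p) (k : ℕ) :
    ∑ t ∈ Finset.range i, Matrix.toEuclideanLin (loopCoeff γ t)ᴴ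
      (cderiv e k (fun q => coeff (σ q) ((t : ℤ) - k + u)) p) =
        evalMap γ i (shiftL (-(u : ℤ)) (laurent k (cderiv e k σ p))) := by
  rw [← sum_act_cderiv_eq_evalMap he hp hσ k k (d := u - k) (by omega)]
  refine Finset.sum_congr rfl fun t _ => ?_
  rw [show (t : ℤ) - k + u = t + (u - k) by omega]

/-- Each generator is the evaluation of λ^{l-u}(L^j)^{(k)}, with l = k in the first family and l = u
- o(j) in the second; in both cases o(j) + l ≥ u, so the element lies in λ^{-u}W ∩ H₊. -/
theorem explicitSpan_le_map (he : e ∈ IsManifold.maximalAtlas 𝓘(ℂ) ω M) (hp : p ∈ e.source)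
    (hL : ∀ j, HolAt (L j) p)
    (hW : ∀ j k l, k ≤ l → laurent l (cderiv e k (L j) p) ∈ W)
    (hord : ∀ j k l o, HasOrder (L j) o →
      laurent l (cderiv e k (L j) p) ∈ shift ((l + o : ℕ) : ℤ) (Hplus n)) :
    explicitSpan γ e L u i p ≤ (stepSpace W u i).map (evalMap γ i) := by
  have key : ∀ j k l o, HasOrder (L j) o → k ≤ l → u ≤ l + o →
      evalMap γ i (shiftL (-(u : ℤ)) (laurent l (cderiv e k (L j) p))) ∈
        (stepSpace W u i).map (evalMap γ i) := fun j k l o ho hkl hul => by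
    have h1 : shift ((l + o : ℕ) : ℤ) (Hplus n) ≤ shift (u : ℤ) (Hplus n) :=
      shift_Hplus_mono (by omega)
    exact Submodule.mem_map_of_mem
      (shiftL_neg_mem_stepSpace (hW j k l hkl) (h1 (hord j k l o ho)))
  refine sup_le ?_ ?_ <;> rw [Submodule.span_le]
  · rintro _ ⟨j, k, o, ho, h1, -, rfl⟩
    rw [sum_act_cderiv_eq_evalMap' he hp (hL j)]
    exact key j k k o ho le_rfl (by omega)
  · rintro _ ⟨j, k, o, ho, h1, rfl⟩
    rw [sum_act_cderiv_eq_evalMap he hp (hL j) k (u - o) (u := u) (by omega)]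
    exact key j k (u - o) o ho (by omega) (by omega)

/-- Evaluate λ^{l-u}(L^j)^{(k)} with k ≤ l and o(j) + l ≥ u. If l = k, it is a first-type generator,
or zero once its order reaches the cut-off. If l > k and o(j) + l = u, it is a second-type
generator. If l > k and o(j) + l > u, it is λ times an element of W_{i+1} ⊆ γH₊ and evaluates to
zero by `evalMap_shiftL`. -/
theorem map_le_explicitSpan (he : e ∈ IsManifold.maximalAtlas 𝓘(ℂ) ω M) (hp : p ∈ e.source)
    (hL : ∀ j, HolAt (L j) p)
    (hW : ∀ j k l, k ≤ l → laurent l (cderiv e k (L j) p) ∈ W)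
    (hord : ∀ j k l o, HasOrder (L j) o →
      laurent l (cderiv e k (L j) p) ∈ shift ((l + o : ℕ) : ℤ) (Hplus n))
    (hγ : γ ∈ OmegaPoly i n) (hstep : stepSpace W u (i + 1) ≤ grass γ) (hir : u + (i + 1) ≤ r)
    (hadapted : W ⊓ shift (u : ℤ) (Hplus n) ≤
      Submodule.span ℂ {f | ∃ (j : Fin m) (k l o : ℕ), HasOrder (L j) o ∧ k ≤ l ∧ u ≤ o + l ∧
        f = laurent l (cderiv e k (L j) p)} ⊔ shift (r : ℤ) (Hplus n)) :
    (stepSpace W u (i + 1)).map (evalMap γ (i + 1)) ≤ explicitSpan γ e L u (i + 1) p := by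
  have hzero : ∀ {f : H n} {b : ℕ}, f ∈ shift (b : ℤ) (Hplus n) → u + (i + 1) ≤ b →
      evalMap γ (i + 1) (shiftL (-(u : ℤ)) f) = 0 := fun {f b} hf hb =>
    evalMap_eq_zero_of_mem_shift
      (shift_Hplus_mono (by omega) (shiftL_mem_shift (a := -(u : ℤ)) hf))
  have key : Submodule.span ℂ {f | ∃ (j : Fin m) (k l o : ℕ), HasOrder (L j) o ∧ k ≤ l ∧
        u ≤ o + l ∧ f = laurent l (cderiv e k (L j) p)} ⊔ shift (r : ℤ) (Hplus n) ≤
      (explicitSpan γ e L u (i + 1) p).comap (evalMap γ (i + 1) ∘ₗ shiftL (-(u : ℤ))) := by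
    refine sup_le ?_ fun f hf => ?_
    · rw [Submodule.span_le]
      rintro _ ⟨j, k, l, o, ho, hkl, hul, rfl⟩
      rw [SetLike.mem_coe, Submodule.mem_comap, LinearMap.comp_apply]
      rcases hkl.eq_or_lt with rfl | hkl
      · by_cases hi : o + k ≤ u + i
        · refine Submodule.mem_sup_left (Submodule.subset_span
            ⟨j, k, o, ho, by omega, by push_cast; omega, ?_⟩)
          rw [sum_act_cderiv_eq_evalMap' he hp (hL j)]
        · rw [hzero (hord j k k o ho) (by omega)]
          exact Submodule.zero_mem _
      · obtain ⟨l, rfl⟩ : ∃ l', l = l' + 1 := ⟨l - 1, by omega⟩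
        rcases hul.eq_or_lt with hul | hul
        · refine Submodule.mem_sup_right (Submodule.subset_span ⟨j, k, o, ho, by omega, ?_⟩)
          rw [sum_act_cderiv_eq_evalMap he hp (hL j) k (l + 1) (u := u) (by omega)]
        -- One factor λ is spare here: the generator with exponent l instead of l + 1 still lies in
        -- W ∩ λ^u H₊.
        · have h1 : shift ((l + o : ℕ) : ℤ) (Hplus n) ≤ shift (u : ℤ) (Hplus n) :=
            shift_Hplus_mono (by omega)
          have h2 := hstep (shiftL_neg_mem_stepSpace (i := i + 1) (hW j k l (by omega))
            (h1 (hord j k l o ho)))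
          have h3 := evalMap_shiftL hγ h2
          rw [shiftL_shiftL, add_comm (1 : ℤ), ← shiftL_shiftL, ← laurent_succ] at h3
          rw [h3]
          exact Submodule.zero_mem _
    · rw [Submodule.mem_comap, LinearMap.comp_apply, hzero hf hir]
      exact Submodule.zero_mem _
  rw [Submodule.map_le_iff_le_comap]
  refine sup_le ?_ fun f hf => ?_
  · rintro f ⟨hfW, hf⟩
    rw [SetLike.mem_coe, mem_shift, neg_neg] at hfW
    have h1 : shiftL (u : ℤ) f ∈ shift (u : ℤ) (Hplus n) := by
      rw [mem_shift, shiftL_shiftL, neg_add_cancel, shiftL_zero]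
      exact hf
    have h2 := key (hadapted ⟨hfW, h1⟩)
    rwa [Submodule.mem_comap, LinearMap.comp_apply, shiftL_shiftL, neg_add_cancel,
      shiftL_zero] at h2
  · rw [Submodule.mem_comap, evalMap_eq_zero_of_mem_shift hf]
    exact Submodule.zero_mem _

end Surface

/-! ### Generic properties of spanning sets -/

section Generic

variable {M : Type*} [TopologicalSpace M] [ChartedSpace ℂ M] [IsManifold 𝓘(ℂ) ω M] {n r m : ℕ}
  {L : Fin m → M → Coef r n} {X : M → Submodule ℂ (Coef r n)} {W : M → Submodule ℂ (H n)}

theorem eventually_laurent_cderiv_mem (hX : Generates X W) (hL : IsMeromorphicSpanningSet X L) :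
    ∀ᶠ p in codiscrete M, ∀ e ∈ IsManifold.maximalAtlas 𝓘(ℂ) ω M, p ∈ e.source →
      ∀ j k l, k ≤ l → laurent l (cderiv e k (L j) p) ∈ W p := by
  have h1 : ∀ᶠ p in codiscrete M, ∀ j, HolAt (L j) p :=
    eventually_all.2 fun j => (hL.1 j).eventually_holAt
  filter_upwards [hX, h1, eventually_codiscrete_eventually_nhds hL.2] with p h1 h2 h3 e he hp j k l
    hkl
  rw [h1]
  rcases lt_or_ge l r with hlr | hlr
  · refine Submodule.mem_sup_left (Submodule.subset_span ⟨l, hlr, _,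
      cderiv_mem_osculating (h2 j) ?_ he hp hkl, rfl⟩)
    filter_upwards [h3] with q hq
    rw [hq]
    exact Submodule.subset_span ⟨j, rfl⟩
  · have h4 : shift ((l + 0 : ℕ) : ℤ) (Hplus n) ≤ shift (r : ℤ) (Hplus n) :=
      shift_Hplus_mono (by omega)
    exact Submodule.mem_sup_right (h4 (laurent_mem_shift_Hplus fun a ha =>
      coeff_of_neg _ (by simpa using ha)))

theorem eventually_laurent_cderiv_mem_shift (hL : ∀ j, IsMeromorphic (L j)) :
    ∀ᶠ p in codiscrete M, ∀ e ∈ IsManifold.maximalAtlas 𝓘(ℂ) ω M, p ∈ e.source →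
      ∀ j k l o, HasOrder (L j) o →
        laurent l (cderiv e k (L j) p) ∈ shift ((l + o : ℕ) : ℤ) (Hplus n) := by
  have h1 : ∀ᶠ p in codiscrete M, ∀ j, HolAt (L j) p :=
    eventually_all.2 fun j => (hL j).eventually_holAt
  filter_upwards [h1, eventually_coeff_vanish L] with p h1 h2 e he hp j k l o ho
  refine laurent_mem_shift_Hplus fun a ha => ?_
  rcases lt_or_ge a 0 with h3 | h3
  · exact coeff_of_neg _ h3
  · obtain ⟨a, rfl⟩ := Int.eq_ofNat_of_zero_le h3
    exact coeff_cderiv_eq_zero he hp (h1 j) (h2 j a (ho.1 a (by exact_mod_cast ha))) k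

/-- At level 0 no adaptedness is needed: the order condition is void, and generation of W together
with `osculating_le` gives the spanning property. -/
theorem eventually_le_span_of_generates (hX : IsHolomorphicSubbundle X) (hXW : Generates X W)
    (hL : IsMeromorphicSpanningSet X L) :
    ∀ᶠ p in codiscrete M, ∀ e ∈ IsManifold.maximalAtlas 𝓘(ℂ) ω M, p ∈ e.source →
      W p ⊓ shift ((0 : ℕ) : ℤ) (Hplus n) ≤
        Submodule.span ℂ {f | ∃ (j : Fin m) (k l o : ℕ), HasOrder (L j) o ∧ k ≤ l ∧ 0 ≤ o + l ∧
          f = laurent l (cderiv e k (L j) p)} ⊔ shift (r : ℤ) (Hplus n) := by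
  have h1 : ∀ᶠ p in codiscrete M, ∀ j, HolAt (L j) p :=
    eventually_all.2 fun j => (hL.1 j).eventually_holAt
  filter_upwards [hXW, h1, eventually_codiscrete_eventually_nhds hL.2,
    eventually_zero_of_not_hasOrder L] with p h1 h2 h3 h4 e he hp
  refine inf_le_left.trans ?_
  rw [h1]
  refine sup_le_sup_right ?_ _
  rw [Submodule.span_le]
  rintro _ ⟨l, -, v, hv, rfl⟩
  have h5 : Submodule.span ℂ {v | ∃ j, ∃ a ≤ l, v = cderiv e a (L j) p} ≤
      (Submodule.span ℂ {f | ∃ (j : Fin m) (k l o : ℕ), HasOrder (L j) o ∧ k ≤ l ∧ 0 ≤ o + l ∧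
          f = laurent l (cderiv e k (L j) p)}).comap (laurentL r n l) := by
    rw [Submodule.span_le]
    rintro _ ⟨j, a, ha, rfl⟩
    by_cases ho : ∃ o, HasOrder (L j) o
    · obtain ⟨o, ho⟩ := ho
      exact Submodule.subset_span ⟨j, a, l, o, ho, ha, Nat.zero_le _, rfl⟩
    · rw [cderiv_congr hp (h4 j ho), cderiv_zero_fun]
      exact Submodule.zero_mem _
  exact h5 (osculating_le hX h2 h3 he hp l hv)

end Generic

/-! ### The formulae for the factorization -/

section FactorizationFormulae

variable {M : Type*} [TopologicalSpace M] [ChartedSpace ℂ M] [IsManifold 𝓘(ℂ) ω M] {n r m i : ℕ}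
  {Φ : M → Circle → Mat n} {R : ℕ → M → Mat n} {startU : Bool}
  {L : Fin m → M → Coef r n} {X : M → Submodule ℂ (Coef r n)}

theorem IsFactorization.explicitSpan_le (h : IsFactorization (altType startU r) r Φ R)
    (hXW : Generates X fun p => grass (Φ p)) (hL : IsMeromorphicSpanningSet X L) (hi : i < r) :
    ∀ᶠ p in codiscrete M, ∀ e ∈ IsManifold.maximalAtlas 𝓘(ℂ) ω M, p ∈ e.source →
      explicitSpan (partialProd (ranges R) i p) e L (altCount startU r (i + 1)) (i + 1) p ≤
        ranges R (i + 1) p := by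
  have h1 : ∀ᶠ p in codiscrete M, ∀ j, HolAt (L j) p :=
    eventually_all.2 fun j => (hL.1 j).eventually_holAt
  filter_upwards [h1, eventually_laurent_cderiv_mem hXW hL,
    eventually_laurent_cderiv_mem_shift hL.1, h.ranges_eq hi] with p h1 h2 h3 h4 e he hp
  rw [h4]
  exact explicitSpan_le_map he hp h1 (h2 e he hp) (h3 e he hp)

theorem IsFactorization.ranges_eq_explicitSpan (h : IsFactorization (altType startU r) r Φ R)
    (hX : IsHolomorphicSubbundle X) (hXW : Generates X fun p => grass (Φ p))
    (hL : IsMeromorphicSpanningSet X L) (hi : i < r)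
    (hu : altCount startU r (i + 1) = 0 ∨
      IsAdapted (fun p => grass (Φ p)) L (altCount startU r (i + 1))) :
    ∀ᶠ p in codiscrete M, ∀ e ∈ IsManifold.maximalAtlas 𝓘(ℂ) ω M, p ∈ e.source →
      ranges R (i + 1) p =
        explicitSpan (partialProd (ranges R) i p) e L (altCount startU r (i + 1)) (i + 1) p := by
  have h1 : ∀ᶠ p in codiscrete M, ∀ j, HolAt (L j) p :=
    eventually_all.2 fun j => (hL.1 j).eventually_holAt
  have hir := altCount_le startU (r := r) (i := i + 1) hi
  have h5 : ∀ᶠ p in codiscrete M, ∀ e ∈ IsManifold.maximalAtlas 𝓘(ℂ) ω M, p ∈ e.source →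
      grass (Φ p) ⊓ shift (altCount startU r (i + 1) : ℤ) (Hplus n) ≤
        Submodule.span ℂ {f | ∃ (j : Fin m) (k l o : ℕ), HasOrder (L j) o ∧ k ≤ l ∧
          altCount startU r (i + 1) ≤ o + l ∧ f = laurent l (cderiv e k (L j) p)} ⊔
            shift (r : ℤ) (Hplus n) := by
    rcases hu with hu | hu
    · rw [hu]
      exact eventually_le_span_of_generates hX hXW hL
    · filter_upwards [hu] with p h e he hp
      exact (h e he hp).le
  filter_upwards [h1, eventually_laurent_cderiv_mem hXW hL,
    eventually_laurent_cderiv_mem_shift hL.1, h.ranges_eq hi, h5, h.explicitSpan_le hXW hL hi,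
    h.grass_eq_stepSpace (i := i + 1) hi] with p h1 h2 h3 h4 h5 h6 h7 e he hp
  refine le_antisymm ?_ (h6 e he hp)
  rw [h4]
  refine map_le_explicitSpan he hp h1 (h2 e he hp) (h3 e he hp) ((h.sol i hi.le).mem p) ?_
    (by omega) (h5 e he hp)
  have hm := (h.sol i hi.le).mem p
  rw [← stepDown_partialProd_succ h.proj] at hm
  have h8 := grass_le_stepDown ((h.sol (i + 1) hi).mem p) (h.proj _ _) hm
  rwa [stepDown_partialProd_succ h.proj, h7] at h8

end FactorizationFormulae

/-! ### Extended solutions into the orthogonal group -/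

section Orthogonal

variable {n : ℕ}

theorem map_ofReal_injective {A B : Matrix (Fin n) (Fin n) ℝ}
    (h : A.map (fun x : ℝ => (x : ℂ)) = B.map fun x : ℝ => (x : ℂ)) : A = B := by
  ext a b
  exact Complex.ofReal_injective (congrFun (congrFun h a) b)

/-- Orthogonal matrices are the real unitary ones, so with values in O(n) amounts to unitarity plus
invariance under conjugation. -/
theorem mem_orthogonalMats {A : Mat n} :
    A ∈ orthogonalMats n ↔ A ∈ unitaryMats n ∧ A.map (starRingEnd ℂ) = A := by
  have hmul : ∀ B C : Matrix (Fin n) (Fin n) ℝ, (B * C).map (fun x : ℝ => (x : ℂ)) =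
      B.map (fun x : ℝ => (x : ℂ)) * C.map fun x : ℝ => (x : ℂ) := fun B C =>
    Matrix.map_mul (f := Complex.ofRealHom)
  have hone : (1 : Matrix (Fin n) (Fin n) ℝ).map (fun x : ℝ => (x : ℂ)) = 1 :=
    Matrix.map_one _ Complex.ofReal_zero Complex.ofReal_one
  have hstar : ∀ B : Matrix (Fin n) (Fin n) ℝ, star (B.map fun x : ℝ => (x : ℂ)) =
      Bᵀ.map fun x : ℝ => (x : ℂ) := fun B => by
    ext a b
    exact Complex.conj_ofReal _
  constructor
  · rintro ⟨B, hB, rfl⟩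
    constructor
    · rw [unitaryMats, Set.mem_ofPred_eq, Matrix.mem_unitaryGroup_iff, hstar, ← hmul,
        (Matrix.mem_orthogonalGroup_iff _ _).1 hB, hone]
    · ext a b
      exact Complex.conj_ofReal _
  · rintro ⟨h1, h2⟩
    have h3 : A = (A.map Complex.re).map fun x : ℝ => (x : ℂ) := by
      ext a b
      exact (Complex.conj_eq_iff_re.1 (congrFun (congrFun h2 a) b)).symm
    refine ⟨A.map Complex.re, ?_, h3⟩
    rw [unitaryMats, Set.mem_ofPred_eq, Matrix.mem_unitaryGroup_iff] at h1
    rw [Matrix.mem_orthogonalGroup_iff]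
    apply map_ofReal_injective
    rw [hmul, hone, ← hstar, ← h3, h1]

theorem conj_zpow_circle (z : Circle) (k : ℤ) :
    starRingEnd ℂ ((z : ℂ) ^ k) = (z : ℂ) ^ (-k) := by
  rw [map_zpow₀, ← Circle.coe_inv_eq_conj, Circle.coe_inv, inv_zpow, zpow_neg]

theorem smul_map_conj (z : Circle) (k : ℤ) (A : Mat n) :
    ((z : ℂ) ^ k • A).map (starRingEnd ℂ) = (z : ℂ) ^ (-k) • A.map (starRingEnd ℂ) := by
  ext a b
  rw [Matrix.map_apply, Matrix.smul_apply, smul_eq_mul, map_mul, conj_zpow_circle]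
  rfl

theorem zpow_smul_mem_unitaryMats {A : Mat n} (hA : A ∈ unitaryMats n) (z : Circle) (k : ℤ) :
    (z : ℂ) ^ k • A ∈ unitaryMats n := by
  rw [unitaryMats, Set.mem_ofPred_eq, Matrix.mem_unitaryGroup_iff] at hA ⊢
  rw [star_smul, smul_mul_smul_comm, hA, ← starRingEnd_apply, conj_zpow_circle,
    ← zpow_add₀ (Circle.coe_ne_zero z), add_neg_cancel, zpow_zero, one_smul]

/-- Negative powers are powers of the conjugate on the circle, which is smooth on all of ℂ. -/
theorem contMDiff_circle_zpow (k : ℤ) :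
    ContMDiff (𝓡 1) 𝓘(ℝ, ℂ) ∞ (fun z : Circle => (z : ℂ) ^ k) := by
  obtain ⟨j, rfl | rfl⟩ := k.eq_nat_or_neg
  · have h1 : ContDiff ℝ ∞ fun w : ℂ => w ^ j := contDiff_id.pow j
    simp_rw [zpow_natCast]
    exact h1.contMDiff.comp contMDiff_coe_circle
  · have h1 : ContDiff ℝ ∞ fun w : ℂ => Complex.conjCLE w ^ j := Complex.conjCLE.contDiff.pow j
    have h2 : (fun z : Circle => (z : ℂ) ^ (-(j : ℤ))) =
        (fun w : ℂ => Complex.conjCLE w ^ j) ∘ fun z : Circle => (z : ℂ) := by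
      ext1 z
      rw [← conj_zpow_circle, zpow_natCast, map_pow]
      rfl
    rw [h2]
    exact h1.contMDiff.comp contMDiff_coe_circle

variable {M : Type*} [TopologicalSpace M] [ChartedSpace ℂ M]
  {Φ : M → Circle → Mat n} {e : OpenPartialHomeomorph M ℂ} {p : M}

theorem contMDiff_zpow_smul
    (h : ∀ a b, ContMDiff (𝓘(ℝ, ℂ).prod (𝓡 1)) 𝓘(ℝ, ℂ) ∞
      fun x : M × Circle => Φ x.1 x.2 a b) (k : ℤ) (a b : Fin n) :
    ContMDiff (𝓘(ℝ, ℂ).prod (𝓡 1)) 𝓘(ℝ, ℂ) ∞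
      fun x : M × Circle => ((x.2 : ℂ) ^ k • Φ x.1 x.2) a b := by
  have h1 : ContDiff ℝ ∞ fun w : ℂ × ℂ => w.1 * w.2 := contDiff_fst.mul contDiff_snd
  have h2 : ContMDiff (𝓘(ℝ, ℂ).prod (𝓡 1)) 𝓘(ℝ, ℂ × ℂ) ∞
      fun x : M × Circle => ((x.2 : ℂ) ^ k, Φ x.1 x.2 a b) :=
    ((contMDiff_circle_zpow k).comp contMDiff_snd).prodMk_space (h a b)
  exact h1.contMDiff.comp h2

theorem matSmoothAt_of_contMDiff
    (h : ∀ a b, ContMDiff (𝓘(ℝ, ℂ).prod (𝓡 1)) 𝓘(ℝ, ℂ) ∞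
      fun x : M × Circle => Φ x.1 x.2 a b) (z : Circle) (p : M) :
    MatSmoothAt (fun q => Φ q z) p := fun a b =>
  ((h a b).comp (contMDiff_id.prodMk (contMDiff_const (c := z)))).contMDiffAt

theorem contMDiff_loop
    (h : ∀ a b, ContMDiff (𝓘(ℝ, ℂ).prod (𝓡 1)) 𝓘(ℝ, ℂ) ∞
      fun x : M × Circle => Φ x.1 x.2 a b) (p : M) (a b : Fin n) :
    ContMDiff (𝓡 1) 𝓘(ℝ, ℂ) ∞ fun z : Circle => Φ p z a b :=
  (h a b).comp ((contMDiff_const (c := p)).prodMk contMDiff_id)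

theorem inv_mul_dzMat_zpow_smul (he : e ∈ IsManifold.maximalAtlas 𝓘(ℂ) ω M) (hp : p ∈ e.source)
    (h : ∀ z p, MatSmoothAt (fun q => Φ q z) p) (k : ℤ) (z : Circle)
    (hu : Φ p z ∈ unitaryMats n) :
    ((z : ℂ) ^ k • Φ p z)⁻¹ * dzMat e (fun q => (z : ℂ) ^ k • Φ q z) p =
      (Φ p z)⁻¹ * dzMat e (fun q => Φ q z) p := by
  have hz : (z : ℂ) ^ k ≠ 0 := zpow_ne_zero k (Circle.coe_ne_zero z)
  rw [dzMat_eq_ddM, dzMat_eq_ddM, ddM_const_smul _ ((h z p).matDiffAt he hp) hp]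
  have h1 : ((z : ℂ) ^ k • Φ p z)⁻¹ = ((z : ℂ) ^ k)⁻¹ • (Φ p z)⁻¹ := by
    have hdet := Matrix.isUnit_det_of_right_inverse (Matrix.mem_unitaryGroup_iff.1 hu)
    exact Matrix.inv_smul' (Φ p z) (Units.mk0 _ hz) hdet
  rw [h1, smul_mul_smul_comm, inv_mul_cancel₀ hz, one_smul]

omit [ChartedSpace ℂ M] in
theorem ddM_transpose {c : ℂ} {F : M → Mat n} :
    ddM c e (fun q => (F q)ᵀ) p = (ddM c e F p)ᵀ := rfl

/-- The logarithmic derivative of a map into the orthogonal group is skew. -/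
theorem transpose_inv_mul_dzMat (he : e ∈ IsManifold.maximalAtlas 𝓘(ℂ) ω M) (hp : p ∈ e.source)
    {F : M → Mat n} (hF : MatSmoothAt F p) (ho : ∀ q, F q ∈ orthogonalMats n) :
    ((F p)⁻¹ * dzMat e F p)ᵀ = -((F p)⁻¹ * dzMat e F p) := by
  have h1 : ∀ q, (F q)ᵀ * F q = 1 := by
    intro q
    obtain ⟨h2, h3⟩ := mem_orthogonalMats.1 (ho q)
    rw [unitaryMats, Set.mem_ofPred_eq, Matrix.mem_unitaryGroup_iff'] at h2
    rw [← h2, Matrix.star_eq_conjTranspose, Matrix.conjTranspose]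
    nth_rewrite 1 [← h3]
    rfl
  have hd := hF.matDiffAt he hp
  have hdt : MatDiffAt e (fun q => (F q)ᵀ) p := fun a b => hd b a
  have h4 := ddM_mul (c := -Complex.I) hdt hd hp
  simp_rw [h1] at h4
  rw [ddM_const, ddM_transpose] at h4
  rw [dzMat_eq_ddM, Matrix.inv_eq_left_inv (h1 p), Matrix.transpose_mul, Matrix.transpose_transpose]
  exact eq_neg_of_add_eq_zero_left h4.symm

/-- With r = 2s, the condition conj Φ = λ^{-r}Φ says that λ^{-s}Φ is real. The factor λ^{-s} is
constant on the surface, so the logarithmic derivative and A do not change. -/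
theorem IsExtendedSolutionU.zpow_smul {r s : ℕ} (hr : r = 2 * s) (h : IsExtendedSolutionU Φ)
    (hΦ : ∀ p, Φ p ∈ OmegaReal r n) :
    IsExtendedSolutionO fun p z => ((z : ℂ) ^ (-(s : ℤ))) • Φ p z := by
  have hsm := contMDiff_zpow_smul h.2.1 (-(s : ℤ))
  have hval := matSmoothAt_of_contMDiff h.2.1
  have ho : ∀ p (z : Circle), ((z : ℂ) ^ (-(s : ℤ))) • Φ p z ∈ orthogonalMats n := by
    intro p z
    rw [mem_orthogonalMats]
    refine ⟨zpow_smul_mem_unitaryMats ((h.1 p).1 z) z _, ?_⟩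
    rw [smul_map_conj, (hΦ p).2 z, smul_smul, ← zpow_add₀ (Circle.coe_ne_zero z)]
    congr 2
    rw [hr]
    push_cast
    ring
  refine ⟨fun p => ⟨ho p, ?_, contMDiff_loop (Φ := fun p z => (z : ℂ) ^ (-(s : ℤ)) • Φ p z) hsm p⟩, hsm, fun e he => ?_⟩
  · beta_reduce
    rw [(h.1 p).2.1, Circle.coe_one, one_zpow, one_smul]
  · obtain ⟨A, hA⟩ := h.2.2 e he
    refine ⟨A, fun p hp => ⟨?_, fun z => ?_⟩⟩
    -- At λ = -1 the logarithmic derivative is 2A; being that of a map into O(n), it is skew, and so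
    -- is A.
    · have h1 := transpose_inv_mul_dzMat he hp (matSmoothAt_of_contMDiff
        (Φ := fun p z => (z : ℂ) ^ (-(s : ℤ)) • Φ p z) hsm (-1) p)
        fun q => ho q (-1)
      rw [inv_mul_dzMat_zpow_smul he hp hval _ _ ((h.1 p).1 _), (hA p hp).2 (-1), Matrix.transpose_smul,
        ← smul_neg] at h1
      have h2 : (1 - ((-1 : Circle) : ℂ)⁻¹) ≠ 0 := by
        rw [Circle.coe_neg, Circle.coe_one]
        norm_num
      exact smul_right_injective _ h2 h1
    · rw [inv_mul_dzMat_zpow_smul he hp hval _ _ ((h.1 p).1 z)]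
      exact (hA p hp).2 z

theorem IsExtendedSolutionO.of_zpow_smul {r s : ℕ} (hr : r = 2 * s)
    (hΦ : ∀ p, Φ p ∈ OmegaPoly r n)
    (h : IsExtendedSolutionO fun p z => ((z : ℂ) ^ (-(s : ℤ))) • Φ p z) :
    IsExtendedSolutionU Φ ∧ ∀ p, Φ p ∈ OmegaReal r n := by
  set Ψ : M → Circle → Mat n := fun p z => ((z : ℂ) ^ (-(s : ℤ))) • Φ p z with hΨ
  have hval := matSmoothAt_of_contMDiff h.2.1
  have hΦΨ : ∀ p (z : Circle), Φ p z = (z : ℂ) ^ (s : ℤ) • Ψ p z := by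
    intro p z
    rw [hΨ]
    beta_reduce
    rw [smul_smul, ← zpow_add₀ (Circle.coe_ne_zero z), add_neg_cancel, zpow_zero, one_smul]
  clear_value Ψ
  have hsm := contMDiff_zpow_smul h.2.1 s
  simp_rw [← hΦΨ] at hsm
  refine ⟨⟨fun p => (hΦ p).1, hsm, fun e he => ?_⟩, fun p => ⟨hΦ p, fun z => ?_⟩⟩
  · obtain ⟨A, hA⟩ := h.2.2 e he
    refine ⟨A, fun p hp => ⟨Set.mem_univ _, fun z => ?_⟩⟩
    have h1 := inv_mul_dzMat_zpow_smul he hp hval s z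
      (mem_orthogonalMats.1 ((h.1 p).1 z)).1
    simp_rw [← hΦΨ] at h1
    rw [h1]
    exact (hA p hp).2 z
  · have h1 := (mem_orthogonalMats.1 ((h.1 p).1 z)).2
    rw [hΦΨ, smul_map_conj, h1, smul_smul, ← zpow_add₀ (Circle.coe_ne_zero z), hr]
    congr 2
    push_cast
    ring

end Orthogonal

end UnitonFact

end

/-! ### The main theorem -/

theorem mainTheorem1 {M : Type*} [TopologicalSpace M] [T2Space M] [ConnectedSpace M]
    [ChartedSpace ℂ M] [IsManifold 𝓘(ℂ) ω M] (n s r : ℕ) (hr : r = 2 * s)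
    (Φ : M → Circle → UnitonFact.Mat n) (hΦ : ∀ p, Φ p ∈ UnitonFact.OmegaPoly r n) :
    -- the two forms of the hypothesis are equivalent
    ((UnitonFact.IsExtendedSolutionU Φ ∧ ∀ p, Φ p ∈ UnitonFact.OmegaReal r n) ↔
      UnitonFact.IsExtendedSolutionO (fun p z => ((z : ℂ) ^ (-(s : ℤ))) • Φ p z)) ∧
    (UnitonFact.IsExtendedSolutionU Φ → (∀ p, Φ p ∈ UnitonFact.OmegaReal r n) →
      -- there is at least one adapted choice of meromorphic data
      (∃ (X : M → Submodule ℂ (UnitonFact.Coef r n)) (m : ℕ)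
          (L : Fin m → M → UnitonFact.Coef r n),
        UnitonFact.IsHolomorphicSubbundle X ∧
        UnitonFact.Generates X (fun p => UnitonFact.grass (Φ p)) ∧
        UnitonFact.IsMeromorphicSpanningSet X L ∧
        ∀ u ≤ r, UnitonFact.IsAdapted (fun p => UnitonFact.grass (Φ p)) L u) ∧
      ∀ startU : Bool, ∃ α : ℕ → M → Submodule ℂ (UnitonFact.E n),
        UnitonFact.IsUnitonFactorization r Φ α ∧
        UnitonFact.IsAlternatingFiltration startU r (UnitonFact.partialProd α) ∧
        -- each quadratic factor is real of degree 2
        (∀ l, 1 ≤ l → l ≤ s → ∀ p,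
          (fun z => UnitonFact.eta (α (2 * l - 1) p) z * UnitonFact.eta (α (2 * l) p) z) ∈
            UnitonFact.OmegaReal 2 n) ∧
        -- each even partial product is real
        (∀ j, 1 ≤ j → j ≤ s → ∀ p,
          UnitonFact.partialProd α (2 * j) p ∈ UnitonFact.OmegaReal (2 * j) n) ∧
        -- the unitons in terms of `W`
        (∀ i, 1 ≤ i → i ≤ r → ∀ᶠ p in codiscrete M,
          (α i p : Set (UnitonFact.E n)) =
            (fun f => ∑ t ∈ Finset.range i, Matrix.toEuclideanLin
              (UnitonFact.loopCoeff (UnitonFact.partialProd α (i - 1) p) t)ᴴ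
                (UnitonFact.P (t : ℤ) f)) ''
              (UnitonFact.stepSpace (UnitonFact.grass (Φ p))
                (UnitonFact.altCount startU r i) i : Set (UnitonFact.H n))) ∧
        -- the unitons in terms of meromorphic spanning sets
        ∀ (X : M → Submodule ℂ (UnitonFact.Coef r n)) (m : ℕ)
          (L : Fin m → M → UnitonFact.Coef r n),
          UnitonFact.IsHolomorphicSubbundle X →
          UnitonFact.Generates X (fun p => UnitonFact.grass (Φ p)) →
          UnitonFact.IsMeromorphicSpanningSet X L →
          ∀ i, 1 ≤ i → i ≤ r →
            -- one inclusion always holds, and equality holds for adapted data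
            (∀ᶠ p in codiscrete M, ∀ e ∈ IsManifold.maximalAtlas 𝓘(ℂ) ω M, p ∈ e.source →
              UnitonFact.explicitSpan (UnitonFact.partialProd α (i - 1) p) e L
                (UnitonFact.altCount startU r i) i p ≤ α i p) ∧
            ((UnitonFact.altCount startU r i = 0 ∨
              UnitonFact.IsAdapted (fun p => UnitonFact.grass (Φ p)) L
                (UnitonFact.altCount startU r i)) →
              ∀ᶠ p in codiscrete M, ∀ e ∈ IsManifold.maximalAtlas 𝓘(ℂ) ω M, p ∈ e.source →
                α i p = UnitonFact.explicitSpan (UnitonFact.partialProd α (i - 1) p) e L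
                  (UnitonFact.altCount startU r i) i p)) := by
  refine ⟨⟨fun h => h.1.zpow_smul hr h.2, fun h => h.of_zpow_smul hr hΦ⟩, fun h hreal => ?_⟩
  have hsol := UnitonFact.polySolution_of_isExtendedSolutionU h hΦ
  constructor
  · obtain ⟨m, L, hL, hadapted⟩ := hsol.exists_adapted
    -- The generating bundle X is W / λ^r H₊ itself.
    exact ⟨_, m, L, hsol.isHolomorphicSubbundle, hsol.generates, hL, hadapted⟩
  · intro startU
    obtain ⟨R, hR⟩ := hsol.exists_factorization (UnitonFact.altType startU r)
    refine ⟨UnitonFact.ranges R, hR.isUnitonFactorization, hR.isAlternatingFiltration,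
      fun l hl hls p => ?_, fun j _ hj => hR.isReal hr hreal hj, fun i hi hir => ?_,
      fun X m L hX hXW hL i hi hir => ?_⟩
    · obtain ⟨l, rfl⟩ : ∃ j, l = j + 1 := ⟨l - 1, by omega⟩
      have hp := hR.isReal_factor hr hreal (l := l) (by omega) p
      rwa [show 2 * (l + 1) - 1 = 2 * l + 1 by omega, show 2 * (l + 1) = 2 * l + 2 by omega]
    · obtain ⟨i, rfl⟩ : ∃ j, i = j + 1 := ⟨i - 1, by omega⟩
      filter_upwards [hR.ranges_eq (i := i) (by omega)] with p hp
      rw [hp, Submodule.map_coe]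
      exact Set.image_congr fun f _ => UnitonFact.evalMap_apply _ _ f
    · obtain ⟨i, rfl⟩ : ∃ j, i = j + 1 := ⟨i - 1, by omega⟩
      exact ⟨hR.explicitSpan_le hXW hL (by omega),
        hR.ranges_eq_explicitSpan hX hXW hL (by omega)⟩
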